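/- **Setting.** Let $\widehat P$ be a finite, linearly ordered set of processes and let $L$ be a finite set of labels; $\bot\notin L$ is the null label. A multiprogram $P$ has finitely many threads, each belonging to one process. A thread is a program that, depending on the operations it has completed so far, issues invocations of: $\mathrm{read}(x)$ and $\mathrm{write}(x,v)$ on variables shared by the threads of its process; $\mathrm{bcast}(u,l)$ (broadcast the update $u$ with label $l\in L\cup\{\bot\}$); and $\mathrm{deliver}()$ (which returns an update and its label). A (finite) computation $C$ of $P$ consists of one finite sequence for each thread, obtained by completing the thread's successive invocations with arbitrary responses. $O_C$ is the set of its operations, $O_C|p$ is the set of those of process $p$, and $\to_{\mathrm{prog}}$ (program order) is the union of the orders of the individual threads. A sequence of operations on variables is valid if each read returns the most recently written value (or the initial value if there is none). **Partial-order broadcast, $\mathrm{POB}(L)$.** $C$ satisfies $\mathrm{POB}(L)$ if there are total orders $L_p$ of $O_C|p$, one for each process $p$, such that: 1. each $L_p$ is valid: it is valid on variables, no $\mathrm{deliver}(u,l)$ precedes $\mathrm{bcast}(u,l)$, and no $\mathrm{deliver}(u,l)$ occurs twice; 2. $L_p$ extends $\to_{\mathrm{prog}}$ on $O_C|p$, and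 orders $\mathrm{deliver}(u_1,l_1)$ before $\mathrm{deliver}(u_2,l_2)$ whenever $\mathrm{bcast}(u_1,l_1)\to_{\mathrm{prog}}\mathrm{bcast}(u_2,l_2)$; 3. for each $l\in L$, all the $L_p$ agree on the order of the deliveries of the updates with label $l$; 4. for all $p,u,l$: $\mathrm{bcast}(u,l)\in O_C$ if and only if $\mathrm{deliver}(u,l)\in O_C|p$. **Message-passing network, $\mathrm{NW}$.** Here the operations are $\mathrm{send}(s,d,m)$ and $\mathrm{recv}(s,d,m)$ (source, destination, contents), and operations on variables and queues local to a process. Happens-before is the transitive closure of the union of program order; the order from $\mathrm{send}(s,d,m)$ to $\mathrm{recv}(s,d,m)$; the order from $\mathrm{recv}(s,d,m)$ to $\mathrm{recv}(s,d,m')$ when $\mathrm{send}(s,d,m)\to_{\mathrm{prog}}\mathrm{send}(s,d,m')$; and the order from a write of a value to a local variable to the reads of that variable that return this value. A computation $\widehat C$ satisfies $\mathrm{NW}$ if for each process there is a total order of its operations that is valid for each variable and queue, contains each $\mathrm{send}(s,d,m)$ and each $\mathrm{recv}(s,d,m)$ at most once, and extends happens-before, and if moreover $\mathrm{recv}(s,d,m)\in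 O_{\widehat C}$ if and only if $\mathrm{send}(s,d,m)\in O_{\widehat C}$. **The timestamp transformation $\mathrm{TS}_L$.** Each process $p$ has integer variables $\mathit{localcounter}$, $\mathit{counter}[q]$ and $T[q]$ ($q\in\widehat P$), initially $0$; a priority queue $\mathit{priorityQ}[l]$ for each $l\in L$; and a fifo queue $\mathit{fifoQ}[q]$ for each $q\in\widehat P$; all queues are initially empty. Queue elements $e=[\mathit{update},\mathit{ts},\mathit{counter},\mathit{src}]$ are ordered in priority queues lexicographically by $(\mathit{ts},\mathit{src})$. To enqueue $e$ with label $l$ and source $s$ means to insert it into $\mathit{priorityQ}[l]$ if $l\ne\bot$, and into $\mathit{fifoQ}[s]$ if $l=\bot$. Reads and writes are unchanged. $\mathrm{bcast}(u,l)$ at $p$ becomes $\mathrm{send}(p,p,[\text{request},u,l])$. An element $e$ is *deliverable* if $e.\mathit{counter}=\mathit{counter}[e.\mathit{src}]+1$ and either $e$ is the minimum of some $\mathit{priorityQ}[l]$ and $e.\mathit{ts}\le T[q]$ for all $q$, or $e$ is the head of some $\mathit{fifoQ}[q]$. $\mathrm{deliver}()$ at $p$: while no element is deliverable, receive and handle one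 message; then choose a deliverable element $e$, remove it from its queue, set $\mathit{counter}[e.\mathit{src}]:=e.\mathit{counter}$, and return $e.\mathit{update}$ with its label. Handling a message from $s$ at $p$: * $[\text{request},u,l]$: increment $T[p]$ and $\mathit{localcounter}$ by $1$; let $e=[u,T[p],\mathit{localcounter},p]$; enqueue $e$ with label $l$ and source $p$; send $[\text{ord},l,e]$ to all other processes. * $[\text{ts},t,q]$: set $T[q]:=t$. * $[\text{ord},l,e]$: set $T[s]:=e.\mathit{ts}$; enqueue $e$ with label $l$ and source $s$; if $e.\mathit{ts}>T[p]$, then set $T[p]:=e.\mathit{ts}$ and send $[\text{ts},T[p],p]$ to all other processes. A finite computation $\widehat C$ of $\mathrm{TS}_L(P)$ has one finite sequence of target operations for each thread, in which all calls have returned, except that a thread may be left waiting forever inside a last call of $\mathrm{deliver}$ for a message to receive. Its interpretation is the computation $C$ of $P$ formed by the calls that have returned, with the responses they returned. **Theorem.** Let $P$ be a multiprogram in which at most one thread of each process calls $\mathrm{deliver}$. Then $\mathrm{TS}_L(P)$ correctly implements $\mathrm{POB}(L)$ on $\mathrm{NW}$, in the following sense. Let $\widehat C$ be a finite computation of $\mathrm{TS}_L(P)$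 that satisfies $\mathrm{NW}$, with interpretation $C$. Assume that updates are unique (no two operations of $C$ broadcast the same labeled update), and that no process stops calling $\mathrm{deliver}$ too early: each process either has a thread left waiting inside a call of $\mathrm{deliver}$, or has completed at least as many calls of $\mathrm{deliver}$ in $C$ as there are $\mathrm{bcast}$ operations in $C$. Then $C$ is a computation of $P$ that satisfies $\mathrm{POB}(L)$. In particular, every process delivers every broadcast update exactly once. -/

import Mathlib

namespace TimestampBroadcast

/-! ## Operations, computations, program order -/

/-- Completed operations on read/write variables: `read x v` returns `v`, `write x v` stores `v`. -/
inductive VarOp (X A : Type) : Type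
  | read (x : X) (v : A)
  | write (x : X) (v : A)

/-- A computation: for each thread its finite sequence of completed operations. -/
abbrev MultiComputation (Thr Op : Type) : Type := Thr → List Op

/-- The operations (operation occurrences) of a computation: a thread and a position in its
sequence. -/
abbrev Occ {Thr Op : Type} (C : MultiComputation Thr Op) : Type := (t : Thr) × Fin (C t).length

/-- The completed operation at an occurrence. -/
def Occ.op {Thr Op : Type} {C : MultiComputation Thr Op} (o : Occ C) : Op := (C o.1).get o.2

/-- Program order: the union of the orders of the individual threads. -/
def ProgOrder {Thr Op : Type} (C : MultiComputation Thr Op) (a b : Occ C) : Prop :=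
  a.1 = b.1 ∧ a.2.val < b.2.val

/-- `O_C | p`: the operations of the threads of `p`. -/
def opsOf {Proc Thr Op : Type} (owner : Thr → Proc) (C : MultiComputation Thr Op) (p : Proc) :
    Set (Occ C) :=
  {o | owner o.1 = p}

/-- The sequence `l` realizes a total order of the set `A`. -/
def IsTotalOrderOf {α : Type} (l : List α) (A : Set α) : Prop :=
  l.Nodup ∧ ∀ a, a ∈ l ↔ a ∈ A

/-- `a` occurs before `b` in the sequence `l`. -/
def Before {α : Type} (l : List α) (a b : α) : Prop := [a, b].Sublist l

/-- On `A`, the relation `R` extends the relation `T`. -/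
def Extends {α : Type} (A : Set α) (R T : α → α → Prop) : Prop :=
  ∀ a₁ ∈ A, ∀ a₂ ∈ A, T a₁ a₂ → R a₁ a₂

/-- On `A`, the relations `R` and `T` agree. -/
def Agree {α : Type} (A : Set α) (R T : α → α → Prop) : Prop :=
  ∀ a₁ ∈ A, ∀ a₂ ∈ A, (R a₁ a₂ ↔ T a₁ a₂)

/-- Validity of a sequence of operations on variables: each read returns the value of the most
recent preceding write to the same variable, or the initial value if there is none. -/
def VarValid {X A : Type} (init : X → A) (S : List (VarOp X A)) : Prop :=
  ∀ pre x v post, S = pre ++ VarOp.read x v :: post →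
    (∃ a b, pre = a ++ VarOp.write x v :: b ∧ ∀ w, VarOp.write x w ∉ b) ∨
      ((∀ w, VarOp.write x w ∉ pre) ∧ v = init x)

/-- A sequence of operations is a run of a sequential object with transition relation `step`. -/
inductive Runs {σ Op : Type} (step : σ → Op → σ → Prop) : σ → List Op → σ → Prop
  | nil (s : σ) : Runs step s [] s
  | cons {s s' s'' : σ} {o : Op} {S : List Op} :
      step s o s' → Runs step s' S s'' → Runs step s (o :: S) s''

/-! ## Specification level: multiprograms and the partial-order broadcast model

A label is an element of `Option L`; `none` is the null label of unlabeled updates. -/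

/-- Invocations of the specification level. -/
inductive SpecInv (V Val U L : Type) : Type
  | read (x : V)
  | write (x : V) (v : Val)
  | bcast (u : U) (l : Option L)
  | deliver

/-- Completed operations of the specification level. -/
inductive SpecOp (V Val U L : Type) : Type
  | var (o : VarOp V Val)
  | bcast (u : U) (l : Option L)
  | deliver (u : U) (l : Option L)

/-- The invocation of a completed operation. -/
def SpecOp.inv {V Val U L : Type} : SpecOp V Val U L → SpecInv V Val U L
  | .var (.read x _) => .read x
  | .var (.write x v) => .write x v
  | .bcast u l => .bcast u l
  | .deliver _ _ => .deliver

/-- The part of an operation that concerns variables. -/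
def SpecOp.var? {V Val U L : Type} : SpecOp V Val U L → Option (VarOp V Val)
  | .var o => some o
  | _ => none

/-- The labeled update returned by a deliver. -/
def SpecOp.deliver? {V Val U L : Type} : SpecOp V Val U L → Option (U × Option L)
  | .deliver u l => some (u, l)
  | _ => none

/-- A multiprogram. Each thread belongs to a process; the threads of a process `p` share local
variables named by `V`, with initial values `init p`. A thread is a program: `next t h` is the set
of invocations that thread `t` may issue after it has performed the completed operations `h`. -/
structure Multiprogram (Proc Thr V Val U L : Type) : Type where
  owner : Thr → Proc
  init : Proc → V → Val
  next : Thr → List (SpecOp V Val U L) → Set (SpecInv V Val U L)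

section Spec

variable {Proc Thr V Val U L : Type}

/-- `h` is a finite sequence of completed operations of thread `t`: each invocation is issued by
the program of `t`, and completed by an arbitrary response. -/
def Multiprogram.Generates (P : Multiprogram Proc Thr V Val U L) (t : Thr)
    (h : List (SpecOp V Val U L)) : Prop :=
  ∀ pre o post, h = pre ++ o :: post → o.inv ∈ P.next t pre

/-- `C` is a finite computation of `P`. -/
def Multiprogram.IsComputation (P : Multiprogram Proc Thr V Val U L)
    (C : MultiComputation Thr (SpecOp V Val U L)) : Prop :=
  ∀ t, P.Generates t (C t)

/-- Thread `t` calls `deliver` in some computation. -/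
def Multiprogram.CallsDeliver (P : Multiprogram Proc Thr V Val U L) (t : Thr) : Prop :=
  ∃ h, P.Generates t h ∧ SpecInv.deliver ∈ P.next t h

/-- The set of broadcast operations. -/
def bcasts (C : MultiComputation Thr (SpecOp V Val U L)) : Set (Occ C) :=
  {o | ∃ u l, o.op = .bcast u l}

/-- The set of deliver operations. -/
def delivers (C : MultiComputation Thr (SpecOp V Val U L)) : Set (Occ C) :=
  {o | ∃ u l, o.op = .deliver u l}

/-- Update objects are unique: no two operations broadcast the same labeled update. -/
def UniqueUpdates (C : MultiComputation Thr (SpecOp V Val U L)) : Prop :=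
  ∀ (a b : Occ C) (u : U) (l : Option L), a.op = .bcast u l → b.op = .bcast u l → a = b

/-- Validity at the specification level: variables behave as such, no update is delivered more
than once, and no deliver precedes the corresponding broadcast (which need not be present). -/
def SpecValid (init : V → Val) (S : List (SpecOp V Val U L)) : Prop :=
  VarValid init (S.filterMap SpecOp.var?) ∧
  (S.filterMap SpecOp.deliver?).Nodup ∧
  ∀ u l, ¬ Before S (.deliver u l) (.bcast u l)

/-- The deliver relation: delivers ordered as the corresponding broadcasts in program order. -/
def DelOrder (C : MultiComputation Thr (SpecOp V Val U L)) (x y : Occ C) : Prop :=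
  ∃ u₁ l₁ u₂ l₂, x.op = .deliver u₁ l₁ ∧ y.op = .deliver u₂ l₂ ∧
    ∃ b₁ b₂ : Occ C, b₁.op = .bcast u₁ l₁ ∧ b₂.op = .bcast u₂ l₂ ∧ ProgOrder C b₁ b₂

/-- In the sequence `S`, update `u₁` with label `l` is delivered before update `u₂` with the same
label `l`. -/
def DeliveredBefore (S : List (SpecOp V Val U L)) (l : L) (u₁ u₂ : U) : Prop :=
  Before S (.deliver u₁ (some l)) (.deliver u₂ (some l))

/-- The updates with label `l` that are delivered in `C`. -/
def deliveredUpdates (C : MultiComputation Thr (SpecOp V Val U L)) (l : L) : Set U :=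
  {u | ∃ o : Occ C, o.op = .deliver u (some l)}

/-- The partial-order broadcast model. -/
def POB (owner : Thr → Proc) (init : Proc → V → Val)
    (C : MultiComputation Thr (SpecOp V Val U L)) : Prop :=
  ∃ seq : Proc → List (Occ C),
    (∀ p, IsTotalOrderOf (seq p) (opsOf owner C p) ∧ SpecValid (init p) ((seq p).map Occ.op)) ∧
    (∀ p, Extends (opsOf owner C p) (Before (seq p))
      (fun a b => ProgOrder C a b ∨ DelOrder C a b)) ∧
    (∀ p q, ∀ l : L, Agree (deliveredUpdates C l)
      (DeliveredBefore ((seq p).map Occ.op) l) (DeliveredBefore ((seq q).map Occ.op) l)) ∧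
    (∀ p u l, (∃ o : Occ C, o.op = .bcast u l) ↔ (∃ o ∈ opsOf owner C p, o.op = .deliver u l))

end Spec

/-! ## Target level: the message-passing network model -/

/-- Queue elements: update, timestamp, counter, source. -/
structure QElem (Proc U : Type) : Type where
  update : U
  ts : ℕ
  counter : ℕ
  src : Proc

/-- Priority of a queue element: the pair (timestamp, source), ordered lexicographically. -/
def QElem.key {Proc U : Type} (e : QElem Proc U) : ℕ ×ₗ Proc := toLex (e.ts, e.src)

/-- Message contents. -/
inductive Msg (Proc U L : Type) : Type
  | localBroadcastRequest (u : U) (l : Option L)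
  | tsUpdate (timestamp : ℕ) (q : Proc)
  | ordMsg (l : Option L) (e : QElem Proc U)

/-- The numerical local variables `T[q]`, `counter[q]` and `local-counter`. -/
inductive Reg (Proc : Type) : Type
  | T (q : Proc)
  | counter (q : Proc)
  | localCounter

/-- Completed operations on a queue (`first` looks at the element that `deq` would remove). -/
inductive QueueOp (E : Type) : Type
  | enq (e : E)
  | deq (e : E)
  | first (e : E)
  | isEmpty (b : Bool)

/-- Sequential specification of a priority queue; `deq` is extract-min. -/
def pqStep {Proc U : Type} [LinearOrder Proc] (s : Multiset (QElem Proc U)) :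
    QueueOp (QElem Proc U) → Multiset (QElem Proc U) → Prop
  | .enq e, s' => s' = e ::ₘ s
  | .deq e, s' => s = e ::ₘ s' ∧ ∀ x ∈ s', e.key ≤ x.key
  | .first e, s' => s' = s ∧ e ∈ s ∧ ∀ x ∈ s, e.key ≤ x.key
  | .isEmpty b, s' => s' = s ∧ (b = true ↔ s = 0)

/-- Sequential specification of a fifo queue. -/
def fifoStep {E : Type} (s : List E) : QueueOp E → List E → Prop
  | .enq e, s' => s' = s ++ [e]
  | .deq e, s' => s = e :: s'
  | .first e, s' => s' = s ∧ s.head? = some e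
  | .isEmpty b, s' => s' = s ∧ (b = true ↔ s = [])

/-- Completed operations of the target level: operations on the (copies of the) program's
variables, on the numerical variables and queues of the transformation, and
`send(source, destination, contents)`, `recv(source, destination, contents)`. -/
inductive TargetOp (Proc V Val U L : Type) : Type
  | var (o : VarOp V Val)
  | reg (o : VarOp (Reg Proc) ℕ)
  | priorityQ (l : L) (o : QueueOp (QElem Proc U))
  | fifoQ (q : Proc) (o : QueueOp (QElem Proc U))
  | send (s d : Proc) (m : Msg Proc U L)
  | recv (s d : Proc) (m : Msg Proc U L)

section Target

variable {Proc Thr V Val U L : Type}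

def TargetOp.var? : TargetOp Proc V Val U L → Option (VarOp V Val)
  | .var o => some o
  | _ => none

def TargetOp.reg? : TargetOp Proc V Val U L → Option (VarOp (Reg Proc) ℕ)
  | .reg o => some o
  | _ => none

open scoped Classical in
noncomputable def TargetOp.priorityQ? (l : L) :
    TargetOp Proc V Val U L → Option (QueueOp (QElem Proc U))
  | .priorityQ l' o => if l' = l then some o else none
  | _ => none

open scoped Classical in
noncomputable def TargetOp.fifoQ? (q : Proc) :
    TargetOp Proc V Val U L → Option (QueueOp (QElem Proc U))
  | .fifoQ q' o => if q' = q then some o else none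
  | _ => none

def TargetOp.send? : TargetOp Proc V Val U L → Option (Proc × Proc × Msg Proc U L)
  | .send s d m => some (s, d, m)
  | _ => none

def TargetOp.recv? : TargetOp Proc V Val U L → Option (Proc × Proc × Msg Proc U L)
  | .recv s d m => some (s, d, m)
  | _ => none

/-- Validity of a sequence of operations of one process at the target level: for each object (a
variable, a queue, a message) the subsequence of operations on it is valid. Numerical variables
start at `0`, queues start empty; a message is sent at most once and received at most once. -/
def TargetValid [LinearOrder Proc] (init : V → Val) (S : List (TargetOp Proc V Val U L)) : Prop :=
  VarValid init (S.filterMap TargetOp.var?) ∧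
  VarValid (fun _ => 0) (S.filterMap TargetOp.reg?) ∧
  (∀ l, ∃ s, Runs pqStep 0 (S.filterMap (TargetOp.priorityQ? l)) s) ∧
  (∀ q, ∃ s, Runs fifoStep [] (S.filterMap (TargetOp.fifoQ? q)) s) ∧
  (S.filterMap TargetOp.send?).Nodup ∧
  (S.filterMap TargetOp.recv?).Nodup

/-- Message causality. -/
def MessageOrder (C : MultiComputation Thr (TargetOp Proc V Val U L)) (x y : Occ C) : Prop :=
  ∃ s d m, x.op = .send s d m ∧ y.op = .recv s d m

/-- FIFO channel causality. -/
def FifoChannel (C : MultiComputation Thr (TargetOp Proc V Val U L)) (x y : Occ C) : Prop :=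
  ∃ s d m m', x.op = .recv s d m ∧ y.op = .recv s d m' ∧
    ∃ a b : Occ C, a.op = .send s d m ∧ b.op = .send s d m' ∧ ProgOrder C a b

/-- Writes-into causality (variables are local to a process). -/
def WritesInto (owner : Thr → Proc) (C : MultiComputation Thr (TargetOp Proc V Val U L))
    (x y : Occ C) : Prop :=
  owner x.1 = owner y.1 ∧
    ((∃ w z, x.op = .var (.write w z) ∧ y.op = .var (.read w z)) ∨
      (∃ w z, x.op = .reg (.write w z) ∧ y.op = .reg (.read w z)))

/-- Happens-before. -/
def HappensBefore (owner : Thr → Proc) (C : MultiComputation Thr (TargetOp Proc V Val U L)) :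
    Occ C → Occ C → Prop :=
  Relation.TransGen fun x y =>
    ProgOrder C x y ∨ MessageOrder C x y ∨ FifoChannel C x y ∨ WritesInto owner C x y

/-- The message-passing network model. -/
def NW [LinearOrder Proc] (owner : Thr → Proc) (init : Proc → V → Val)
    (C : MultiComputation Thr (TargetOp Proc V Val U L)) : Prop :=
  ∃ seq : Proc → List (Occ C),
    (∀ p, IsTotalOrderOf (seq p) (opsOf owner C p) ∧ TargetValid (init p) ((seq p).map Occ.op)) ∧
    (∀ p, Extends (opsOf owner C p) (Before (seq p)) (HappensBefore owner C)) ∧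
    (∀ s d m, (∃ o : Occ C, o.op = .recv s d m) ↔ (∃ o : Occ C, o.op = .send s d m))

end Target

/-! ## Target code

`Code Op α` is a piece of sequential code of one thread, given by its possible finite executions:
`c w (some a)` says that `c` can perform the completed operations `w` and return `a`, with
arbitrary responses to the invocations; `c w none` says that `c` can perform `w` and then wait
forever for the response to an invocation. -/
def Code (Op α : Type) : Type := List Op → Option α → Prop

instance {Op : Type} : Monad (Code Op) where
  pure a := fun w r => w = [] ∧ r = some a
  bind c f := fun w r =>
    (c w none ∧ r = none) ∨ ∃ w₁ a w₂, c w₁ (some a) ∧ f a w₂ r ∧ w = w₁ ++ w₂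

/-- An operation without return value. -/
def Code.emit {Op : Type} (o : Op) : Code Op Unit := fun w r => w = [o] ∧ r = some ()

/-- An operation that returns a value (arbitrary; the memory model restricts it). -/
def Code.call {Op α : Type} (f : α → Op) : Code Op α := fun w r => ∃ a, w = [f a] ∧ r = some a

/-- The same for an operation that may also wait forever. -/
def Code.await {Op α : Type} (f : α → Op) : Code Op α := fun w r =>
  (∃ a, w = [f a] ∧ r = some a) ∨ (w = [] ∧ r = none)

/-- Nondeterministic choice. -/
def Code.choose {Op : Type} (α : Type) : Code Op α := fun w r => w = [] ∧ ∃ a, r = some a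

/-- Restrict nondeterministic choices to those for which `b` holds. -/
def Code.require {Op : Type} (b : Bool) : Code Op Unit := fun w r =>
  w = [] ∧ b = true ∧ r = some ()

/-- Some enumeration, without repetition, of a set. -/
def Code.enumerate {Op α : Type} (A : Set α) : Code Op (List α) := fun w r =>
  w = [] ∧ ∃ xs, IsTotalOrderOf xs A ∧ r = some xs

/-- `while guard do body`. -/
inductive Code.While {Op : Type} (guard : Code Op Bool) (body : Code Op Unit) : Code Op Unit
  | exit {w : List Op} : guard w (some false) → Code.While guard body w (some ())
  | guardWaits {w : List Op} : guard w none → Code.While guard body w none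
  | bodyWaits {w w' : List Op} : guard w (some true) → body w' none →
      Code.While guard body (w ++ w') none
  | again {w w' w'' : List Op} {r : Option Unit} : guard w (some true) → body w' (some ()) →
      Code.While guard body w'' r → Code.While guard body (w ++ w' ++ w'') r

section Algorithm

variable {Proc Thr V Val U L : Type}

/-- Read a numerical variable. -/
def readReg (x : Reg Proc) : Code (TargetOp Proc V Val U L) ℕ := Code.call fun v => .reg (.read x v)

/-- Write a numerical variable. -/
def writeReg (x : Reg Proc) (v : ℕ) : Code (TargetOp Proc V Val U L) Unit :=
  Code.emit (.reg (.write x v))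

/-- `CanExtract(priorityQ[l])`. -/
def canExtract (l : L) : Code (TargetOp Proc V Val U L) Bool := do
  if ← Code.call fun b => .priorityQ l (.isEmpty b) then
    return false
  else
    let e ← Code.call fun e => .priorityQ l (.first e)
    let c ← readReg (.counter e.src)
    if e.counter = c + 1 then
      let qs ← Code.enumerate Set.univ
      qs.allM fun q => do
        let n ← readReg (.T q)
        return decide (e.ts ≤ n)
    else
      return false

/-- `CanDequeue(fifoQ[q])`. -/
def canDequeue (q : Proc) : Code (TargetOp Proc V Val U L) Bool := do
  if ← Code.call fun b => .fifoQ q (.isEmpty b) then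
    return false
  else
    let e ← Code.call fun e => .fifoQ q (.first e)
    let c ← readReg (.counter e.src)
    return decide (e.counter = c + 1)

/-- `ProcessQueueElement(e, l, source)`. -/
def enqueueElement (e : QElem Proc U) (l : Option L) (source : Proc) :
    Code (TargetOp Proc V Val U L) Unit :=
  match l with
  | some l => Code.emit (.priorityQ l (.enq e))
  | none => Code.emit (.fifoQ source (.enq e))

/-- `FifoBroadcast(m)` at `p`: send `m` to all other processes. -/
def fifoBroadcast (p : Proc) (m : Msg Proc U L) : Code (TargetOp Proc V Val U L) Unit := do
  let qs ← Code.enumerate {q | q ≠ p}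
  qs.forM fun q => Code.emit (.send p q m)

/-- `HandleMessage()` at `p`. -/
def handleMessage (p : Proc) : Code (TargetOp Proc V Val U L) Unit := do
  let (s, m) ← Code.await fun sm : Proc × Msg Proc U L => .recv sm.1 p sm.2
  match m with
  | .localBroadcastRequest u l => do
      let n ← readReg (.T p)
      writeReg (.T p) (n + 1)
      let c ← readReg .localCounter
      writeReg .localCounter (c + 1)
      let n' ← readReg (.T p)
      let c' ← readReg .localCounter
      let e : QElem Proc U := { update := u, ts := n', counter := c', src := p }
      enqueueElement e l p
      fifoBroadcast p (.ordMsg l e)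
  | .tsUpdate timestamp q => writeReg (.T q) timestamp
  | .ordMsg l e => do
      writeReg (.T s) e.ts
      enqueueElement e l s
      let n ← readReg (.T p)
      if e.ts > n then do
        writeReg (.T p) e.ts
        let n' ← readReg (.T p)
        fifoBroadcast p (.tsUpdate n' p)

/-- The condition under which `deliver` has to wait for a further message. -/
def nothingDeliverable : Code (TargetOp Proc V Val U L) Bool := do
  let ls ← Code.enumerate (Set.univ : Set L)
  if ← ls.anyM canExtract then
    return false
  else
    let qs ← Code.enumerate (Set.univ : Set Proc)
    return !(← qs.anyM canDequeue)

/-- The code of `deliver` at `p`; it returns a labeled update. -/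
def deliverCode (p : Proc) : Code (TargetOp Proc V Val U L) (U × Option L) := do
  Code.While nothingDeliverable (handleMessage p)
  match ← Code.choose (L ⊕ Proc) with
  | .inl l => do
      Code.require (← canExtract l)
      let e ← Code.call fun e => .priorityQ l (.deq e)
      writeReg (.counter e.src) e.counter
      return (e.update, some l)
  | .inr q => do
      Code.require (← canDequeue q)
      let e ← Code.call fun e => .fifoQ q (.deq e)
      writeReg (.counter e.src) e.counter
      return (e.update, none)

/-- The timestamp transformation of an invocation by process `p`. The response returned by the
code completes the invocation to an operation of the specification level. -/
def timestampCode (p : Proc) :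
    SpecInv V Val U L → Code (TargetOp Proc V Val U L) (SpecOp V Val U L)
  | .read x => do
      let v ← Code.call fun v => .var (.read x v)
      return .var (.read x v)
  | .write x v => do
      Code.emit (.var (.write x v))
      return .var (.write x v)
  | .bcast u l => do
      Code.emit (.send p p (.localBroadcastRequest u l))
      return .bcast u l
  | .deliver => do
      let ul ← deliverCode p
      return .deliver ul.1 ul.2

/-- `ThreadRun P t w h b`: the transformed thread `t` of `P` can perform the target operations `w`;
they are interpreted as the specification operations `h`. All calls have returned, except that if
`b = true` then the last one (not part of `h`) waits forever to receive a message. -/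
inductive ThreadRun (P : Multiprogram Proc Thr V Val U L) (t : Thr) :
    List (TargetOp Proc V Val U L) → List (SpecOp V Val U L) → Bool → Prop
  | start : ThreadRun P t [] [] false
  | returns {w w' : List (TargetOp Proc V Val U L)} {h : List (SpecOp V Val U L)}
      {i : SpecInv V Val U L} {o : SpecOp V Val U L} :
      ThreadRun P t w h false → i ∈ P.next t h → timestampCode (P.owner t) i w' (some o) →
      ThreadRun P t (w ++ w') (h ++ [o]) false
  | waits {w w' : List (TargetOp Proc V Val U L)} {h : List (SpecOp V Val U L)}
      {i : SpecInv V Val U L} :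
      ThreadRun P t w h false → i ∈ P.next t h → timestampCode (P.owner t) i w' none →
      ThreadRun P t (w ++ w') h true

/-- `D` is a finite computation of the transformed multiprogram, `C` is its interpretation as a
computation of `P`, and `waiting` tells which threads wait forever inside a call of `deliver`. -/
def IsTimestampComputation (P : Multiprogram Proc Thr V Val U L)
    (D : MultiComputation Thr (TargetOp Proc V Val U L)) (C : MultiComputation Thr (SpecOp V Val U L))
    (waiting : Thr → Bool) : Prop :=
  ∀ t, ThreadRun P t (D t) (C t) (waiting t)

/-- No process stops calling `deliver` too early: either some thread of the process is left
waiting inside a call of `deliver`, or the process has called `deliver` at least as often as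
updates have been broadcast. -/
def KeepsDelivering (P : Multiprogram Proc Thr V Val U L)
    (C : MultiComputation Thr (SpecOp V Val U L)) (waiting : Thr → Bool) : Prop :=
  ∀ p, (∃ t, P.owner t = p ∧ waiting t = true) ∨
    (bcasts C).ncard ≤ (delivers C ∩ opsOf P.owner C p).ncard

end Algorithm

end TimestampBroadcast

open TimestampBroadcast

namespace TimestampBroadcast

/-! ## Runs of sequential objects -/

section Runs

variable {σ Op : Type} {step : σ → Op → σ → Prop}

/-! The network orders reduce to one sequential run per process. Whatever a process does with
numerical variables, queues, receives and sends to other processes happens inside `deliver`, hence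
in a single thread. On these operations the total order of the process is therefore that thread's
own sequence (`filterMap_op_eq`), and objectwise validity turns it into a run on an explicit local
state (`NetworkRun.exists_local`). A weakest-precondition calculus shows that the run ends in a
state reachable by the atomic steps of `Reach`, and that a thread left waiting has found nothing
deliverable in that state (`ThreadRun.reach`).

Each process p sends one and the same stream of messages to all others. Every increase of T[p] is
announced, so the timestamps of the stream increase strictly and T[p] is the last of them; the
announced elements carry the counters 1, 2, ... (`Reach.sendInv`). This uses only that messages come
from processes entitled to send them, not that other streams are well formed, so there is no
circularity. Since all messages arrive, once and in fifo order, every process receives exactly the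
stream of s from s (`NetworkRun.exists_finalStates`). In the end all processes hold the same T and
have enqueued the same elements.

Safety: a labeled element is removed only when its timestamp is at most every T[q], whereas an
element that arrives later from q has a timestamp above T[q]. So no late arrival undercuts a
delivered element, and every process delivers each label in increasing order of (timestamp, source),
a pair that identifies the element. The counter test makes deliveries from one source follow the
order of its requests, labeled or not (`QInv.enqueue`, `QInv.dequeuePQ`, `Reach.deliverInv`).

Liveness: if a waiting process had undelivered elements, take one with the least key. Its counter is
the next one, its timestamp is stable because every process raises its own T to all that it
enqueues, and it is at the front of its queue; so it was deliverable (`QInv.delivered_of_blocked`).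
A process that does not wait has made enough calls, and a count shows that it has delivered
everything (`Represents.dlv_of_count`).

`Represents.pob` translates this back: a broadcast is represented by the send of its request, a
delivery by the dequeue that it performs. -/

theorem runs_nil_iff {s s' : σ} : Runs step s [] s' ↔ s' = s := by
  constructor
  · intro h; cases h; rfl
  · rintro rfl; exact .nil _

theorem runs_cons_iff {s s'' : σ} {o : Op} {w : List Op} :
    Runs step s (o :: w) s'' ↔ ∃ s', step s o s' ∧ Runs step s' w s'' := by
  constructor
  · intro h; cases h with | cons h₁ h₂ => exact ⟨_, h₁, h₂⟩
  · rintro ⟨_, h₁, h₂⟩; exact .cons h₁ h₂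

theorem runs_append_iff {s s'' : σ} {w₁ w₂ : List Op} :
    Runs step s (w₁ ++ w₂) s'' ↔ ∃ s', Runs step s w₁ s' ∧ Runs step s' w₂ s'' := by
  induction w₁ generalizing s with
  | nil => simp [runs_nil_iff]
  | cons o w ih =>
    simp only [List.cons_append, runs_cons_iff, ih]
    constructor
    · rintro ⟨a, h₁, b, h₂, h₃⟩; exact ⟨b, ⟨a, h₁, h₂⟩, h₃⟩
    · rintro ⟨b, ⟨a, h₁, h₂⟩, h₃⟩; exact ⟨a, h₁, b, h₂, h₃⟩

theorem runs_singleton_iff {s s' : σ} {o : Op} : Runs step s [o] s' ↔ step s o s' := by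
  simp [runs_cons_iff, runs_nil_iff]

end Runs

/-! ## Updating functions -/

open scoped Classical in
/-- Change one value of a function. -/
noncomputable def upd {X A : Type} (f : X → A) (x : X) (v : A) : X → A :=
  fun y => if y = x then v else f y

section Upd

variable {X A : Type} {f : X → A} {x y : X} {v : A}

@[simp] theorem upd_same : upd f x v x = v := if_pos rfl

@[simp] theorem upd_of_ne (h : y ≠ x) : upd f x v y = f y := if_neg h

@[simp] theorem upd_eq_self : upd f x (f x) = f := by
  funext z
  by_cases h : z = x
  · subst h; simp
  · simp [h]

end Upd

/-! ## The local state of a process -/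

section State

variable {Proc V Val U L : Type}

/-- The local state of a process: numerical variables and queues, together with the histories of
received and sent messages and of enqueued and dequeued elements; `log` merges the histories of
received messages and of dequeued elements. -/
structure LState (Proc U L : Type) : Type where
  reg : Reg Proc → ℕ
  pq : L → Multiset (QElem Proc U)
  fq : Proc → List (QElem Proc U)
  rcv : List (Proc × Msg Proc U L)
  snd : Proc → List (Msg Proc U L)
  enq : List ((L ⊕ Proc) × QElem Proc U)
  dlv : List ((L ⊕ Proc) × QElem Proc U)
  log : List ((Proc × Msg Proc U L) ⊕ ((L ⊕ Proc) × QElem Proc U))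

/-- The initial local state. -/
def LState.init : LState Proc U L := ⟨fun _ => 0, fun _ => 0, fun _ => [], [], fun _ => [], [], [], []⟩

/-- Assign a numerical variable. -/
noncomputable def LState.setReg (σ : LState Proc U L) (x : Reg Proc) (v : ℕ) : LState Proc U L :=
  { σ with reg := upd σ.reg x v }

/-- Record a received message. -/
def LState.receive (σ : LState Proc U L) (s : Proc) (m : Msg Proc U L) : LState Proc U L :=
  { σ with rcv := σ.rcv ++ [(s, m)], log := σ.log ++ [.inl (s, m)] }

/-- Record a sent message. -/
noncomputable def LState.sendTo (σ : LState Proc U L) (d : Proc) (m : Msg Proc U L) : LState Proc U L :=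
  { σ with snd := upd σ.snd d (σ.snd d ++ [m]) }

open scoped Classical in
/-- Record a message sent to all processes except `p`. -/
noncomputable def LState.sendOthers (σ : LState Proc U L) (p : Proc) (m : Msg Proc U L) : LState Proc U L :=
  { σ with snd := fun d => if d = p then σ.snd d else σ.snd d ++ [m] }

/-- Enqueue an element. -/
noncomputable def LState.enqueue (σ : LState Proc U L) : L ⊕ Proc → QElem Proc U → LState Proc U L
  | .inl l, e => { σ with pq := upd σ.pq l (e ::ₘ σ.pq l), enq := σ.enq ++ [(.inl l, e)] }
  | .inr q, e => { σ with fq := upd σ.fq q (σ.fq q ++ [e]), enq := σ.enq ++ [(.inr q, e)] }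

/-- Dequeue `e` from the priority queue of `l`, leaving the elements `s`. -/
noncomputable def LState.dequeuePQ (σ : LState Proc U L) (l : L) (e : QElem Proc U)
    (s : Multiset (QElem Proc U)) : LState Proc U L :=
  { σ with pq := upd σ.pq l s, dlv := σ.dlv ++ [(.inl l, e)],
           log := σ.log ++ [.inr (.inl l, e)] }

/-- Dequeue `e` from the fifo queue of `q`, leaving the elements `s`. -/
noncomputable def LState.dequeueFifo (σ : LState Proc U L) (q : Proc) (e : QElem Proc U)
    (s : List (QElem Proc U)) : LState Proc U L :=
  { σ with fq := upd σ.fq q s, dlv := σ.dlv ++ [(.inr q, e)],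
           log := σ.log ++ [.inr (.inr q, e)] }

/-- Minimal elements of a priority queue. -/
def IsMinElem [LinearOrder Proc] (s : Multiset (QElem Proc U)) (e : QElem Proc U) : Prop :=
  e ∈ s ∧ ∀ x ∈ s, e.key ≤ x.key

/-- The effect of an operation on the local state. -/
def lstep [LinearOrder Proc] (σ : LState Proc U L) : TargetOp Proc V Val U L → LState Proc U L → Prop
  | .var _, σ' => σ' = σ
  | .reg (.read x v), σ' => v = σ.reg x ∧ σ' = σ
  | .reg (.write x v), σ' => σ' = σ.setReg x v
  | .priorityQ l (.enq e), σ' => σ' = σ.enqueue (.inl l) e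
  | .priorityQ l (.deq e), σ' =>
      ∃ s, σ.pq l = e ::ₘ s ∧ (∀ x ∈ s, e.key ≤ x.key) ∧ σ' = σ.dequeuePQ l e s
  | .priorityQ l (.first e), σ' => σ' = σ ∧ IsMinElem (σ.pq l) e
  | .priorityQ l (.isEmpty b), σ' => σ' = σ ∧ (b = true ↔ σ.pq l = 0)
  | .fifoQ q (.enq e), σ' => σ' = σ.enqueue (.inr q) e
  | .fifoQ q (.deq e), σ' => ∃ s, σ.fq q = e :: s ∧ σ' = σ.dequeueFifo q e s
  | .fifoQ q (.first e), σ' => σ' = σ ∧ (σ.fq q).head? = some e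
  | .fifoQ q (.isEmpty b), σ' => σ' = σ ∧ (b = true ↔ σ.fq q = [])
  | .send _ d m, σ' => σ' = σ.sendTo d m
  | .recv s _ m, σ' => σ' = σ.receive s m

/-- The element dequeued by an operation, with its queue. -/
def TargetOp.deq? : TargetOp Proc V Val U L → Option ((L ⊕ Proc) × QElem Proc U)
  | .priorityQ l (.deq e) => some (.inl l, e)
  | .fifoQ q (.deq e) => some (.inr q, e)
  | _ => none

/-- The source and contents of a received message. -/
def TargetOp.recvFrom? : TargetOp Proc V Val U L → Option (Proc × Msg Proc U L)
  | .recv s _ m => some (s, m)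
  | _ => none

open scoped Classical in
/-- The contents of a message sent to `d`. -/
noncomputable def TargetOp.sendTo? (d : Proc) : TargetOp Proc V Val U L → Option (Msg Proc U L)
  | .send _ d' m => if d' = d then some m else none
  | _ => none

/-- The entry of `log` made by an operation. -/
def TargetOp.log? (o : TargetOp Proc V Val U L) :
    Option ((Proc × Msg Proc U L) ⊕ ((L ⊕ Proc) × QElem Proc U)) :=
  match o with
  | .recv s _ m => some (.inl (s, m))
  | .priorityQ l (.deq e) => some (.inr (.inl l, e))
  | .fifoQ q (.deq e) => some (.inr (.inr q, e))
  | _ => none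

theorem lstep_history [LinearOrder Proc] {σ σ' : LState Proc U L} {o : TargetOp Proc V Val U L}
    (h : lstep σ o σ') :
    σ'.rcv = σ.rcv ++ [o].filterMap TargetOp.recvFrom? ∧
    (∀ d, σ'.snd d = σ.snd d ++ [o].filterMap (TargetOp.sendTo? d)) ∧
    σ'.dlv = σ.dlv ++ [o].filterMap TargetOp.deq? ∧
    σ'.log = σ.log ++ [o].filterMap TargetOp.log? := by
  rcases o with _ | (_ | _) | ⟨_, (_ | _ | _ | _)⟩ | ⟨_, (_ | _ | _ | _)⟩ | ⟨_, _, _⟩ | ⟨_, _, _⟩ <;>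
    simp only [lstep] at h <;>
    first
    | (obtain ⟨_, _, _, rfl⟩ := h
       simp [TargetOp.recvFrom?, TargetOp.sendTo?, TargetOp.deq?, TargetOp.log?, LState.dequeuePQ,
         LState.dequeueFifo, LState.receive])
    | (obtain ⟨rfl, _⟩ := h
       refine ⟨?_, fun d => ?_, ?_, ?_⟩ <;> exact (List.append_nil _).symm)
    | (obtain rfl := h
       refine ⟨?_, fun d => ?_, ?_, ?_⟩ <;>
       simp only [TargetOp.recvFrom?, TargetOp.sendTo?, TargetOp.deq?, TargetOp.log?, LState.sendTo,
         List.filterMap_cons, List.filterMap_nil, List.append_nil]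
       rename_i d' m
       by_cases hd : d = d'
       · subst hd; simp
       · simp [hd, Ne.symm hd])

theorem runs_lstep_history [LinearOrder Proc] {σ σ' : LState Proc U L}
    {w : List (TargetOp Proc V Val U L)} (h : Runs lstep σ w σ') :
    σ'.rcv = σ.rcv ++ w.filterMap TargetOp.recvFrom? ∧
    (∀ d, σ'.snd d = σ.snd d ++ w.filterMap (TargetOp.sendTo? d)) ∧
    σ'.dlv = σ.dlv ++ w.filterMap TargetOp.deq? ∧
    σ'.log = σ.log ++ w.filterMap TargetOp.log? := by
  induction h with
  | nil => simp
  | @cons s s' s'' o S h _ ih =>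
    obtain ⟨a, b, c, d⟩ := lstep_history h
    obtain ⟨a', b', c', d'⟩ := ih
    have key : ∀ {β : Type} (f : TargetOp Proc V Val U L → Option β),
        (o :: S).filterMap f = [o].filterMap f ++ S.filterMap f := by
      intro β f; rw [← List.filterMap_append]; rfl
    refine ⟨?_, fun x => ?_, ?_, ?_⟩ <;> rw [key]
    · rw [a', a, List.append_assoc]
    · rw [b', b, List.append_assoc]
    · rw [c', c, List.append_assoc]
    · rw [d', d, List.append_assoc]

/-! ## Existence of local runs -/

/-- Validity of the reads of a sequence of variable operations, starting in a given store. -/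
def ReadsFrom {X A : Type} : (X → A) → List (VarOp X A) → Prop
  | _, [] => True
  | f, .read x v :: S => v = f x ∧ ReadsFrom f S
  | f, .write x v :: S => ReadsFrom (upd f x v) S

/-- `VarValid` looks back for the latest write, `ReadsFrom` carries a store forward. Peeling off the
first operation links them: a leading write plays the role of the initial value for the rest. -/
theorem VarValid.readsFrom {X A : Type} {f : X → A} {S : List (VarOp X A)} (h : VarValid f S) :
    ReadsFrom f S := by
  induction S generalizing f with
  | nil => trivial
  | cons o S ih =>
    cases o with
    | read x v =>
      refine ⟨?_, ih fun pre y w post hS => ?_⟩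
      · rcases h [] x v S rfl with ⟨a, b, h', _⟩ | ⟨_, h'⟩
        · simp at h'
        · exact h'
      · rcases h (.read x v :: pre) y w post (by simp [hS]) with ⟨a, b, h', hb⟩ | ⟨h₁, h₂⟩
        · left
          cases a with
          | nil => simp at h'
          | cons c a =>
            simp only [List.cons_append, List.cons.injEq] at h'
            exact ⟨a, b, h'.2, hb⟩
        · right; exact ⟨fun w hw => h₁ w (by simp [hw]), h₂⟩
    | write x v =>
      refine ih fun pre y w post hS => ?_
      rcases h (.write x v :: pre) y w post (by simp [hS]) with ⟨a, b, h', hb⟩ | ⟨h₁, h₂⟩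
      · cases a with
        | nil =>
          simp only [List.nil_append, List.cons.injEq, VarOp.write.injEq] at h'
          obtain ⟨⟨rfl, rfl⟩, rfl⟩ := h'
          right; exact ⟨hb, by simp⟩
        | cons c a =>
          simp only [List.cons_append, List.cons.injEq] at h'
          exact .inl ⟨a, b, h'.2, hb⟩
      · right
        have hne : y ≠ x := fun e => h₁ v (by simp [e])
        exact ⟨fun w hw => h₁ w (by simp [hw]), by simp [hne, h₂]⟩

/-- Validity is given object by object. The runs combine because an operation changes only the
component of the state that belongs to its own object. -/
theorem exists_runs_lstep [LinearOrder Proc] {w : List (TargetOp Proc V Val U L)}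
    (σ : LState Proc U L)
    (h₁ : ReadsFrom σ.reg (w.filterMap TargetOp.reg?))
    (h₂ : ∀ l, ∃ s, Runs pqStep (σ.pq l) (w.filterMap (TargetOp.priorityQ? l)) s)
    (h₃ : ∀ q, ∃ s, Runs fifoStep (σ.fq q) (w.filterMap (TargetOp.fifoQ? q)) s) :
    ∃ σ', Runs lstep σ w σ' := by
  induction w generalizing σ with
  | nil => exact ⟨σ, .nil _⟩
  | cons o w ih =>
    suffices ∃ σ₁, lstep σ o σ₁ ∧ ReadsFrom σ₁.reg (w.filterMap TargetOp.reg?) ∧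
        (∀ l, ∃ s, Runs pqStep (σ₁.pq l) (w.filterMap (TargetOp.priorityQ? l)) s) ∧
        (∀ q, ∃ s, Runs fifoStep (σ₁.fq q) (w.filterMap (TargetOp.fifoQ? q)) s) by
      obtain ⟨σ₁, h, a, b, c⟩ := this
      obtain ⟨σ₂, h'⟩ := ih σ₁ a b c
      exact ⟨σ₂, .cons h h'⟩
    cases o with
    | var o => exact ⟨σ, rfl, h₁, h₂, h₃⟩
    | send s d m => exact ⟨_, rfl, h₁, h₂, h₃⟩
    | recv s d m => exact ⟨_, rfl, h₁, h₂, h₃⟩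
    | reg o =>
      cases o with
      | read x v => exact ⟨σ, ⟨h₁.1, rfl⟩, h₁.2, h₂, h₃⟩
      | write x v => exact ⟨_, rfl, h₁, h₂, h₃⟩
    | priorityQ l o =>
      have hl := h₂ l
      simp only [List.filterMap_cons, TargetOp.priorityQ?, if_true, runs_cons_iff] at hl
      obtain ⟨s, s', hs', hs⟩ := hl
      have h₃' : ∀ q, ∃ s, Runs fifoStep (σ.fq q) (w.filterMap (TargetOp.fifoQ? q)) s := h₃
      have h₁' : ReadsFrom σ.reg (w.filterMap TargetOp.reg?) := h₁
      -- This covers all four queue operations at once; for `first` and `isEmpty` the update is the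
      -- identity.
      have h₂' : ∀ l', ∃ s₁, Runs pqStep (upd σ.pq l s' l')
          (w.filterMap (TargetOp.priorityQ? l')) s₁ := by
        intro l'
        by_cases hl : l' = l
        · subst hl; exact ⟨s, by simpa using hs⟩
        · have := h₂ l'
          simpa [TargetOp.priorityQ?, Ne.symm hl, hl] using this
      cases o with
      | enq e => exact by cases hs'; exact ⟨_, rfl, h₁', h₂', h₃'⟩
      | deq e => exact ⟨_, ⟨s', hs'.1, hs'.2, rfl⟩, h₁', h₂', h₃'⟩
      | first e =>
        obtain ⟨rfl, h, h'⟩ := hs'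
        rw [upd_eq_self] at h₂'
        exact ⟨σ, ⟨rfl, h, h'⟩, h₁', h₂', h₃'⟩
      | isEmpty b =>
        obtain ⟨rfl, h⟩ := hs'
        rw [upd_eq_self] at h₂'
        exact ⟨σ, ⟨rfl, h⟩, h₁', h₂', h₃'⟩
    | fifoQ q o =>
      have hl := h₃ q
      simp only [List.filterMap_cons, TargetOp.fifoQ?, if_true, runs_cons_iff] at hl
      obtain ⟨s, s', hs', hs⟩ := hl
      have h₂' : ∀ l, ∃ s, Runs pqStep (σ.pq l) (w.filterMap (TargetOp.priorityQ? l)) s := h₂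
      have h₁' : ReadsFrom σ.reg (w.filterMap TargetOp.reg?) := h₁
      have h₃' : ∀ l', ∃ s₁, Runs fifoStep (upd σ.fq q s' l')
          (w.filterMap (TargetOp.fifoQ? l')) s₁ := by
        intro l'
        by_cases hl : l' = q
        · subst hl; exact ⟨s, by simpa using hs⟩
        · have := h₃ l'
          simpa [TargetOp.fifoQ?, Ne.symm hl, hl] using this
      cases o with
      | enq e => exact by cases hs'; exact ⟨_, rfl, h₁', h₂', h₃'⟩
      | deq e => exact ⟨_, ⟨s', hs', rfl⟩, h₁', h₂', h₃'⟩
      | first e =>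
        obtain ⟨rfl, h⟩ := hs'
        rw [upd_eq_self] at h₃'
        exact ⟨σ, ⟨rfl, h⟩, h₁', h₂', h₃'⟩
      | isEmpty b =>
        obtain ⟨rfl, h⟩ := hs'
        rw [upd_eq_self] at h₃'
        exact ⟨σ, ⟨rfl, h⟩, h₁', h₂', h₃'⟩

end State

/-! ## Weakest preconditions of target code -/

section WP

variable {Proc V Val U L : Type}

variable [LinearOrder Proc]

/-- Every run of `c` from the local state `σ` ends with a response and a local state that
satisfy `Q`. -/
def wp {α : Type} (c : Code (TargetOp Proc V Val U L) α) (σ : LState Proc U L)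
    (Q : Option α → LState Proc U L → Prop) : Prop :=
  ∀ w r σ', c w r → Runs lstep σ w σ' → Q r σ'

/-- The postcondition that the first part of a sequential composition has to establish. -/
def bindPost {α β : Type} (f : α → Code (TargetOp Proc V Val U L) β)
    (Q : Option β → LState Proc U L → Prop) : Option α → LState Proc U L → Prop
  | none, σ => Q none σ
  | some a, σ => wp (f a) σ Q

variable {α β : Type} {σ : LState Proc U L} {Q Q' : Option α → LState Proc U L → Prop}

@[simp] theorem bindPost_some {f : α → Code (TargetOp Proc V Val U L) β}
    {Q : Option β → LState Proc U L → Prop} {a : α} : bindPost f Q (some a) σ ↔ wp (f a) σ Q := Iff.rfl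

theorem wp.mono {c : Code (TargetOp Proc V Val U L) α} (h : wp c σ Q)
    (hQ : ∀ r σ', Q r σ' → Q' r σ') :
    wp c σ Q' := fun w r σ' h₁ h₂ => hQ _ _ (h w r σ' h₁ h₂)

@[simp] theorem wp_pure {a : α} : wp (pure a : Code (TargetOp Proc V Val U L) α) σ Q ↔ Q
    (some a) σ := by
  constructor
  · intro h; exact h [] _ _ ⟨rfl, rfl⟩ (.nil _)
  · rintro h w r σ' ⟨rfl, rfl⟩ hr
    rw [runs_nil_iff] at hr; subst hr; exact h

@[simp] theorem wp_bind {c : Code (TargetOp Proc V Val U L) α}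
    {f : α → Code (TargetOp Proc V Val U L) β}
    {Q : Option β → LState Proc U L → Prop} : wp (c >>= f) σ Q ↔ wp c σ (bindPost f Q) := by
  constructor
  · intro h w r σ' hc hr
    cases r with
    | none => exact h w none σ' (.inl ⟨hc, rfl⟩) hr
    | some a =>
      intro w' r' σ'' hf hr'
      exact h _ _ _ (.inr ⟨w, a, w', hc, hf, rfl⟩) (runs_append_iff.2 ⟨_, hr, hr'⟩)
  · rintro h w r σ' (⟨hc, rfl⟩ | ⟨w₁, a, w₂, hc, hf, rfl⟩) hr
    · exact h w none σ' hc hr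
    · obtain ⟨σ₁, h₁, h₂⟩ := runs_append_iff.1 hr
      exact h w₁ _ σ₁ hc h₁ w₂ r σ' hf h₂

@[simp] theorem wp_emit {o : TargetOp Proc V Val U L} {Q : Option Unit → LState Proc U L → Prop} :
    wp (Code.emit o) σ Q ↔ ∀ σ', lstep σ o σ' → Q (some ()) σ' := by
  constructor
  · intro h σ' hs; exact h [o] _ _ ⟨rfl, rfl⟩ (runs_singleton_iff.2 hs)
  · rintro h w r σ' ⟨rfl, rfl⟩ hr; exact h _ (runs_singleton_iff.1 hr)

@[simp] theorem wp_call {f : α → TargetOp Proc V Val U L} :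
    wp (Code.call f) σ Q ↔ ∀ a σ', lstep σ (f a) σ' → Q (some a) σ' := by
  constructor
  · intro h a σ' hs; exact h [f a] _ _ ⟨a, rfl, rfl⟩ (runs_singleton_iff.2 hs)
  · rintro h w r σ' ⟨a, rfl, rfl⟩ hr; exact h _ _ (runs_singleton_iff.1 hr)

@[simp] theorem wp_await {f : α → TargetOp Proc V Val U L} :
    wp (Code.await f) σ Q ↔ Q none σ ∧ ∀ a σ', lstep σ (f a) σ' → Q (some a) σ' := by
  constructor
  · intro h
    exact ⟨h [] _ _ (.inr ⟨rfl, rfl⟩) (.nil _),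
      fun a σ' hs => h [f a] _ _ (.inl ⟨a, rfl, rfl⟩) (runs_singleton_iff.2 hs)⟩
  · rintro ⟨h₁, h₂⟩ w r σ' (⟨a, rfl, rfl⟩ | ⟨rfl, rfl⟩) hr
    · exact h₂ _ _ (runs_singleton_iff.1 hr)
    · rw [runs_nil_iff] at hr; subst hr; exact h₁

@[simp] theorem wp_choose : wp (Code.choose α : Code (TargetOp Proc V Val U L) α) σ Q ↔ ∀ a, Q
    (some a) σ := by
  constructor
  · intro h a; exact h [] _ _ ⟨rfl, a, rfl⟩ (.nil _)
  · rintro h w r σ' ⟨rfl, a, rfl⟩ hr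
    rw [runs_nil_iff] at hr; subst hr; exact h a

@[simp] theorem wp_require {b : Bool} {Q : Option Unit → LState Proc U L → Prop} :
    wp (Code.require b : Code (TargetOp Proc V Val U L) Unit) σ Q ↔ (b = true → Q (some ()) σ) := by
  constructor
  · intro h hb; exact h [] _ _ ⟨rfl, hb, rfl⟩ (.nil _)
  · rintro h w r σ' ⟨rfl, hb, rfl⟩ hr
    rw [runs_nil_iff] at hr; subst hr; exact h hb

@[simp] theorem wp_enumerate {A : Set α} {Q : Option (List α) → LState Proc U L → Prop} :
    wp (Code.enumerate A : Code (TargetOp Proc V Val U L) (List α)) σ Q ↔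
      ∀ xs, IsTotalOrderOf xs A → Q (some xs) σ := by
  constructor
  · intro h xs hx; exact h [] _ _ ⟨rfl, xs, hx, rfl⟩ (.nil _)
  · rintro h w r σ' ⟨rfl, xs, hx, rfl⟩ hr
    rw [runs_nil_iff] at hr; subst hr; exact h xs hx

@[simp] theorem wp_readReg {x : Reg Proc} {Q : Option ℕ → LState Proc U L → Prop} :
    wp (readReg x : Code (TargetOp Proc V Val U L) ℕ) σ Q ↔ Q (some (σ.reg x)) σ := by
  simp [readReg, lstep]

@[simp] theorem wp_writeReg {x : Reg Proc} {v : ℕ} {Q : Option Unit → LState Proc U L → Prop} :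
    wp (writeReg x v : Code (TargetOp Proc V Val U L) Unit) σ Q ↔ Q (some ()) (σ.setReg x v) := by
  simp [writeReg, lstep]

/-- Partial correctness suffices because executions are finite. The postcondition for a wait is
passed on separately from guard and body, since a wait inside either ends the whole loop. -/
theorem wp_while {guard : Code (TargetOp Proc V Val U L) Bool}
    {body : Code (TargetOp Proc V Val U L) Unit}
    {Q : Option Unit → LState Proc U L → Prop} (I : LState Proc U L → Prop)
    (hg : ∀ σ, I σ → wp guard σ (fun r σ' => match r with
      | none => Q none σ'
      | some false => Q (some ()) σ'
      | some true => wp body σ' (fun r' σ'' => match r' with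
        | none => Q none σ''
        | some _ => I σ''))) (hI : I σ) : wp (Code.While guard body) σ Q := by
  intro w r σ' h
  induction h generalizing σ with
  | exit h => intro hr; exact hg σ hI _ _ _ h hr
  | guardWaits h => intro hr; exact hg σ hI _ _ _ h hr
  | bodyWaits h h' =>
    intro hr
    obtain ⟨σ₁, h₁, h₂⟩ := runs_append_iff.1 hr
    exact hg σ hI _ _ _ h h₁ _ _ _ h' h₂
  | again h h' _ ih =>
    intro hr
    obtain ⟨σ₂, hr, h₃⟩ := runs_append_iff.1 hr
    obtain ⟨σ₁, h₁, h₂⟩ := runs_append_iff.1 hr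
    exact ih (hg σ hI _ _ _ h h₁ _ _ _ h' h₂) h₃

/-- Evaluate a test on the elements of a list until it succeeds. -/
theorem wp_anyM {f : α → Code (TargetOp Proc V Val U L) Bool} {F G : α → Prop} {xs : List α}
    {Q : Option Bool → LState Proc U L → Prop}
    (hf : ∀ a Q', (∀ b : Bool, (b = false → F a) → (b = true → G a) → Q' (some b) σ) → wp (f a) σ Q')
    (hQ : ∀ b : Bool, (b = false → ∀ a ∈ xs, F a) → (b = true → ∃ a ∈ xs, G a) → Q (some b) σ) :
    wp (xs.anyM f) σ Q := by
  induction xs with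
  | nil => rw [List.anyM, wp_pure]; exact hQ false (by simp) (by simp)
  | cons x xs ih =>
    rw [List.anyM, wp_bind]
    refine hf _ _ fun b h₁ h₂ => ?_
    rw [bindPost_some]
    cases b with
    | true => rw [wp_pure]; exact hQ true (by simp) fun _ => ⟨x, by simp, h₂ rfl⟩
    | false =>
      refine ih fun b h₃ h₄ => hQ b (fun hb => ?_) (fun hb => ?_)
      · simpa using ⟨h₁ rfl, h₃ hb⟩
      · obtain ⟨a, ha, h⟩ := h₄ hb
        exact ⟨a, by simp [ha], h⟩

/-- Evaluate a test on the elements of a list until it fails. -/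
theorem wp_allM {f : α → Code (TargetOp Proc V Val U L) Bool} {F G : α → Prop} {xs : List α}
    {Q : Option Bool → LState Proc U L → Prop}
    (hf : ∀ a Q', (∀ b : Bool, (b = false → F a) → (b = true → G a) → Q' (some b) σ) → wp (f a) σ Q')
    (hQ : ∀ b : Bool, (b = false → ∃ a ∈ xs, F a) → (b = true → ∀ a ∈ xs, G a) → Q (some b) σ) :
    wp (xs.allM f) σ Q := by
  induction xs with
  | nil => rw [List.allM, wp_pure]; exact hQ true (by simp) (by simp)
  | cons x xs ih =>
    rw [List.allM, wp_bind]
    refine hf _ _ fun b h₁ h₂ => ?_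
    rw [bindPost_some]
    cases b with
    | false => rw [wp_pure]; exact hQ false (fun _ => ⟨x, by simp, h₁ rfl⟩) (by simp)
    | true =>
      refine ih fun b h₃ h₄ => hQ b (fun hb => ?_) (fun hb => ?_)
      · obtain ⟨a, ha, h⟩ := h₃ hb
        exact ⟨a, by simp [ha], h⟩
      · simpa using ⟨h₂ rfl, h₄ hb⟩

end WP

/-! ## The steps of a process -/

section Steps

variable {Proc V Val U L : Type}

/-- The queue for elements with label `l` from process `s`. -/
def queueOf (l : Option L) (s : Proc) : L ⊕ Proc := l.elim (.inr s) .inl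

/-- The label of the elements of a queue. -/
def queueLabel : L ⊕ Proc → Option L
  | .inl l => some l
  | .inr _ => none

/-- The element created for a request. -/
def LState.newElem (σ : LState Proc U L) (p : Proc) (u : U) : QElem Proc U :=
  ⟨u, σ.reg (.T p) + 1, σ.reg .localCounter + 1, p⟩

/-- The effect of a request, up to sending the message about the new element. -/
noncomputable def LState.request (σ : LState Proc U L) (p s : Proc) (u : U) (l : Option L) :
    LState Proc U L :=
  (((σ.receive s (.localBroadcastRequest u l)).setReg (.T p) (σ.reg (.T p) + 1)).setReg
    .localCounter (σ.reg .localCounter + 1)).enqueue (queueOf l p) (σ.newElem p u)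

/-- The effect of the arrival of an element, up to raising the own timestamp. -/
noncomputable def LState.arrive (σ : LState Proc U L) (s : Proc) (l : Option L) (e : QElem Proc U) :
    LState Proc U L :=
  ((σ.receive s (.ordMsg l e)).setReg (.T s) e.ts).enqueue (queueOf l s) e

variable [LinearOrder Proc]

/-- The element `e` has the next counter and its timestamp is stable. -/
def LState.Stable (σ : LState Proc U L) (e : QElem Proc U) : Prop :=
  e.counter = σ.reg (.counter e.src) + 1 ∧ ∀ q, e.ts ≤ σ.reg (.T q)

/-- Local states that process `p` can reach, with the sequence of messages it has sent to all other
processes. -/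
inductive Reach (p : Proc) : LState Proc U L → List (Msg Proc U L) → Prop
  | init : Reach p .init []
  | sendSelf {σ : LState Proc U L} {B : List (Msg Proc U L)} (m : Msg Proc U L) :
      Reach p σ B → Reach p (σ.sendTo p m) B
  | request {σ : LState Proc U L} {B : List (Msg Proc U L)} (s : Proc) (u : U) (l : Option L) :
      Reach p σ B →
      Reach p ((σ.request p s u l).sendOthers p (.ordMsg l (σ.newElem p u)))
        (B ++ [.ordMsg l (σ.newElem p u)])
  | tsUpdate {σ : LState Proc U L} {B : List (Msg Proc U L)} (s : Proc) (t : ℕ) (q : Proc) :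
      Reach p σ B → Reach p ((σ.receive s (.tsUpdate t q)).setReg (.T q) t) B
  | arrive {σ : LState Proc U L} {B : List (Msg Proc U L)} (s : Proc) (l : Option L) (e : QElem Proc U) :
      Reach p σ B → e.ts ≤ (σ.arrive s l e).reg (.T p) → Reach p (σ.arrive s l e) B
  | arriveRaise {σ : LState Proc U L} {B : List (Msg Proc U L)} (s : Proc) (l : Option L)
      (e : QElem Proc U) :
      Reach p σ B → (σ.arrive s l e).reg (.T p) < e.ts →
      Reach p (((σ.arrive s l e).setReg (.T p) e.ts).sendOthers p (.tsUpdate e.ts p))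
        (B ++ [.tsUpdate e.ts p])
  | dequeuePQ {σ : LState Proc U L} {B : List (Msg Proc U L)} (l : L) (e e' : QElem Proc U)
      (s : Multiset (QElem Proc U)) :
      Reach p σ B → σ.pq l = e ::ₘ s → (∀ x ∈ s, e.key ≤ x.key) →
      IsMinElem (σ.pq l) e' → σ.Stable e' →
      Reach p ((σ.dequeuePQ l e s).setReg (.counter e.src) e.counter) B
  | dequeueFifo {σ : LState Proc U L} {B : List (Msg Proc U L)} (q : Proc) (e : QElem Proc U)
      (s : List (QElem Proc U)) :
      Reach p σ B → σ.fq q = e :: s → e.counter = σ.reg (.counter e.src) + 1 →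
      Reach p ((σ.dequeueFifo q e s).setReg (.counter e.src) e.counter) B

/-- No element of a priority queue can be delivered. -/
def LState.PQBlocked (σ : LState Proc U L) (l : L) : Prop :=
  σ.pq l = 0 ∨ ∃ e, IsMinElem (σ.pq l) e ∧ ¬ σ.Stable e

/-- No element of a fifo queue can be delivered. -/
def LState.FifoBlocked (σ : LState Proc U L) (q : Proc) : Prop :=
  ∀ e, (σ.fq q).head? = some e → e.counter ≠ σ.reg (.counter e.src) + 1

variable {σ : LState Proc U L} {p : Proc}

theorem wp_canExtract {l : L} {Q : Option Bool → LState Proc U L → Prop}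
    (hQ : ∀ b : Bool, (b = false → σ.PQBlocked l) →
      (b = true → ∃ e, IsMinElem (σ.pq l) e ∧ σ.Stable e) → Q (some b) σ) :
    wp (canExtract l : Code (TargetOp Proc V Val U L) Bool) σ Q := by
  rw [canExtract, wp_bind, wp_call]
  rintro b _ ⟨rfl, hb⟩
  rw [bindPost_some]
  split_ifs with h
  · rw [wp_pure]; exact hQ false (fun _ => .inl (hb.1 h)) (by simp)
  · rw [wp_bind, wp_call]
    rintro e σ ⟨rfl, he⟩
    rw [bindPost_some, wp_bind, wp_readReg, bindPost_some]
    split_ifs with hc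
    · rw [wp_bind, wp_enumerate]
      intro xs hxs
      rw [bindPost_some]
      refine wp_allM (F := fun q => ¬ e.ts ≤ σ.reg (.T q)) (G := fun q => e.ts ≤ σ.reg (.T q))
        (fun q Q' h => ?_) fun b h₁ h₂ => hQ b (fun hb => ?_) (fun hb => ?_)
      · rw [wp_bind, wp_readReg, bindPost_some, wp_pure]
        exact h _ (by simp) (by simp)
      · obtain ⟨q, _, hq⟩ := h₁ hb
        exact .inr ⟨e, he, fun hs => hq (hs.2 q)⟩
      · exact ⟨e, he, hc, fun q => h₂ hb q ((hxs.2 q).2 trivial)⟩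
    · rw [wp_pure]
      exact hQ false (fun _ => .inr ⟨e, he, fun hs => hc hs.1⟩) (by simp)

theorem wp_canDequeue {q : Proc} {Q : Option Bool → LState Proc U L → Prop}
    (hQ : ∀ b : Bool, (b = false → σ.FifoBlocked q) →
      (b = true → ∃ e, (σ.fq q).head? = some e ∧ e.counter = σ.reg (.counter e.src) + 1) →
      Q (some b) σ) :
    wp (canDequeue q : Code (TargetOp Proc V Val U L) Bool) σ Q := by
  rw [canDequeue, wp_bind, wp_call]
  rintro b _ ⟨rfl, hb⟩
  rw [bindPost_some]
  split_ifs with h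
  · rw [wp_pure]; exact hQ false (fun _ e he => by simp [hb.1 h] at he) (by simp)
  · rw [wp_bind, wp_call]
    rintro e _ ⟨rfl, he⟩
    rw [bindPost_some, wp_bind, wp_readReg, bindPost_some, wp_pure]
    refine hQ _ (fun hb e' he' => ?_) fun hb => ⟨e, he, by simpa using hb⟩
    rw [he, Option.some.injEq] at he'
    subst he'; simpa using hb

/-- Only a positive answer needs to carry information: it is what a waiting thread has observed.
After a negative one, `deliver` repeats the test on the queue that it chooses. -/
theorem wp_nothingDeliverable {Q : Option Bool → LState Proc U L → Prop}
    (hQ : ∀ b : Bool, (b = true → (∀ l, σ.PQBlocked l) ∧ ∀ q, σ.FifoBlocked q) → Q (some b) σ) :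
    wp (nothingDeliverable : Code (TargetOp Proc V Val U L) Bool) σ Q := by
  rw [nothingDeliverable, wp_bind, wp_enumerate]
  intro ls hls
  rw [bindPost_some, wp_bind]
  refine wp_anyM (fun l Q' h => wp_canExtract h) fun b h₁ _ => ?_
  rw [bindPost_some]
  split_ifs with hb
  · rw [wp_pure]; exact hQ false (by simp)
  · rw [wp_bind, wp_enumerate]
    intro qs hqs
    rw [bindPost_some, wp_bind]
    refine wp_anyM (fun l Q' h => wp_canDequeue h) fun b' h₂ _ => ?_
    rw [bindPost_some, wp_pure]
    refine hQ _ fun hb' => ⟨fun l => h₁ (by simpa using hb) l ((hls.2 l).2 trivial), fun q => ?_⟩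
    exact h₂ (by simpa using hb') q ((hqs.2 q).2 trivial)

theorem wp_enqueueElement {e : QElem Proc U} {l : Option L} {s : Proc}
    {Q : Option Unit → LState Proc U L → Prop} :
    wp (enqueueElement e l s : Code (TargetOp Proc V Val U L) Unit) σ Q ↔
      Q (some ()) (σ.enqueue (queueOf l s) e) := by
  cases l <;> simp [enqueueElement, lstep, queueOf]

/-- The order of the enumeration leaves no trace, because sent messages are recorded separately for
each destination, and each destination is enumerated once. -/
theorem wp_fifoBroadcast {m : Msg Proc U L} {Q : Option Unit → LState Proc U L → Prop}
    (hQ : Q (some ()) (σ.sendOthers p m)) :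
    wp (fifoBroadcast p m : Code (TargetOp Proc V Val U L) Unit) σ Q := by
  rw [fifoBroadcast, wp_bind, wp_enumerate]
  intro xs hxs
  rw [bindPost_some]
  have key : ∀ (xs : List Proc) (σ : LState Proc U L), xs.Nodup →
      wp (xs.forM fun q => Code.emit (TargetOp.send p q m) : Code (TargetOp Proc V Val U L) Unit) σ
        fun r σ' => r = some () ∧
          σ' = { σ with snd := fun d => if d ∈ xs then σ.snd d ++ [m] else σ.snd d } := by
    intro xs
    induction xs with
    | nil => intro σ _; simp [List.forM]
    | cons x xs ih =>
      intro σ hn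
      rw [List.nodup_cons] at hn
      rw [List.forM, wp_bind, wp_emit]
      rintro _ rfl
      rw [bindPost_some]
      refine (ih _ hn.2).mono fun r σ' h => ⟨h.1, ?_⟩
      rw [h.2]
      simp only [LState.sendTo, LState.mk.injEq, true_and, and_true]
      funext d
      by_cases hd : d = x
      · subst hd; simp [hn.1]
      · simp [hd]
  refine (key xs σ hxs.1).mono fun r σ' h => ?_
  rw [h.1, h.2]
  convert hQ using 1
  simp only [LState.sendOthers, LState.mk.injEq, true_and, and_true]
  funext d
  have := hxs.2 d
  rw [Set.mem_ofPred_eq] at this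
  by_cases hd : d = p <;> simp_all

/-- The only operation that can wait is the initial receive. This is why the waiting case concerns
the unchanged state, in which the guard of the loop was evaluated. -/
theorem wp_handleMessage {B : List (Msg Proc U L)} (h : Reach p σ B)
    {Q : Option Unit → LState Proc U L → Prop} (hnone : Q none σ)
    (hsome : ∀ σ' B', Reach p σ' B' → Q (some ()) σ') :
    wp (handleMessage p : Code (TargetOp Proc V Val U L) Unit) σ Q := by
  rw [handleMessage, wp_bind, wp_await]
  refine ⟨hnone, ?_⟩
  rintro ⟨s, m⟩ _ rfl
  rw [bindPost_some]
  cases m with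
  | localBroadcastRequest u l =>
    simp only [wp_bind, wp_readReg, bindPost_some, wp_writeReg, wp_enqueueElement]
    refine wp_fifoBroadcast ?_
    -- The code reads back the two variables that it has just written; evaluating these reads gives
    -- the fields of `newElem`.
    convert hsome _ _ (Reach.request s u l h) using 1
    simp [LState.request, LState.setReg, LState.receive, LState.newElem]
  | tsUpdate t q =>
    simp only [wp_writeReg]
    exact hsome _ _ (.tsUpdate s t q h)
  | ordMsg l e =>
    simp only [wp_bind, wp_readReg, bindPost_some, wp_writeReg, wp_enqueueElement]
    split_ifs with hlt
    · simp only [wp_bind, wp_readReg, bindPost_some, wp_writeReg]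
      refine wp_fifoBroadcast ?_
      convert hsome _ _ (Reach.arriveRaise s l e h hlt) using 1
      simp [LState.arrive, LState.setReg]
    · rw [wp_pure]
      exact hsome _ _ (.arrive s l e h (not_lt.1 hlt))

/-- Reachability is the loop invariant. A wait can only occur at the receive right after the guard
has found every queue blocked, which gives the second conjunct. -/
theorem wp_deliverCode {B : List (Msg Proc U L)} (h : Reach p σ B) :
    wp (deliverCode p : Code (TargetOp Proc V Val U L) (U × Option L)) σ fun r σ' =>
      (∃ B', Reach p σ' B') ∧ (r = none → (∀ l, σ'.PQBlocked l) ∧ ∀ q, σ'.FifoBlocked q) := by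
  rw [deliverCode, wp_bind]
  refine wp_while (fun σ => ∃ B, Reach p σ B) ?_ ⟨B, h⟩
  rintro σ ⟨B, h⟩
  refine wp_nothingDeliverable fun b hb => ?_
  cases b with
  | true => exact wp_handleMessage h ⟨⟨B, h⟩, fun _ => hb rfl⟩ fun σ' B' h' => ⟨B', h'⟩
  | false =>
    simp only [bindPost_some, wp_bind, wp_choose]
    rintro (l | q)
    · simp only [wp_bind]
      refine wp_canExtract fun b _ hb => ?_
      rw [bindPost_some, wp_bind, wp_require]
      intro hb'
      obtain ⟨e', h₁, h₂⟩ := hb hb'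
      rw [bindPost_some, wp_bind, wp_call]
      rintro e _ ⟨s, hs, hmin, rfl⟩
      simp only [wp_bind, wp_writeReg, bindPost_some, wp_pure]
      -- The tested element `e'` and the removed element `e` are both minimal. That they coincide
      -- needs distinct keys, an invariant not available here, so `Reach` records both.
      exact ⟨⟨B, .dequeuePQ l e e' s h hs hmin h₁ h₂⟩, by simp⟩
    · simp only [wp_bind]
      refine wp_canDequeue fun b _ hb => ?_
      rw [bindPost_some, wp_bind, wp_require]
      intro hb'
      obtain ⟨e', h₁, h₂⟩ := hb hb'
      rw [bindPost_some, wp_bind, wp_call]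
      rintro e _ ⟨s, hs, rfl⟩
      simp only [wp_bind, wp_writeReg, bindPost_some, wp_pure]
      obtain rfl : e = e' := by simpa [hs] using h₁
      exact ⟨⟨B, .dequeueFifo q e s h hs h₂⟩, by simp⟩

variable {Thr : Type}

theorem ThreadRun.reach {P : Multiprogram Proc Thr V Val U L} {t : Thr}
    {w : List (TargetOp Proc V Val U L)} {h : List (SpecOp V Val U L)} {b : Bool}
    (hr : ThreadRun P t w h b) {σ : LState Proc U L} (hσ : Runs lstep .init w σ) :
    (∃ B, Reach (P.owner t) σ B) ∧ (b = true → (∀ l, σ.PQBlocked l) ∧ ∀ q, σ.FifoBlocked q) := by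
  have key : ∀ (i : SpecInv V Val U L) (σ : LState Proc U L), (∃ B, Reach (P.owner t) σ B) →
      wp (timestampCode (P.owner t) i) σ fun r σ' =>
        (∃ B', Reach (P.owner t) σ' B') ∧
          (r = none → (∀ l, σ'.PQBlocked l) ∧ ∀ q, σ'.FifoBlocked q) := by
    rintro i σ ⟨B, hB⟩
    cases i with
    | read x =>
      simp only [timestampCode, wp_bind, wp_call, lstep, bindPost_some, wp_pure]
      rintro _ _ rfl; exact ⟨⟨B, hB⟩, by simp⟩
    | write x v =>
      simp only [timestampCode, wp_bind, wp_emit, lstep, bindPost_some, wp_pure]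
      rintro _ rfl; exact ⟨⟨B, hB⟩, by simp⟩
    | bcast u l =>
      simp only [timestampCode, wp_bind, wp_emit, lstep, bindPost_some, wp_pure]
      rintro _ rfl; exact ⟨⟨B, .sendSelf _ hB⟩, by simp⟩
    | deliver =>
      simp only [timestampCode, wp_bind]
      refine (wp_deliverCode hB).mono fun r σ' h' => ?_
      cases r with
      | none => exact ⟨h'.1, fun _ => h'.2 rfl⟩
      | some a => simpa using h'.1
  induction hr generalizing σ with
  | start =>
    rw [runs_nil_iff] at hσ
    subst hσ; exact ⟨⟨_, .init⟩, by simp⟩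
  | returns _ _ h₂ ih =>
    obtain ⟨σ₁, hr₁, hr₂⟩ := runs_append_iff.1 hσ
    exact ⟨(key _ _ (ih hr₁).1 _ _ _ h₂ hr₂).1, by simp⟩
  | waits _ _ h₂ ih =>
    obtain ⟨σ₁, hr₁, hr₂⟩ := runs_append_iff.1 hσ
    have := key _ _ (ih hr₁).1 _ _ _ h₂ hr₂
    exact ⟨this.1, fun _ => this.2 rfl⟩

end Steps

/-! ## Operations performed by target code -/

section CodeAll

variable {Op α β : Type}

/-- All operations that `c` can perform satisfy `φ`. -/
def Code.All (φ : Op → Prop) (c : Code Op α) : Prop := ∀ w r, c w r → ∀ o ∈ w, φ o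

variable {φ : Op → Prop}

/-- The continuation is examined only for values that the first part can return. This is needed for
broadcasts, whose destinations are known to differ from the sender only through the enumeration. -/
theorem Code.All.bind {c : Code Op α} {f : α → Code Op β} (hc : Code.All φ c)
    (hf : ∀ w a, c w (some a) → Code.All φ (f a)) : Code.All φ (c >>= f) := by
  rintro w r (⟨h, rfl⟩ | ⟨w₁, a, w₂, h₁, h₂, rfl⟩) o ho
  · exact hc _ _ h o ho
  · rcases List.mem_append.1 ho with ho | ho
    · exact hc _ _ h₁ o ho
    · exact hf _ _ h₁ _ _ h₂ o ho

theorem Code.All.pure {a : α} : Code.All φ (pure a : Code Op α) := by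
  rintro w r ⟨rfl, rfl⟩; simp

theorem Code.All.emit {o : Op} (h : φ o) : Code.All φ (Code.emit o) := by
  rintro w r ⟨rfl, rfl⟩; simpa

theorem Code.All.call {f : α → Op} (h : ∀ a, φ (f a)) : Code.All φ (Code.call f) := by
  rintro w r ⟨a, rfl, rfl⟩; simpa using h a

theorem Code.All.await {f : α → Op} (h : ∀ a, φ (f a)) : Code.All φ (Code.await f) := by
  rintro w r (⟨a, rfl, rfl⟩ | ⟨rfl, rfl⟩)
  · simpa using h a
  · simp

theorem Code.All.enumerate {A : Set α} : Code.All φ (Code.enumerate A : Code Op (List α)) := by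
  rintro w r ⟨rfl, _⟩; simp

theorem Code.All.while {guard : Code Op Bool} {body : Code Op Unit} (hg : Code.All φ guard)
    (hb : Code.All φ body) : Code.All φ (Code.While guard body) := by
  intro w r h
  induction h with
  | exit h => exact hg _ _ h
  | guardWaits h => exact hg _ _ h
  | bodyWaits h h' =>
    simp only [List.mem_append]
    rintro o (ho | ho)
    exacts [hg _ _ h o ho, hb _ _ h' o ho]
  | again h h' _ ih =>
    simp only [List.mem_append]
    rintro o ((ho | ho) | ho)
    exacts [hg _ _ h o ho, hb _ _ h' o ho, ih o ho]

theorem Code.All.ite {c d : Code Op α} {P : Prop} [Decidable P] (hc : Code.All φ c)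
    (hd : Code.All φ d) : Code.All φ (if P then c else d) := by
  split_ifs <;> assumption

theorem Code.All.anyM {f : α → Code Op Bool} (hf : ∀ a, Code.All φ (f a)) (xs : List α) :
    Code.All φ (xs.anyM f) := by
  induction xs with
  | nil => exact .pure
  | cons x xs ih =>
    refine .bind (hf x) fun _ b _ => ?_
    cases b
    exacts [ih, .pure]

theorem Code.All.allM {f : α → Code Op Bool} (hf : ∀ a, Code.All φ (f a)) (xs : List α) :
    Code.All φ (xs.allM f) := by
  induction xs with
  | nil => exact .pure
  | cons x xs ih =>
    refine .bind (hf x) fun _ b _ => ?_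
    cases b
    exacts [.pure, ih]

theorem Code.All.forM {f : α → Code Op Unit} {xs : List α} (hf : ∀ a ∈ xs, Code.All φ (f a)) :
    Code.All φ (xs.forM f) := by
  induction xs with
  | nil => exact .pure
  | cons x xs ih =>
    exact .bind (hf x (by simp)) fun _ _ _ => ih fun a ha => hf a (by simp [ha])

end CodeAll

section ThreadOps

variable {Proc Thr V Val U L : Type}

/-- The specification operation that a target operation represents. -/
def TargetOp.spec? : TargetOp Proc V Val U L → Option (SpecOp V Val U L)
  | .var o => some (.var o)
  | .send _ _ (.localBroadcastRequest u l) => some (.bcast u l)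
  | .priorityQ l (.deq e) => some (.deliver e.update (some l))
  | .fifoQ _ (.deq e) => some (.deliver e.update none)
  | _ => none

/-- The messages that process `s` sends to process `d`. -/
def MsgFrom (s d : Proc) : Msg Proc U L → Prop
  | .localBroadcastRequest _ _ => d = s
  | .tsUpdate _ q => d ≠ s ∧ q = s
  | .ordMsg _ _ => d ≠ s

/-- The operations that threads of `p` perform. -/
def ThreadOp (p : Proc) : TargetOp Proc V Val U L → Prop
  | .send s d m => s = p ∧ MsgFrom p d m
  | .recv _ d _ => d = p
  | _ => True

/-- The auxiliary operations that threads of `p` perform. -/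
def AuxOp (p : Proc) (o : TargetOp Proc V Val U L) : Prop := ThreadOp p o ∧ o.spec? = none

variable {p : Proc}

theorem all_readReg {x : Reg Proc} :
    Code.All (AuxOp p) (readReg x : Code (TargetOp Proc V Val U L) ℕ) :=
  .call fun _ => ⟨trivial, rfl⟩

theorem all_writeReg {x : Reg Proc} {v : ℕ} :
    Code.All (AuxOp p) (writeReg x v : Code (TargetOp Proc V Val U L) Unit) :=
  .emit ⟨trivial, rfl⟩

theorem all_canExtract {l : L} :
    Code.All (AuxOp p) (canExtract l : Code (TargetOp Proc V Val U L) Bool) :=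
  .bind (.call fun _ => ⟨trivial, rfl⟩) fun _ _ _ => .ite .pure <|
    .bind (.call fun _ => ⟨trivial, rfl⟩) fun _ _ _ => .bind all_readReg fun _ _ _ =>
    .ite (.bind .enumerate fun _ _ _ => .allM (fun _ => .bind all_readReg fun _ _ _ => .pure) _) .pure

theorem all_canDequeue {q : Proc} :
    Code.All (AuxOp p) (canDequeue q : Code (TargetOp Proc V Val U L) Bool) :=
  .bind (.call fun _ => ⟨trivial, rfl⟩) fun _ _ _ => .ite .pure <|
    .bind (.call fun _ => ⟨trivial, rfl⟩) fun _ _ _ => .bind all_readReg fun _ _ _ => .pure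

theorem all_nothingDeliverable :
    Code.All (AuxOp p) (nothingDeliverable : Code (TargetOp Proc V Val U L) Bool) :=
  .bind .enumerate fun _ _ _ => .bind (.anyM (fun _ => all_canExtract) _) fun _ _ _ =>
    .ite .pure <| .bind .enumerate fun _ _ _ => .bind (.anyM (fun _ => all_canDequeue) _)
    fun _ _ _ => .pure

theorem all_enqueueElement {e : QElem Proc U} {l : Option L} {s : Proc} :
    Code.All (AuxOp p) (enqueueElement e l s : Code (TargetOp Proc V Val U L) Unit) := by
  cases l <;> exact .emit ⟨trivial, rfl⟩

theorem all_fifoBroadcast {m : Msg Proc U L} (h : ∀ d, d ≠ p → MsgFrom p d m)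
    (hm : ∀ d, (TargetOp.send p d m : TargetOp Proc V Val U L).spec? = none) :
    Code.All (AuxOp p) (fifoBroadcast p m : Code (TargetOp Proc V Val U L) Unit) := by
  refine .bind .enumerate ?_
  rintro w qs ⟨_, xs, hxs, hq⟩
  obtain rfl : qs = xs := by simpa using hq
  exact .forM fun d hd => .emit ⟨⟨rfl, h d ((hxs.2 d).1 hd)⟩, hm d⟩

theorem all_handleMessage :
    Code.All (AuxOp p) (handleMessage p : Code (TargetOp Proc V Val U L) Unit) := by
  refine .bind (.await fun _ => ⟨rfl, rfl⟩) ?_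
  rintro _ ⟨s, m⟩ _
  cases m with
  | localBroadcastRequest u l =>
    exact .bind all_readReg fun _ _ _ => .bind all_writeReg fun _ _ _ => .bind all_readReg
      fun _ _ _ => .bind all_writeReg fun _ _ _ => .bind all_readReg fun _ _ _ =>
      .bind all_readReg fun _ _ _ => .bind all_enqueueElement fun _ _ _ =>
      all_fifoBroadcast (fun _ h => h) fun _ => rfl
  | tsUpdate t q => exact all_writeReg
  | ordMsg l e =>
    exact .bind all_writeReg fun _ _ _ => .bind all_enqueueElement fun _ _ _ =>
      .bind all_readReg fun _ _ _ => .ite (.bind all_writeReg fun _ _ _ => .bind all_readReg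
        fun _ _ _ => all_fifoBroadcast (fun _ h => ⟨h, rfl⟩) fun _ => rfl) .pure

theorem filterMap_spec_of_aux {w : List (TargetOp Proc V Val U L)} (h : ∀ o ∈ w, AuxOp p o) :
    w.filterMap TargetOp.spec? = [] :=
  List.filterMap_eq_nil_iff.2 fun o ho => (h o ho).2

/-- The loop and the tests perform auxiliary operations only, and the final dequeue is the single
operation that represents the delivery. A run that waits never gets that far. -/
theorem deliverCode_ops {w : List (TargetOp Proc V Val U L)} {r : Option (U × Option L)}
    (h : deliverCode p w r) : (∀ o ∈ w, ThreadOp p o) ∧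
      w.filterMap TargetOp.spec? = r.toList.map fun a => .deliver a.1 a.2 := by
  have hW : Code.All (AuxOp p) (Code.While nothingDeliverable (handleMessage p) :
      Code (TargetOp Proc V Val U L) Unit) := .while all_nothingDeliverable all_handleMessage
  rcases h with ⟨h, rfl⟩ | ⟨w₁, _, w₂, h₁, h, rfl⟩
  · exact ⟨fun o ho => (hW _ _ h o ho).1, by simpa using filterMap_spec_of_aux (hW _ _ h)⟩
  have a₁ := hW _ _ h₁
  have tail : ∀ {b : Bool} {o : QElem Proc U → TargetOp Proc V Val U L} {l : Option L}
      {w : List (TargetOp Proc V Val U L)} {r : Option (U × Option L)},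
      (∀ e, ThreadOp p (o e) ∧ (o e).spec? = some (.deliver e.update l)) →
      (do
        Code.require b
        let e ← Code.call o
        writeReg (.counter e.src) e.counter
        return (e.update, l) : Code (TargetOp Proc V Val U L) (U × Option L)) w r →
      (∀ o ∈ w, ThreadOp p o) ∧
        w.filterMap TargetOp.spec? = r.toList.map fun a => .deliver a.1 a.2 := by
    intro b o l w r ho h
    rcases h with ⟨⟨_, _, h⟩, _⟩ | ⟨_, _, _, ⟨rfl, _, _⟩, h, rfl⟩
    · cases h
    rcases h with ⟨⟨_, _, h⟩, _⟩ | ⟨_, e, _, ⟨e', rfl, he⟩, h, rfl⟩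
    · cases h
    cases he
    rcases h with ⟨⟨_, h⟩, _⟩ | ⟨_, _, _, ⟨rfl, _⟩, ⟨rfl, rfl⟩, rfl⟩
    · cases h
    constructor
    · simpa using ⟨(ho e).1, trivial⟩
    · exact List.filterMap_cons_some (ho e).2
  rcases h with ⟨⟨_, _, h⟩, _⟩ | ⟨_, c, w₃, ⟨rfl, _⟩, h, hw⟩
  · cases h
  rw [hw, List.nil_append]
  suffices (∀ o ∈ w₃, ThreadOp p o) ∧
      w₃.filterMap TargetOp.spec? = r.toList.map fun a => .deliver a.1 a.2 by
    constructor
    · intro o ho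
      exact (List.mem_append.1 ho).elim (fun h => (a₁ o h).1) (this.1 o)
    · rw [List.filterMap_append, filterMap_spec_of_aux a₁, this.2, List.nil_append]
  -- An auxiliary test in front of the dequeue contributes no specification operation; this serves
  -- both kinds of queue.
  have guard : ∀ {g : Code (TargetOp Proc V Val U L) Bool}
      {f : Bool → Code (TargetOp Proc V Val U L) (U × Option L)}, Code.All (AuxOp p) g →
      (∀ b w, f b w r → (∀ o ∈ w, ThreadOp p o) ∧
        w.filterMap TargetOp.spec? = r.toList.map fun a => .deliver a.1 a.2) →
      (g >>= f) w₃ r → (∀ o ∈ w₃, ThreadOp p o) ∧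
        w₃.filterMap TargetOp.spec? = r.toList.map fun a => .deliver a.1 a.2 := by
    rintro g f hg hf (⟨h', rfl⟩ | ⟨w₄, b, w₅, h₄, h', rfl⟩)
    · exact ⟨fun o ho => (hg _ _ h' o ho).1, by simpa using filterMap_spec_of_aux (hg _ _ h')⟩
    · obtain ⟨h₂, h₃⟩ := hf _ _ h'
      constructor
      · intro o ho
        exact (List.mem_append.1 ho).elim (fun h => (hg _ _ h₄ o h).1) (h₂ o)
      · rw [List.filterMap_append, filterMap_spec_of_aux (hg _ _ h₄), h₃, List.nil_append]
  cases c with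
  | inl l => exact guard all_canExtract (fun b w h => tail (o := fun e => .priorityQ l (.deq e))
      (fun e => ⟨trivial, rfl⟩) h) h
  | inr q => exact guard all_canDequeue (fun b w h => tail (o := fun e => .fifoQ q (.deq e))
      (fun e => ⟨trivial, rfl⟩) h) h

/-- The operations of threads that do not call `deliver`. -/
def PlainOp (p : Proc) : TargetOp Proc V Val U L → Prop
  | .var _ => True
  | .send s d (.localBroadcastRequest _ _) => s = p ∧ d = p
  | _ => False

theorem PlainOp.threadOp {o : TargetOp Proc V Val U L} (h : PlainOp p o) : ThreadOp p o := by
  rcases o with _ | _ | _ | _ | ⟨_, _, _ | _ | _⟩ | _ <;> trivial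

/-- Every invocation except `deliver` compiles to exactly one operation that always returns. -/
theorem timestampCode_plain {i : SpecInv V Val U L} (hi : i ≠ .deliver)
    {w : List (TargetOp Proc V Val U L)} {r : Option (SpecOp V Val U L)}
    (h : timestampCode p i w r) :
    ∃ o o', w = [o] ∧ PlainOp p o ∧ r = some o' ∧ o.spec? = some o' ∧ o'.inv = i := by
  cases i with
  | deliver => exact absurd rfl hi
  | read x =>
    rcases h with ⟨⟨_, _, h⟩, _⟩ | ⟨_, _, _, ⟨v, rfl, h⟩, ⟨rfl, rfl⟩, rfl⟩
    · cases h
    · cases h; exact ⟨_, _, rfl, trivial, rfl, rfl, rfl⟩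
  | write x v =>
    rcases h with ⟨⟨_, h⟩, _⟩ | ⟨_, _, _, ⟨rfl, h⟩, ⟨rfl, rfl⟩, rfl⟩
    · cases h
    · exact ⟨_, _, rfl, trivial, rfl, rfl, rfl⟩
  | bcast u l =>
    rcases h with ⟨⟨_, h⟩, _⟩ | ⟨_, _, _, ⟨rfl, h⟩, ⟨rfl, rfl⟩, rfl⟩
    · cases h
    · exact ⟨_, _, rfl, ⟨rfl, rfl⟩, rfl, rfl, rfl⟩

theorem timestampCode_ops {i : SpecInv V Val U L}
    {w : List (TargetOp Proc V Val U L)} {r : Option (SpecOp V Val U L)}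
    (h : timestampCode p i w r) :
    (∀ o ∈ w, ThreadOp p o) ∧ w.filterMap TargetOp.spec? = r.toList ∧ ∀ o ∈ r, o.inv = i := by
  by_cases hi : i = .deliver
  · subst hi
    rcases h with ⟨h, rfl⟩ | ⟨w₁, a, w₂, h, ⟨rfl, rfl⟩, rfl⟩
    · have := deliverCode_ops h
      exact ⟨this.1, this.2, by simp⟩
    · have := deliverCode_ops h
      rw [List.append_nil]
      exact ⟨this.1, this.2, by simp [SpecOp.inv]⟩
  · obtain ⟨o, o', rfl, h₁, rfl, h₂, h₃⟩ := timestampCode_plain hi h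
    exact ⟨by simpa using h₁.threadOp, by simp [h₂], by simpa using h₃⟩

variable {P : Multiprogram Proc Thr V Val U L} {t : Thr} {w : List (TargetOp Proc V Val U L)}
  {h : List (SpecOp V Val U L)} {b : Bool}

theorem ThreadRun.generates (hr : ThreadRun P t w h b) : P.Generates t h := by
  induction hr with
  | start => intro pre o post he; simp at he
  | waits _ _ _ ih => exact ih
  | @returns w w' h i o _ hi hc ih =>
    intro pre o' post he
    rcases List.eq_nil_or_concat post with rfl | ⟨post, x, rfl⟩
    · rw [← List.concat_eq_append, ← List.concat_eq_append] at he
      obtain ⟨rfl, rfl⟩ := List.concat_inj.1 he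
      rw [(timestampCode_ops hc).2.2 o rfl]; exact hi
    · have : h ++ [o] = (pre ++ o' :: post) ++ [x] := by simpa using he
      rw [← List.concat_eq_append, ← List.concat_eq_append] at this
      exact ih _ _ _ (List.concat_inj.1 this).1

theorem ThreadRun.threadOp (hr : ThreadRun P t w h b) : ∀ o ∈ w, ThreadOp (P.owner t) o := by
  induction hr with
  | start => simp
  | returns _ _ hc ih | waits _ _ hc ih =>
    intro o ho
    exact (List.mem_append.1 ho).elim (ih o) ((timestampCode_ops hc).1 o)

theorem ThreadRun.filterMap_spec (hr : ThreadRun P t w h b) : w.filterMap TargetOp.spec? = h := by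
  induction hr with
  | start => rfl
  | returns _ _ hc ih => rw [List.filterMap_append, ih, (timestampCode_ops hc).2.1]; rfl
  | waits _ _ hc ih => rw [List.filterMap_append, ih, (timestampCode_ops hc).2.1]; simp

/-- An invocation of `deliver` in the run would itself witness `CallsDeliver`, because the completed
history before it is generated by the program. -/
theorem ThreadRun.plain (hr : ThreadRun P t w h b) (hd : ¬ P.CallsDeliver t) :
    b = false ∧ ∀ o ∈ w, PlainOp (P.owner t) o := by
  induction hr with
  | start => simp
  | @returns w w' h i o hr' hi hc ih =>
    have : i ≠ .deliver := by rintro rfl; exact hd ⟨h, hr'.generates, hi⟩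
    obtain ⟨o, o', rfl, h₁, _⟩ := timestampCode_plain this hc
    refine ⟨rfl, fun x hx => (List.mem_append.1 hx).elim (ih.2 x) fun hx => ?_⟩
    rw [List.mem_singleton.1 hx]; exact h₁
  | @waits w w' h i hr' hi hc ih =>
    have : i ≠ .deliver := by rintro rfl; exact hd ⟨h, hr'.generates, hi⟩
    obtain ⟨o, o', _, _, h, _⟩ := timestampCode_plain this hc
    cases h

end ThreadOps

/-! ## The order of a sequence -/

section Before

variable {α β : Type} {l : List α} {a b : α}

theorem Before.mem_left (h : Before l a b) : a ∈ l := h.subset (by simp)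

theorem Before.mem_right (h : Before l a b) : b ∈ l := h.subset (by simp)

theorem before_or_before (ha : a ∈ l) (hb : b ∈ l) (hab : a ≠ b) : Before l a b ∨ Before l b a := by
  obtain ⟨l₁, l₂, rfl⟩ := List.append_of_mem ha
  rcases List.mem_append.1 hb with hb | hb
  · right
    obtain ⟨l₃, l₄, rfl⟩ := List.append_of_mem hb
    simp only [Before, List.append_assoc, List.cons_append]
    refine List.Sublist.trans ?_ (List.sublist_append_right _ _)
    refine List.cons_sublist_cons.2 (List.singleton_sublist.2 (by simp))
  · left
    have hb : b ∈ l₂ := (List.mem_cons.1 hb).resolve_left (Ne.symm hab)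
    refine List.Sublist.trans ?_ (List.sublist_append_right _ _)
    exact List.cons_sublist_cons.2 (List.singleton_sublist.2 hb)

theorem Before.ne (hl : l.Nodup) (h : Before l a b) : a ≠ b :=
  List.pairwise_iff_forall_sublist.1 hl h

theorem Before.asymm (hl : l.Nodup) (h : Before l a b) : ¬ Before l b a := by
  induction l with
  | nil => simp [Before] at h
  | cons c l ih =>
    intro h'
    rw [List.nodup_cons] at hl
    simp only [Before] at h h'
    rw [List.cons_sublist_cons'] at h h'
    rcases h with h | ⟨rfl, h⟩ <;> rcases h' with h' | ⟨rfl, h'⟩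
    · exact ih hl.2 h h'
    · exact hl.1 (Before.mem_right h)
    · exact hl.1 (Before.mem_right h')
    · exact hl.1 (List.singleton_sublist.1 h)

theorem Before.filterMap {f : α → Option β} {a' b' : β} (h : Before l a b) (ha : f a = some a')
    (hb : f b = some b') : Before (l.filterMap f) a' b' := by
  have := List.Sublist.filterMap f h
  simpa [Before, List.filterMap_cons_some ha, List.filterMap_cons_some hb] using this

theorem Before.of_filterMap {f : α → Option β} {a' b' : β} (h : Before (l.filterMap f) a' b') :
    ∃ a b, Before l a b ∧ f a = some a' ∧ f b = some b' := by
  -- `Pairwise` amounts to a statement about all two-element sublists and can be pulled back along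
  -- `filterMap`.
  have : (l.filterMap f).Pairwise fun x y => ∃ a b, Before l a b ∧ f a = some x ∧ f b = some y := by
    rw [List.pairwise_filterMap, List.pairwise_iff_forall_sublist]
    intro a b hab x hx y hy
    exact ⟨a, b, hab, hx, hy⟩
  exact List.pairwise_iff_forall_sublist.1 this h

end Before

/-! ## Histories of queue elements -/

section Histories

variable {Proc U L : Type}

/-- A queue element together with its queue. -/
abbrev Entry (Proc U L : Type) : Type := (L ⊕ Proc) × QElem Proc U

open scoped Classical in
/-- The entries from process `s`. -/
noncomputable def fromSrc (s : Proc) (E : List (Entry Proc U L)) : List (Entry Proc U L) :=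
  E.filter fun x => x.2.src = s

open scoped Classical in
/-- The elements of queue `k`. -/
noncomputable def inQueue (k : L ⊕ Proc) (E : List (Entry Proc U L)) : List (QElem Proc U) :=
  (E.filter fun x => x.1 = k).map Prod.snd

variable {s : Proc} {k : L ⊕ Proc} {E E' : List (Entry Proc U L)} {x y : Entry Proc U L}

theorem mem_fromSrc : x ∈ fromSrc s E ↔ x ∈ E ∧ x.2.src = s := by simp [fromSrc]

theorem mem_inQueue {e : QElem Proc U} : e ∈ inQueue k E ↔ (k, e) ∈ E := by simp [inQueue]

theorem fromSrc_append : fromSrc s (E ++ E') = fromSrc s E ++ fromSrc s E' := by simp [fromSrc]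

theorem inQueue_append : inQueue k (E ++ E') = inQueue k E ++ inQueue k E' := by simp [inQueue]

theorem fromSrc_singleton (h : x.2.src = s) : fromSrc s [x] = [x] := by simp [fromSrc, h]

theorem fromSrc_singleton_of_ne (h : x.2.src ≠ s) : fromSrc s [x] = [] := by simp [fromSrc, h]

theorem inQueue_singleton {e : QElem Proc U} : inQueue k [(k, e)] = [e] := by simp [inQueue]

theorem inQueue_singleton_of_ne {k' : L ⊕ Proc} {e : QElem Proc U} (h : k' ≠ k) :
    inQueue k [(k', e)] = [] := by simp [inQueue, h]

/-- The elements from each process appear with increasing timestamps and counters. -/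
def Streamed (E : List (Entry Proc U L)) : Prop :=
  ∀ s, (fromSrc s E).Pairwise fun x y => x.2.ts < y.2.ts ∧ x.2.counter < y.2.counter

theorem Streamed.pairwise (h : Streamed E) : E.Pairwise fun x y => x.2.src = y.2.src →
    x.2.ts < y.2.ts ∧ x.2.counter < y.2.counter := by
  classical
  refine List.pairwise_iff_forall_sublist.2 fun {x y} hxy hs => ?_
  refine List.pairwise_iff_forall_sublist.1 (h y.2.src) ?_
  have := hxy.filter fun x => decide (x.2.src = y.2.src)
  simpa [hs, fromSrc] using this

theorem Streamed.trichotomy (h : Streamed E) (hx : x ∈ E) (hy : y ∈ E) (hs : x.2.src = y.2.src) :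
    x = y ∨ (x.2.ts < y.2.ts ∧ x.2.counter < y.2.counter) ∨
      (y.2.ts < x.2.ts ∧ y.2.counter < x.2.counter) := by
  by_cases hxy : x = y
  · exact .inl hxy
  · refine .inr <| (before_or_before hx hy hxy).imp (fun hb => ?_) (fun hb => ?_)
    · exact List.pairwise_iff_forall_sublist.1 h.pairwise hb hs
    · exact List.pairwise_iff_forall_sublist.1 h.pairwise hb hs.symm

theorem Streamed.nodup (h : Streamed E) : E.Nodup :=
  h.pairwise.imp fun h e => by subst e; exact lt_irrefl _ (h rfl).1

theorem Streamed.eq_of_counter (h : Streamed E) (hx : x ∈ E) (hy : y ∈ E) (hs : x.2.src = y.2.src)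
    (hc : x.2.counter = y.2.counter) : x = y := by
  rcases h.trichotomy hx hy hs with h | h | h
  · exact h
  · exact absurd hc h.2.ne
  · exact absurd hc h.2.ne'

/-- The key contains the source, and timestamps from one source are strictly increasing. -/
theorem Streamed.eq_of_key (h : Streamed E) (hx : x ∈ E) (hy : y ∈ E)
    (hk : x.2.key = y.2.key) : x = y := by
  have hk' : (x.2.ts, x.2.src) = (y.2.ts, y.2.src) := hk
  rw [Prod.mk.injEq] at hk'
  rcases h.trichotomy hx hy hk'.2 with h | h | h
  · exact h
  · exact absurd hk'.1 h.1.ne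
  · exact absurd hk'.1 h.1.ne'

theorem Streamed.nodup_inQueue (h : Streamed E) (k : L ⊕ Proc) : (inQueue k E).Nodup := by
  classical
  refine (h.nodup.filter _).map_on ?_
  intro x hx y hy hxy
  simp only [List.mem_filter, decide_eq_true_eq] at hx hy
  exact Prod.ext (hx.2.trans hy.2.symm) hxy

theorem Streamed.snoc (h : Streamed E) (hx : ∀ y ∈ E, y.2.src = x.2.src → y.2.ts < x.2.ts ∧
    y.2.counter < x.2.counter) : Streamed (E ++ [x]) := by
  intro s
  rw [fromSrc_append]
  by_cases hs : x.2.src = s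
  · subst hs
    rw [fromSrc_singleton rfl, List.pairwise_append]
    refine ⟨h _, by simp, fun y hy z hz => ?_⟩
    rw [List.mem_singleton] at hz; subst hz
    exact hx y (mem_fromSrc.1 hy).1 (mem_fromSrc.1 hy).2
  · rw [fromSrc_singleton_of_ne hs, List.append_nil]; exact h s

theorem key_lt_of_ts_lt [LinearOrder Proc] {e e' : QElem Proc U} (h : e.ts < e'.ts) :
    e.key < e'.key :=
  Prod.Lex.toLex_lt_toLex.2 (.inl h)

theorem ts_le_of_key_le [LinearOrder Proc] {e e' : QElem Proc U} (h : e.key ≤ e'.key) :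
    e.ts ≤ e'.ts := by
  rcases Prod.Lex.toLex_le_toLex.1 h with h | h
  · exact h.le
  · exact h.1.le

/-! ## Invariants of the queues -/

variable [LinearOrder Proc]

/-- Invariants of the queues of a process. -/
structure QInv (σ : LState Proc U L) : Prop where
  streamed : Streamed σ.enq
  ts_le : ∀ x ∈ σ.enq, x.2.ts ≤ σ.reg (.T x.2.src)
  pq : ∀ l, (inQueue (.inl l) σ.dlv : Multiset (QElem Proc U)) + σ.pq l = inQueue (.inl l) σ.enq
  fq : ∀ q, inQueue (.inr q) σ.dlv ++ σ.fq q = inQueue (.inr q) σ.enq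
  counters : ∀ s, (fromSrc s σ.dlv).map (fun x => x.2.counter) = List.range' 1 (σ.reg (.counter s))
  sorted : σ.dlv.Pairwise fun x y => ∀ l, x.1 = .inl l → y.1 = .inl l → x.2.key < y.2.key
  stable : ∀ l e, (.inl l, e) ∈ σ.dlv → (∀ q, e.ts ≤ σ.reg (.T q)) ∧ ∀ e' ∈ σ.pq l, e.key < e'.key

/-! ### Preservation of the queue invariants, and completeness of blocked states -/

namespace QInv

variable {σ : LState Proc U L}

theorem init : QInv (LState.init : LState Proc U L) where
  streamed _ := by simp [LState.init, fromSrc]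
  ts_le := by simp [LState.init]
  pq := by simp [LState.init, inQueue]
  fq := by simp [LState.init, inQueue]
  counters := by simp [LState.init, fromSrc]
  sorted := by simp [LState.init]
  stable := by simp [LState.init]

theorem mem_pq_iff (h : QInv σ) {l : L} {e : QElem Proc U} :
    (.inl l, e) ∈ σ.enq ↔ (.inl l, e) ∈ σ.dlv ∨ e ∈ σ.pq l := by
  rw [← mem_inQueue, ← Multiset.mem_coe, ← h.pq l, Multiset.mem_add, Multiset.mem_coe, mem_inQueue]

theorem mem_fq_iff (h : QInv σ) {q : Proc} {e : QElem Proc U} :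
    (.inr q, e) ∈ σ.enq ↔ (.inr q, e) ∈ σ.dlv ∨ e ∈ σ.fq q := by
  rw [← mem_inQueue, ← h.fq q, List.mem_append, mem_inQueue]

theorem mem_enq_of_mem_dlv (h : QInv σ) {x : Entry Proc U L} (hx : x ∈ σ.dlv) : x ∈ σ.enq := by
  obtain ⟨l | q, e⟩ := x
  · exact h.mem_pq_iff.2 (.inl hx)
  · exact h.mem_fq_iff.2 (.inl hx)

/-- Pending keys lie strictly above delivered ones, so an element in both places would be below
itself. -/
theorem not_mem_dlv_of_mem_pq (h : QInv σ) {l : L} {e : QElem Proc U} (he : e ∈ σ.pq l) :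
    (.inl l, e) ∉ σ.dlv := fun hd => lt_irrefl _ ((h.stable l e hd).2 e he)

theorem not_mem_dlv_of_mem_fq (h : QInv σ) {q : Proc} {e : QElem Proc U} (he : e ∈ σ.fq q) :
    (.inr q, e) ∉ σ.dlv := by
  have hn := h.streamed.nodup_inQueue (.inr q)
  rw [← h.fq q, List.nodup_append] at hn
  exact fun hd => hn.2.2 e (mem_inQueue.2 hd) e he rfl

theorem raise (h : QInv σ) {reg : Reg Proc → ℕ} (hc : ∀ s, reg (.counter s) = σ.reg (.counter s))
    (hT : ∀ q, σ.reg (.T q) ≤ reg (.T q)) : QInv { σ with reg := reg } where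
  streamed := h.streamed
  ts_le x hx := (h.ts_le x hx).trans (hT _)
  pq := h.pq
  fq := h.fq
  counters s := by rw [h.counters s]; simp [hc]
  sorted := h.sorted
  stable l e he := ⟨fun q => ((h.stable l e he).1 q).trans (hT q), (h.stable l e he).2⟩

/-- The heart of safety: the new timestamp exceeds the old T of its source, while delivered labeled
elements lie at or below every T. So the newcomer sorts after all deliveries of its label. The new
register file is left general to serve requests and both kinds of arrival. -/
theorem enqueue (h : QInv σ) {k : L ⊕ Proc} {e : QElem Proc U} (ht : σ.reg (.T e.src) < e.ts)
    (hctr : ∀ y ∈ σ.enq, y.2.src = e.src → y.2.counter < e.counter) {reg : Reg Proc → ℕ}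
    (hc : ∀ s, reg (.counter s) = σ.reg (.counter s))
    (hT : ∀ q, σ.reg (.T q) ≤ reg (.T q)) (he : e.ts ≤ reg (.T e.src)) :
    QInv (({ σ with reg := reg } : LState Proc U L).enqueue k e) := by
  have h' := h.raise hc hT
  have hs : Streamed (σ.enq ++ [(k, e)]) := h.streamed.snoc fun y hy hys =>
    ⟨by have := h.ts_le y hy; rw [hys] at this; exact this.trans_lt ht, hctr y hy hys⟩
  have hle : ∀ x ∈ σ.enq ++ [(k, e)], x.2.ts ≤ reg (.T x.2.src) := by
    intro x hx
    rcases List.mem_append.1 hx with hx | hx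
    · exact h'.ts_le x hx
    · rw [List.mem_singleton] at hx; subst hx; exact he
  cases k with
  | inl l =>
    refine ⟨hs, hle, fun l' => ?_, fun q => ?_, h'.counters, h'.sorted, fun l' e' he' => ?_⟩
    · change _ + upd σ.pq l (e ::ₘ σ.pq l) l' = ↑(inQueue (.inl l') (σ.enq ++ [(.inl l, e)]))
      rw [inQueue_append, ← Multiset.coe_add, ← h.pq l', add_assoc]
      by_cases hl : l' = l
      · subst hl
        rw [upd_same, inQueue_singleton, add_comm (σ.pq l'), Multiset.coe_singleton,
          Multiset.singleton_add]; rfl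
      · rw [upd_of_ne hl, inQueue_singleton_of_ne (by simpa using Ne.symm hl)]; simp; rfl
    · change _ = inQueue (.inr q) (σ.enq ++ [(.inl l, e)])
      rw [inQueue_append, inQueue_singleton_of_ne (by simp), List.append_nil]; exact h.fq q
    · refine ⟨(h'.stable l' e' he').1, fun e'' he'' => ?_⟩
      change e'' ∈ upd σ.pq l (e ::ₘ σ.pq l) l' at he''
      by_cases hl : l' = l
      · subst hl
        rw [upd_same, Multiset.mem_cons] at he''
        rcases he'' with rfl | he''
        -- Stability of the delivered element is used at the source of the new one.
        · exact key_lt_of_ts_lt (((h.stable l' e' he').1 _).trans_lt ht)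
        · exact (h.stable l' e' he').2 _ he''
      · rw [upd_of_ne hl] at he''; exact (h.stable l' e' he').2 _ he''
  | inr q =>
    refine ⟨hs, hle, fun l => ?_, fun q' => ?_, h'.counters, h'.sorted, h'.stable⟩
    · change _ = (↑(inQueue (.inl l) (σ.enq ++ [(.inr q, e)])) : Multiset (QElem Proc U))
      rw [inQueue_append, inQueue_singleton_of_ne (by simp), List.append_nil]; exact h.pq l
    · change _ ++ upd σ.fq q (σ.fq q ++ [e]) q' = inQueue (.inr q') (σ.enq ++ [(.inr q, e)])
      rw [inQueue_append, ← h.fq q', List.append_assoc]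
      by_cases hl : q' = q
      · subst hl
        rw [upd_same, inQueue_singleton]; rfl
      · rw [upd_of_ne hl, inQueue_singleton_of_ne (by simpa using Ne.symm hl), List.append_nil]; rfl

/-- An element passes the test only if its counter is the next one, so the list of delivered
counters grows by exactly one term. -/
theorem counters_snoc (h : QInv σ) {k : L ⊕ Proc} {e : QElem Proc U}
    (hc : e.counter = σ.reg (.counter e.src) + 1) (s : Proc) :
    (fromSrc s (σ.dlv ++ [(k, e)])).map (fun x => x.2.counter) =
      List.range' 1 (upd σ.reg (.counter e.src) e.counter (.counter s)) := by
  rw [fromSrc_append, List.map_append, h.counters s]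
  by_cases hs : e.src = s
  · subst hs
    rw [upd_same, fromSrc_singleton (x := (k, e)) rfl, hc, List.range'_concat]
    simp [hc, add_comm]
  · rw [fromSrc_singleton_of_ne (x := (k, e)) hs, upd_of_ne (by simpa using Ne.symm hs)]; simp

theorem dequeueFifo (h : QInv σ) {q : Proc} {e : QElem Proc U} {s : List (QElem Proc U)}
    (hq : σ.fq q = e :: s) (hc : e.counter = σ.reg (.counter e.src) + 1) :
    QInv ((σ.dequeueFifo q e s).setReg (.counter e.src) e.counter) := by
  have hT : ∀ q, upd σ.reg (.counter e.src) e.counter (.T q) = σ.reg (.T q) := fun q => by simp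
  refine ⟨h.streamed, fun x hx => (h.ts_le x hx).trans_eq (hT _).symm, fun l => ?_, fun q' => ?_,
    h.counters_snoc hc, ?_, fun l e' he' => ?_⟩
  · change (inQueue (.inl l) (σ.dlv ++ [(.inr q, e)]) : Multiset (QElem Proc U)) + _ = _
    rw [inQueue_append, inQueue_singleton_of_ne (by simp), List.append_nil]; exact h.pq l
  · change inQueue (.inr q') (σ.dlv ++ [(.inr q, e)]) ++ upd σ.fq q s q' = inQueue (.inr q') σ.enq
    rw [← h.fq q', inQueue_append]
    by_cases hl : q' = q
    · subst hl
      rw [upd_same, inQueue_singleton, hq]; simp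
    · rw [upd_of_ne hl, inQueue_singleton_of_ne (by simpa using Ne.symm hl), List.append_nil]
  · refine List.pairwise_append.2 ⟨h.sorted, by simp, fun x _ y hy l _ hyl => ?_⟩
    rw [List.mem_singleton] at hy; subst hy; simp at hyl
  · have he : (.inl l, e') ∈ σ.dlv := by
      rcases List.mem_append.1 he' with h | h
      · exact h
      · simp at h
    exact ⟨fun q => ((h.stable l e' he).1 q).trans_eq (hT q).symm, (h.stable l e' he).2⟩

/-- The removed element is above all earlier deliveries of its label because it was pending, and it
becomes stable because the test has just compared it with every T. -/
theorem dequeuePQ (h : QInv σ) {l : L} {e e' : QElem Proc U} {s : Multiset (QElem Proc U)}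
    (hl : σ.pq l = e ::ₘ s) (hmin : ∀ x ∈ s, e.key ≤ x.key) (hmin' : IsMinElem (σ.pq l) e')
    (hst : σ.Stable e') : QInv ((σ.dequeuePQ l e s).setReg (.counter e.src) e.counter) := by
  have he : e ∈ σ.pq l := by rw [hl]; exact Multiset.mem_cons_self e s
  have henq : ∀ x ∈ σ.pq l, (Sum.inl l, x) ∈ σ.enq := fun x hx => h.mem_pq_iff.2 (.inr hx)
  -- Both elements are minimal in the same queue, so their keys agree, and keys identify enqueued
  -- elements.
  obtain rfl : e' = e := by
    have hk : e'.key = e.key := by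
      refine le_antisymm (hmin'.2 _ he) ?_
      have := hmin'.1
      rw [hl, Multiset.mem_cons] at this
      rcases this with h | h
      · rw [h]
      · exact hmin _ h
    exact congrArg Prod.snd (h.streamed.eq_of_key (henq _ hmin'.1) (henq _ he) hk)
  -- Delivered and pending elements together form a duplicate-free multiset; this makes the
  -- inequalities with the remaining keys strict.
  have hes : e' ∉ s := by
    have hn := Multiset.coe_nodup.2 (h.streamed.nodup_inQueue (.inl l))
    rw [← h.pq l, hl] at hn
    exact (Multiset.nodup_cons.1 (Multiset.nodup_of_le (Multiset.le_add_left _ _) hn)).1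
  have hlt : ∀ x ∈ s, e'.key < x.key := fun x hx => lt_of_le_of_ne (hmin x hx) fun hk => hes <| by
    have := h.streamed.eq_of_key (henq _ he) (henq x (by rw [hl]; exact Multiset.mem_cons_of_mem hx)) hk
    rw [Prod.mk.injEq] at this
    rw [this.2]; exact hx
  have hT : ∀ q, upd σ.reg (.counter e'.src) e'.counter (.T q) = σ.reg (.T q) := fun q => by simp
  refine ⟨h.streamed, fun x hx => (h.ts_le x hx).trans_eq (hT _).symm, fun l' => ?_, fun q => ?_,
    h.counters_snoc hst.1, ?_, fun l' x hx => ?_⟩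
  · change ↑(inQueue (.inl l') (σ.dlv ++ [(.inl l, e')])) + upd σ.pq l s l' = ↑(inQueue (.inl l') σ.enq)
    rw [← h.pq l', inQueue_append]
    by_cases hll : l' = l
    · subst hll
      rw [upd_same, inQueue_singleton, hl, ← Multiset.coe_add, add_assoc, Multiset.coe_singleton,
        Multiset.singleton_add]
    · rw [upd_of_ne hll, inQueue_singleton_of_ne (by simpa using Ne.symm hll), List.append_nil]
  · change inQueue (.inr q) (σ.dlv ++ [(.inl l, e')]) ++ _ = _
    rw [inQueue_append, inQueue_singleton_of_ne (by simp), List.append_nil]; exact h.fq q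
  · refine List.pairwise_append.2 ⟨h.sorted, by simp, ?_⟩
    rintro ⟨k, x⟩ hx y hy l' hxl hyl
    rw [List.mem_singleton] at hy; subst hy
    obtain rfl : l = l' := by simpa using hyl
    obtain rfl : k = .inl l := hxl
    exact (h.stable l x hx).2 _ he
  · change (.inl l', x) ∈ σ.dlv ++ [(.inl l, e')] at hx
    change (∀ q, x.ts ≤ upd σ.reg (.counter e'.src) e'.counter (.T q)) ∧ ∀ y ∈ upd σ.pq l s l', x.key < y.key
    simp only [hT]
    rcases List.mem_append.1 hx with hx | hx
    · refine ⟨(h.stable l' x hx).1, fun y hy => (h.stable l' x hx).2 y ?_⟩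
      by_cases hll : l' = l
      · subst hll
        rw [upd_same] at hy
        rw [hl]; exact Multiset.mem_cons_of_mem hy
      · rwa [upd_of_ne hll] at hy
    · simp only [List.mem_singleton, Prod.mk.injEq, Sum.inl.injEq] at hx
      obtain ⟨rfl, rfl⟩ := hx
      refine ⟨hst.2, fun y hy => ?_⟩
      rw [upd_same] at hy; exact hlt y hy

/-- If no element can be delivered although all timestamps are stable, then everything has been
delivered. -/
theorem delivered_of_blocked (h : QInv σ) (hT : ∀ x ∈ σ.enq, ∀ q, x.2.ts ≤ σ.reg (.T q))
    (hfifo : ∀ q e, (.inr q, e) ∈ σ.enq → e.src = q)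
    (hpos : ∀ x ∈ σ.enq, 0 < x.2.counter)
    (hclosed : ∀ x ∈ σ.enq, ∀ c, 0 < c → c ≤ x.2.counter →
      ∃ y ∈ σ.enq, y.2.src = x.2.src ∧ y.2.counter = c)
    (hpq : ∀ l, σ.PQBlocked l) (hfq : ∀ q, σ.FifoBlocked q) :
    ∀ x ∈ σ.enq, x ∈ σ.dlv := by
  classical
  by_contra! hcon
  obtain ⟨x₀, hx₀, hx₀'⟩ := hcon
  -- An undelivered element with the least key over all queues; the rest of the proof shows that it
  -- was deliverable.
  obtain ⟨x, hx, hmin⟩ := Finset.exists_min_image (σ.enq.toFinset.filter (· ∉ σ.dlv))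
    (fun x => x.2.key) ⟨x₀, by simp [hx₀, hx₀']⟩
  simp only [Finset.mem_filter, List.mem_toFinset] at hx hmin
  obtain ⟨hxe, hxd⟩ := hx
  have hctr : ∀ y : Entry Proc U L, y ∈ σ.dlv → 0 < y.2.counter ∧
      y.2.counter ≤ σ.reg (.counter y.2.src) := by
    intro y hy
    have : y.2.counter ∈ (fromSrc y.2.src σ.dlv).map (fun x => x.2.counter) :=
      List.mem_map.2 ⟨y, mem_fromSrc.2 ⟨hy, rfl⟩, rfl⟩
    rw [h.counters, List.mem_range'_1] at this
    omega
  have hdel : ∀ s c, 0 < c → c ≤ σ.reg (.counter s) → ∃ y ∈ σ.dlv, y.2.src = s ∧ y.2.counter = c := by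
    intro s c h₀ h₁
    have : c ∈ (fromSrc s σ.dlv).map (fun x => x.2.counter) := by
      rw [h.counters, List.mem_range'_1]; omega
    obtain ⟨y, hy, hc⟩ := List.mem_map.1 this
    exact ⟨y, (mem_fromSrc.1 hy).1, (mem_fromSrc.1 hy).2, hc⟩
  -- A smaller counter would belong to an element already delivered. A larger one would leave the
  -- holder of the next counter undelivered, with an earlier timestamp from the same source, against
  -- minimality.
  have hnext : x.2.counter = σ.reg (.counter x.2.src) + 1 := by
    by_contra hne
    rcases lt_or_gt_of_ne hne with hlt | hgt
    · obtain ⟨y, hy, hs, hc⟩ := hdel x.2.src x.2.counter (hpos x hxe) (by omega)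
      exact hxd (h.streamed.eq_of_counter (h.mem_enq_of_mem_dlv hy) hxe hs hc ▸ hy)
    · obtain ⟨y, hy, hs, hc⟩ := hclosed x hxe (σ.reg (.counter x.2.src) + 1) (by omega) hgt.le
      have hyd : y ∉ σ.dlv := fun hyd => by have := (hctr y hyd).2; rw [hs] at this; omega
      have hk := ts_le_of_key_le (hmin y ⟨hy, hyd⟩)
      rcases h.streamed.trichotomy hxe hy hs.symm with rfl | h | h <;> omega
  obtain ⟨l | q, e⟩ := x
  · have he := (h.mem_pq_iff.1 hxe).resolve_left hxd
    rcases hpq l with h₀ | ⟨e₀, ⟨he₀, hm⟩, hst⟩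
    · rw [h₀] at he; exact Multiset.notMem_zero _ he
    · have he₀' : (Sum.inl l, e₀) ∈ σ.enq := h.mem_pq_iff.2 (.inr he₀)
      -- The unstable element reported by the test is minimal in this queue, and the chosen one is
      -- minimal among all undelivered elements; hence they are equal.
      have := h.streamed.eq_of_key he₀' hxe (le_antisymm (hm e he)
        (hmin _ ⟨he₀', h.not_mem_dlv_of_mem_pq he₀⟩))
      rw [Prod.mk.injEq] at this
      rw [this.2] at hst
      exact hst ⟨hnext, hT _ hxe⟩
  · have he := (h.mem_fq_iff.1 hxe).resolve_left hxd
    obtain ⟨a, s, hs⟩ := List.exists_cons_of_ne_nil (List.ne_nil_of_mem he)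
    have ha : a ∈ σ.fq q := by simp [hs]
    have ha' : (Sum.inr q, a) ∈ σ.enq := h.mem_fq_iff.2 (.inr ha)
    have hle := ts_le_of_key_le (hmin _ ⟨ha', h.not_mem_dlv_of_mem_fq ha⟩)
    rw [hs, List.mem_cons] at he
    rcases he with rfl | he
    · exact hfq q e (by simp [hs]) hnext
    -- A fifo queue holds elements of one source in timestamp order, so an element behind the head
    -- would have a larger timestamp than the head, contrary to minimality.
    · have hp : (inQueue (.inr q) σ.enq).Pairwise fun x y => x.src = y.src → x.ts < y.ts :=
        List.pairwise_map.2 ((h.streamed.pairwise.filter _).imp fun h hs => (h hs).1)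
      rw [← h.fq q, hs, List.pairwise_append, List.pairwise_cons] at hp
      exact absurd (hp.2.1.1 e he ((hfifo _ _ ha').trans (hfifo _ _ hxe).symm)) (not_lt.2 hle)

end QInv

end Histories

/-! ## Message streams -/

section Streams

variable {Proc V Val U L : Type}

/-- The timestamp of a message. -/
def Msg.ts : Msg Proc U L → ℕ
  | .localBroadcastRequest _ _ => 0
  | .tsUpdate t _ => t
  | .ordMsg _ e => e.ts

/-- The request made by a message. -/
def Msg.request? : Msg Proc U L → Option (U × Option L)
  | .localBroadcastRequest u l => some (u, l)
  | _ => none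

/-- The entry made when a message from `s` announces a new element. -/
def Msg.entry? (s : Proc) : Msg Proc U L → Option (Entry Proc U L)
  | .ordMsg l e => some (queueOf l s, e)
  | _ => none

/-- The labeled update of an entry. -/
def labeledUpdate (x : Entry Proc U L) : U × Option L := (x.2.update, queueLabel x.1)

/-- The entries announced by a sequence of messages from `s`. -/
def arrivals (s : Proc) (M : List (Msg Proc U L)) : List (Entry Proc U L) :=
  M.filterMap (Msg.entry? s)

/-- The last timestamp in a sequence of messages. -/
def lastTs (M : List (Msg Proc U L)) : ℕ := M.foldl (fun _ m => m.ts) 0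

/-- The timestamps in a sequence of messages are positive and increase. -/
def IncTs (M : List (Msg Proc U L)) : Prop := (0 :: M.map Msg.ts).Pairwise (· < ·)

open scoped Classical in
/-- The messages received from `s`. -/
noncomputable def rcvFrom (s : Proc) (R : List (Proc × Msg Proc U L)) : List (Msg Proc U L) :=
  R.filterMap fun x => if x.1 = s then some x.2 else none

variable {s p : Proc} {M : List (Msg Proc U L)} {m : Msg Proc U L}

@[simp] theorem queueLabel_queueOf {l : Option L} : queueLabel (queueOf l s) = l := by
  cases l <;> rfl

theorem mem_arrivals {x : Entry Proc U L} :
    x ∈ arrivals s M ↔ ∃ l, Msg.ordMsg l x.2 ∈ M ∧ x.1 = queueOf l s := by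
  obtain ⟨k, e⟩ := x
  simp only [arrivals, List.mem_filterMap]
  constructor
  · rintro ⟨_ | _ | ⟨l, e'⟩, hm, h⟩
    · cases h
    · cases h
    · cases h; exact ⟨l, hm, rfl⟩
  · rintro ⟨l, hm, rfl⟩; exact ⟨_, hm, rfl⟩

@[simp] theorem lastTs_snoc : lastTs (M ++ [m]) = m.ts := by simp [lastTs]

/-- The leading 0 is the initial value of T and covers the empty stream. -/
theorem lastTs_mem (M : List (Msg Proc U L)) : lastTs M ∈ 0 :: M.map Msg.ts := by
  rcases List.eq_nil_or_concat M with rfl | ⟨N, m, rfl⟩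
  · simp [lastTs]
  · simp

theorem incTs_append {N : List (Msg Proc U L)} (h : IncTs (M ++ N)) : IncTs M := by
  rw [IncTs, List.map_append, ← List.cons_append] at h
  exact (List.pairwise_append.1 h).1

theorem IncTs.lastTs_lt (h : IncTs (M ++ [m])) : lastTs M < m.ts := by
  rw [IncTs, List.map_append, ← List.cons_append] at h
  exact (List.pairwise_append.1 h).2.2 _ (lastTs_mem M) _ (by simp)

theorem IncTs.le_lastTs (h : IncTs M) (hm : m ∈ M) : m.ts ≤ lastTs M := by
  rcases List.eq_nil_or_concat M with rfl | ⟨N, m', rfl⟩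
  · simp at hm
  · rw [List.concat_eq_append] at h hm ⊢
    rw [IncTs, List.map_append, ← List.cons_append] at h
    rw [lastTs_snoc]
    rcases List.mem_append.1 hm with hm | hm
    · exact ((List.pairwise_append.1 h).2.2 _ (List.mem_cons_of_mem _ (List.mem_map_of_mem hm)) _
        (by simp)).le
    · rw [List.mem_singleton.1 hm]

theorem IncTs.snoc (h : IncTs M) (hm : lastTs M < m.ts) : IncTs (M ++ [m]) := by
  rw [IncTs, List.map_append, ← List.cons_append]
  refine List.pairwise_append.2 ⟨h, by simp, fun a ha b hb => ?_⟩
  rw [List.map_singleton, List.mem_singleton] at hb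
  subst hb
  rcases List.mem_cons.1 ha with rfl | ha
  · omega
  · obtain ⟨m', hm', rfl⟩ := List.mem_map.1 ha
    exact (h.le_lastTs hm').trans_lt hm

theorem arrivals_append {N : List (Msg Proc U L)} :
    arrivals s (M ++ N) = arrivals s M ++ arrivals s N := by simp [arrivals]

@[simp] theorem arrivals_ordMsg {l : Option L} {e : QElem Proc U} :
    arrivals s [Msg.ordMsg l e] = [(queueOf l s, e)] := rfl

@[simp] theorem arrivals_tsUpdate {t : ℕ} {q : Proc} :
    arrivals s [(Msg.tsUpdate t q : Msg Proc U L)] = [] := rfl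

/-- A sequence of messages that `s` may send to the other processes. -/
structure GoodStream (s : Proc) (M : List (Msg Proc U L)) : Prop where
  inc : IncTs M
  src : ∀ x ∈ arrivals s M, x.2.src = s
  counters : (arrivals s M).map (fun x => x.2.counter) = List.range' 1 (arrivals s M).length

theorem GoodStream.nil : GoodStream s ([] : List (Msg Proc U L)) :=
  ⟨by simp [IncTs], by simp [arrivals], by simp [arrivals]⟩

/-- Good streams are closed under prefixes. This lets a property of the final stream be used at
every earlier state. -/
theorem GoodStream.of_append {N : List (Msg Proc U L)} (h : GoodStream s (M ++ N)) :
    GoodStream s M := by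
  refine ⟨incTs_append h.inc, fun x hx => h.src x (by simp [arrivals_append, hx]), ?_⟩
  have := h.counters
  rw [arrivals_append, List.map_append, List.length_append, ← List.range'_append_1] at this
  exact (List.append_inj this (by simp)).1

theorem GoodStream.counter_last {l : Option L} {e : QElem Proc U}
    (h : GoodStream s (M ++ [.ordMsg l e])) : e.counter = (arrivals s M).length + 1 := by
  have := h.counters
  rw [arrivals_append, List.map_append, List.length_append, ← List.range'_append_1] at this
  have := (List.append_inj this (by simp)).2
  simp at this
  omega

theorem GoodStream.snoc_ordMsg (h : GoodStream s M) {l : Option L} {e : QElem Proc U}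
    (hs : e.src = s)
    (ht : lastTs M < e.ts) (hc : e.counter = (arrivals s M).length + 1) :
    GoodStream s (M ++ [.ordMsg l e]) := by
  refine ⟨h.inc.snoc ht, ?_, ?_⟩
  · rw [arrivals_append]
    intro x hx
    rcases List.mem_append.1 hx with hx | hx
    · exact h.src x hx
    · rw [arrivals_ordMsg, List.mem_singleton] at hx; subst hx; exact hs
  · rw [arrivals_append, List.map_append, List.length_append, ← List.range'_append_1, h.counters,
      arrivals_ordMsg]
    simp [hc, add_comm]

theorem GoodStream.snoc_tsUpdate (h : GoodStream s M) {t : ℕ} {q : Proc} (ht : lastTs M < t) :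
    GoodStream s (M ++ [.tsUpdate t q]) := by
  refine ⟨h.inc.snoc ht, ?_, ?_⟩ <;> rw [arrivals_append, arrivals_tsUpdate, List.append_nil]
  exacts [h.src, h.counters]

theorem GoodStream.counter_mem (h : GoodStream s M) {x : Entry Proc U L} (hx : x ∈ arrivals s M) :
    0 < x.2.counter ∧ x.2.counter ≤ (arrivals s M).length := by
  have : x.2.counter ∈ (arrivals s M).map (fun x => x.2.counter) := List.mem_map.2 ⟨x, hx, rfl⟩
  rw [h.counters, List.mem_range'_1] at this
  omega

theorem GoodStream.exists_counter (h : GoodStream s M) {c : ℕ} (h₀ : 0 < c)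
    (hc : c ≤ (arrivals s M).length) : ∃ x ∈ arrivals s M, x.2.counter = c := by
  have : c ∈ (arrivals s M).map (fun x => x.2.counter) := by
    rw [h.counters, List.mem_range'_1]; omega
  exact List.mem_map.1 this

theorem mem_rcvFrom {R : List (Proc × Msg Proc U L)} : m ∈ rcvFrom s R ↔ (s, m) ∈ R := by
  simp [rcvFrom]

theorem rcvFrom_snoc {R : List (Proc × Msg Proc U L)} :
    rcvFrom s (R ++ [(s, m)]) = rcvFrom s R ++ [m] := by simp [rcvFrom]

theorem rcvFrom_snoc_of_ne {R : List (Proc × Msg Proc U L)} {s' : Proc} (h : s' ≠ s) :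
    rcvFrom s (R ++ [(s', m)]) = rcvFrom s R := by simp [rcvFrom, h]

/-- Supplies what `QInv.enqueue` requires of a new element, from the position of its announcement in
the stream. -/
theorem GoodStream.fresh {l : Option L} {e : QElem Proc U}
    (h : GoodStream s (M ++ [.ordMsg l e])) {E : List (Entry Proc U L)}
    (hE : fromSrc s E = arrivals s M) :
    lastTs M < e.ts ∧ e.src = s ∧ ∀ y ∈ E, y.2.src = e.src → y.2.counter < e.counter := by
  have hs : e.src = s := h.src (queueOf l s, e) (by simp [arrivals_append])
  refine ⟨h.inc.lastTs_lt, hs, fun y hy hys => ?_⟩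
  have hy' : y ∈ arrivals s M := hE ▸ mem_fromSrc.2 ⟨hy, hys.trans hs⟩
  have := h.of_append.counter_mem hy'
  rw [h.counter_last]; omega

/-! ## Invariants of the streams of a process -/

section EnqueueFields

variable {σ : LState Proc U L} {k : L ⊕ Proc} {e : QElem Proc U}

@[simp] theorem enqueue_reg : (σ.enqueue k e).reg = σ.reg := by cases k <;> rfl
@[simp] theorem enqueue_rcv : (σ.enqueue k e).rcv = σ.rcv := by cases k <;> rfl
@[simp] theorem enqueue_snd : (σ.enqueue k e).snd = σ.snd := by cases k <;> rfl
@[simp] theorem enqueue_dlv : (σ.enqueue k e).dlv = σ.dlv := by cases k <;> rfl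
@[simp] theorem enqueue_log : (σ.enqueue k e).log = σ.log := by cases k <;> rfl
@[simp] theorem enqueue_enq : (σ.enqueue k e).enq = σ.enq ++ [(k, e)] := by cases k <;> rfl

end EnqueueFields

/-- All messages received by `p` are messages that processes send to `p`. -/
def RcvOK (p : Proc) (σ : LState Proc U L) : Prop := ∀ x ∈ σ.rcv, MsgFrom x.1 p x.2

/-- Invariants of the messages that `p` sends. -/
structure SendInv (p : Proc) (σ : LState Proc U L) (B : List (Msg Proc U L)) : Prop where
  snd : ∀ d, d ≠ p → σ.snd d = B
  ts : σ.reg (.T p) = lastTs B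
  good : GoodStream p B
  localCounter : σ.reg .localCounter = (arrivals p B).length
  requests : (arrivals p B).map labeledUpdate = (rcvFrom p σ.rcv).filterMap Msg.request?

variable [LinearOrder Proc] {σ : LState Proc U L} {B : List (Msg Proc U L)}

/-- Messages from others never touch T[p] except through an arrival that raises it, and this is
broadcast at once; requests come from p itself and yield one announcement each. Nothing is assumed
about the timestamps or counters that others send. -/
theorem Reach.sendInv (h : Reach p σ B) (hr : RcvOK p σ) : SendInv p σ B := by
  -- The hypothesis concerns the final receive history; a step backwards drops its last message.
  have last : ∀ {s : Proc} {m : Msg Proc U L} {R : List (Proc × Msg Proc U L)},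
      (∀ x ∈ R ++ [(s, m)], MsgFrom x.1 p x.2) → MsgFrom s p m ∧ ∀ x ∈ R, MsgFrom x.1 p x.2 :=
    fun {s m _} h => ⟨h (s, m) (by simp), fun x hx => h x (by simp [hx])⟩
  induction h with
  | init => exact ⟨fun _ _ => rfl, rfl, .nil, rfl, rfl⟩
  | sendSelf m _ ih =>
    have := ih hr
    exact ⟨fun d hd => by simpa [LState.sendTo, hd] using this.snd d hd, this.ts, this.good,
      this.localCounter, this.requests⟩
  | @request σ B s u l _ ih =>
    obtain ⟨hs, hr'⟩ := last (m := .localBroadcastRequest u l) (by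
      simpa [RcvOK, LState.sendOthers, LState.request, LState.setReg, LState.receive] using hr)
    obtain rfl : p = s := hs
    have := ih hr'
    refine ⟨fun d hd => ?_, ?_, ?_, ?_, ?_⟩
    · simp [LState.sendOthers, LState.request, LState.setReg, LState.receive, hd, this.snd d hd]
    · simp [LState.sendOthers, LState.request, LState.setReg, LState.receive, Msg.ts, LState.newElem]
    · exact this.good.snoc_ordMsg rfl (by simp [LState.newElem, this.ts])
        (by simp [LState.newElem, this.localCounter])
    · simp [LState.sendOthers, LState.request, LState.setReg, arrivals_append, this.localCounter]
    · rw [arrivals_append, List.map_append, this.requests]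
      simp only [LState.sendOthers, LState.request, LState.setReg, LState.receive, enqueue_rcv]
      rw [rcvFrom_snoc, List.filterMap_append]
      simp [labeledUpdate, LState.newElem, Msg.request?]
  | @tsUpdate σ B s t q _ ih =>
    -- A timestamp message concerns its own sender, which is not p, so T[p] is not overwritten.
    obtain ⟨⟨hs, rfl⟩, hr'⟩ := last (m := .tsUpdate t q) hr
    have := ih hr'
    refine ⟨this.snd, ?_, this.good, ?_, ?_⟩
    · simpa [LState.setReg, LState.receive, hs] using this.ts
    · simpa [LState.setReg, LState.receive] using this.localCounter
    · simpa [LState.setReg, LState.receive, rcvFrom_snoc_of_ne hs.symm] using this.requests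
  | @arrive σ B s l e _ _ ih =>
    obtain ⟨hs, hr'⟩ := last (m := .ordMsg l e) (by
      simpa [RcvOK, LState.arrive, LState.setReg, LState.receive] using hr)
    replace hs : p ≠ s := hs
    have := ih hr'
    refine ⟨fun d hd => ?_, ?_, this.good, ?_, ?_⟩
    · simpa [LState.arrive, LState.setReg, LState.receive] using this.snd d hd
    · simpa [LState.arrive, LState.setReg, LState.receive, hs] using this.ts
    · simpa [LState.arrive, LState.setReg, LState.receive] using this.localCounter
    · simpa [LState.arrive, LState.setReg, LState.receive, rcvFrom_snoc_of_ne hs.symm]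
        using this.requests
  | @arriveRaise σ B s l e _ hlt ih =>
    obtain ⟨hs, hr'⟩ := last (m := .ordMsg l e) (by
      simpa [RcvOK, LState.sendOthers, LState.arrive, LState.setReg, LState.receive] using hr)
    replace hs : p ≠ s := hs
    have := ih hr'
    refine ⟨fun d hd => ?_, ?_, this.good.snoc_tsUpdate ?_, ?_, ?_⟩
    · simpa [LState.sendOthers, LState.arrive, LState.setReg, LState.receive, hd] using this.snd d hd
    · simp [LState.sendOthers, LState.setReg, Msg.ts]
    · rw [← this.ts]
      simpa [LState.arrive, LState.setReg, LState.receive, hs] using hlt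
    · simpa [LState.sendOthers, LState.arrive, LState.setReg, LState.receive, arrivals_append]
        using this.localCounter
    · simpa [LState.sendOthers, LState.arrive, LState.setReg, LState.receive, arrivals_append,
        rcvFrom_snoc_of_ne hs.symm] using this.requests
  | dequeuePQ _ _ _ _ _ _ _ _ _ ih | dequeueFifo _ _ _ _ _ _ ih =>
    have := ih hr
    exact ⟨this.snd, (upd_of_ne (by simp)).trans this.ts, this.good,
      (upd_of_ne (by simp)).trans this.localCounter, this.requests⟩

/-! ## Invariants of the deliveries of a process -/

open scoped Classical in
/-- The messages that `s` sends to the other processes, as far as `p` knows them. -/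
noncomputable def stream (p : Proc) (σ : LState Proc U L) (B : List (Msg Proc U L)) (s : Proc) :
    List (Msg Proc U L) :=
  if s = p then B else rcvFrom s σ.rcv

/-- A log entry for the delivery of an element that `p` broadcasts is not followed by the request. -/
def LogOrder (p : Proc) (a b : (Proc × Msg Proc U L) ⊕ Entry Proc U L) : Prop :=
  ∀ x u l, a = .inr x → x.2.src = p → b = .inl (p, .localBroadcastRequest u l) →
    labeledUpdate x ≠ (u, l)

/-- Invariants of the deliveries of `p`. -/
structure DeliverInv (p : Proc) (σ : LState Proc U L) (B : List (Msg Proc U L)) : Prop where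
  ts : ∀ s, σ.reg (.T s) = lastTs (stream p σ B s)
  enq : ∀ s, fromSrc s σ.enq = arrivals s (stream p σ B s)
  own : ∀ x ∈ σ.enq, x.2.ts ≤ σ.reg (.T p)
  queues : QInv σ
  logDlv : ∀ x, .inr x ∈ σ.log → x ∈ σ.dlv
  log : σ.log.Pairwise (LogOrder p)

/-- The queue invariants do not see the histories of messages or the log. -/
theorem QInv.congr {σ σ' : LState Proc U L} (h : QInv σ) (h₁ : σ'.reg = σ.reg) (h₂ : σ'.pq = σ.pq)
    (h₃ : σ'.fq = σ.fq) (h₄ : σ'.enq = σ.enq) (h₅ : σ'.dlv = σ.dlv) : QInv σ' := by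
  obtain ⟨_, _, _, _, _, _, _, _⟩ := σ
  obtain ⟨_, _, _, _, _, _, _, _⟩ := σ'
  subst h₁ h₂ h₃ h₄ h₅
  exact ⟨h.1, h.2, h.3, h.4, h.5, h.6, h.7⟩

/-- A delivered element with source p was created by a request that p had already received. The same
request arriving now would be received twice. -/
theorem DeliverInv.log_receive {p : Proc} {σ : LState Proc U L} {B : List (Msg Proc U L)}
    (h : DeliverInv p σ B) (hs : SendInv p σ B) {s : Proc} {m : Msg Proc U L}
    (hn : (σ.rcv ++ [(s, m)]).Nodup) : List.Pairwise (LogOrder p) (σ.log ++ [.inl (s, m)]) := by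
  refine List.pairwise_append.2 ⟨h.log, by simp, ?_⟩
  rintro a ha b hb x u l rfl hx rfl hxu
  rw [List.mem_singleton, Sum.inl.injEq] at hb
  have hxe : x ∈ fromSrc p σ.enq :=
    mem_fromSrc.2 ⟨h.queues.mem_enq_of_mem_dlv (h.logDlv x ha), hx⟩
  rw [h.enq p, stream, if_pos rfl] at hxe
  have : (u, l) ∈ (arrivals p B).map labeledUpdate := List.mem_map.2 ⟨x, hxe, hxu⟩
  rw [hs.requests] at this
  obtain ⟨m', hm', hmr⟩ := List.mem_filterMap.1 this
  rw [mem_rcvFrom] at hm'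
  cases m' with
  | localBroadcastRequest u' l' =>
    obtain ⟨rfl, rfl⟩ : u' = u ∧ l' = l := by simpa [Msg.request?] using hmr
    exact (List.nodup_append.1 hn).2.2 _ hm' _ (List.mem_singleton_self _) hb
  | tsUpdate => cases hmr
  | ordMsg => cases hmr

theorem stream_self : stream p σ B p = B := if_pos rfl

theorem stream_of_ne {s : Proc} (h : s ≠ p) : stream p σ B s = rcvFrom s σ.rcv := if_neg h

/-- The common part of the two arrival steps. They differ only in whether p raises T[p] and appends
a timestamp message to its stream, which announces no element. -/
theorem DeliverInv.arrive (h : DeliverInv p σ B) (hs : SendInv p σ B) {s : Proc} (hsp : s ≠ p)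
    {l : Option L} {e : QElem Proc U} (hg : GoodStream s (rcvFrom s (σ.rcv ++ [(s, Msg.ordMsg l e)])))
    (hn : List.Nodup (σ.rcv ++ [(s, .ordMsg l e)])) {σ' : LState Proc U L} {B' : List (Msg Proc U L)}
    (hrcv : σ'.rcv = σ.rcv ++ [(s, .ordMsg l e)])
    (hlog : σ'.log = σ.log ++ [.inl (s, .ordMsg l e)])
    (hpq : σ'.pq = (σ.enqueue (queueOf l s) e).pq) (hfq : σ'.fq = (σ.enqueue (queueOf l s) e).fq)
    (henq : σ'.enq = σ.enq ++ [(queueOf l s, e)]) (hdlv : σ'.dlv = σ.dlv)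
    (hts : σ'.reg (.T s) = e.ts) (hne : ∀ q, q ≠ s → q ≠ p → σ'.reg (.T q) = σ.reg (.T q))
    (hp : σ'.reg (.T p) = lastTs B') (hple : σ.reg (.T p) ≤ lastTs B')
    (hown : e.ts ≤ lastTs B')
    (hc : ∀ q, σ'.reg (.counter q) = σ.reg (.counter q)) (hB : arrivals p B' = arrivals p B) :
    DeliverInv p σ' B' := by
  rw [rcvFrom_snoc] at hg
  have hE := h.enq s
  rw [stream_of_ne hsp] at hE
  obtain ⟨h₁, h₂, h₃⟩ := hg.fresh hE
  rw [← stream_of_ne (B := B) hsp, ← h.ts] at h₁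
  have hother : ∀ q, q ≠ s → q ≠ p → stream p σ' B' q = stream p σ B q := by
    intro q hqs hqp
    rw [stream_of_ne hqp, stream_of_ne hqp, hrcv, rcvFrom_snoc_of_ne (Ne.symm hqs)]
  have hthis : stream p σ' B' s = stream p σ B s ++ [.ordMsg l e] := by
    rw [stream_of_ne hsp, stream_of_ne hsp, hrcv, rcvFrom_snoc]
  refine ⟨fun q => ?_, fun q => ?_, ?_, ?_, ?_, ?_⟩
  · by_cases hqp : q = p
    · subst hqp; rw [stream_self, hp]
    · by_cases hqs : q = s
      · subst hqs; rw [hthis, hts, lastTs_snoc]; rfl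
      · rw [hother q hqs hqp, hne q hqs hqp, h.ts]
  · rw [henq, fromSrc_append, h.enq]
    by_cases hqs : q = s
    · subst hqs
      rw [hthis, arrivals_append, fromSrc_singleton (x := (queueOf l q, e)) h₂, arrivals_ordMsg]
    · rw [fromSrc_singleton_of_ne (x := (queueOf l s, e)) (fun hq => hqs (hq.symm.trans h₂)), List.append_nil]
      by_cases hqp : q = p
      · subst hqp; rw [stream_self, stream_self, hB]
      · rw [hother q hqs hqp]
  · rw [henq, hp]
    intro x hx
    rcases List.mem_append.1 hx with hx | hx
    · exact (h.own x hx).trans hple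
    · rw [List.mem_singleton] at hx; subst hx; exact hown
  · refine (h.queues.enqueue (k := queueOf l s) (e := e) (reg := σ'.reg)
      (by rwa [h₂]) h₃ hc ?_ (by rw [h₂, hts])).congr ?_ ?_ ?_ ?_ ?_
    · intro q
      by_cases hqs : q = s
      · subst hqs; rw [hts]; exact h₁.le
      · by_cases hqp : q = p
        · subst hqp; rw [hp]; exact hple
        · rw [hne q hqs hqp]
    · simp
    · rw [hpq]; cases l <;> rfl
    · rw [hfq]; cases l <;> rfl
    · rw [henq]; simp
    · rw [hdlv]; simp
  · rw [hlog, hdlv]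
    intro x hx
    exact h.logDlv x (by simpa using hx)
  · rw [hlog]; exact h.log_receive hs hn

/-- Well-formedness of the received streams enters as a hypothesis; it is discharged later by the
send invariants of the other processes. It makes each arriving element fresh and each T monotone. -/
theorem Reach.deliverInv (h : Reach p σ B) (hr : RcvOK p σ)
    (hg : ∀ s, s ≠ p → GoodStream s (rcvFrom s σ.rcv)) (hn : σ.rcv.Nodup) : DeliverInv p σ B := by
  have last : ∀ {s : Proc} {m : Msg Proc U L} {R : List (Proc × Msg Proc U L)},
      (∀ x ∈ R ++ [(s, m)], MsgFrom x.1 p x.2) → MsgFrom s p m ∧ ∀ x ∈ R, MsgFrom x.1 p x.2 :=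
    fun {s m _} h => ⟨h (s, m) (by simp), fun x hx => h x (by simp [hx])⟩
  have lastg : ∀ {s : Proc} {m : Msg Proc U L} {R : List (Proc × Msg Proc U L)},
      (∀ s', s' ≠ p → GoodStream s' (rcvFrom s' (R ++ [(s, m)]))) →
      ∀ s', s' ≠ p → GoodStream s' (rcvFrom s' R) := by
    intro s m R h s' hs'
    have := h s' hs'
    by_cases hss : s = s'
    · subst hss; rw [rcvFrom_snoc] at this; exact this.of_append
    · rwa [rcvFrom_snoc_of_ne hss] at this
  have logIn : ∀ {σ : LState Proc U L} {y : Proc × Msg Proc U L},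
      (∀ x, .inr x ∈ σ.log → x ∈ σ.dlv) → ∀ x, .inr x ∈ σ.log ++ [.inl y] → x ∈ σ.dlv := by
    intro σ y h x hx
    exact h x (by simpa using hx)
  induction h with
  | init =>
    refine ⟨fun s => ?_, fun s => ?_, by simp [LState.init], .init, by simp [LState.init],
      by simp [LState.init]⟩
    · by_cases hs : s = p <;> simp [stream, LState.init, hs, rcvFrom, lastTs]
    · by_cases hs : s = p <;> simp [stream, LState.init, hs, rcvFrom, arrivals, fromSrc]
  | sendSelf m _ ih =>
    have := ih hr hg hn
    exact ⟨this.ts, this.enq, this.own, this.queues.congr rfl rfl rfl rfl rfl, this.logDlv, this.log⟩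
  | @request σ B s u l h ih =>
    -- A process does not send to itself, so freshness of its own element comes from its outgoing
    -- stream, already extended by the announcement.
    have hgood := (h.request s u l).sendInv hr |>.good
    have hrcv : ((σ.request p s u l).sendOthers p (.ordMsg l (σ.newElem p u))).rcv =
        σ.rcv ++ [(s, .localBroadcastRequest u l)] := by
      simp [LState.sendOthers, LState.request, LState.setReg, LState.receive]
    rw [RcvOK, hrcv] at hr
    rw [hrcv] at hg hn
    obtain ⟨hs, hr'⟩ := last hr
    obtain rfl : p = s := hs
    have := ih hr' (lastg hg) (List.nodup_append.1 hn).1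
    have hE := this.enq p
    rw [stream_self] at hE
    obtain ⟨h₁, h₂, h₃⟩ := hgood.fresh hE
    have hT := this.ts p
    rw [stream_self] at hT
    refine ⟨fun s => ?_, fun s => ?_, ?_, ?_, ?_, ?_⟩
    · by_cases hs : s = p
      · subst hs
        simp [stream_self, Msg.ts, LState.sendOthers, LState.request, LState.setReg, LState.newElem]
      · rw [stream_of_ne hs, hrcv, rcvFrom_snoc_of_ne (Ne.symm hs), ← stream_of_ne (B := B) hs, ← this.ts]
        simp [LState.sendOthers, LState.request, LState.setReg, LState.receive, hs]
    · have : fromSrc s (σ.enq ++ [(queueOf l p, σ.newElem p u)]) = arrivals s (stream p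
        ((σ.request p p u l).sendOthers p (.ordMsg l (σ.newElem p u)))
        (B ++ [.ordMsg l (σ.newElem p u)]) s) := by
        rw [fromSrc_append, this.enq]
        by_cases hs : s = p
        · subst hs
          rw [stream_self, stream_self, arrivals_append,
            fromSrc_singleton (s := s) (x := (queueOf l s, σ.newElem s u)) rfl, arrivals_ordMsg]
        · rw [stream_of_ne hs, stream_of_ne hs, hrcv, rcvFrom_snoc_of_ne (Ne.symm hs),
            fromSrc_singleton_of_ne (x := (queueOf l p, σ.newElem p u)) (Ne.symm hs), List.append_nil]
      rw [← this]
      simp [LState.sendOthers, LState.request, LState.setReg, LState.receive]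
    · have hp : ((σ.request p p u l).sendOthers p (.ordMsg l (σ.newElem p u))).reg (.T p) =
          σ.reg (.T p) + 1 := by simp [LState.sendOthers, LState.request, LState.setReg]
      have henq : ((σ.request p p u l).sendOthers p (.ordMsg l (σ.newElem p u))).enq =
          σ.enq ++ [(queueOf l p, σ.newElem p u)] := by
        simp [LState.sendOthers, LState.request, LState.setReg, LState.receive]
      rw [henq, hp]
      intro x hx
      rcases List.mem_append.1 hx with hx | hx
      · exact (this.own x hx).trans (Nat.le_succ _)
      · rw [List.mem_singleton] at hx; subst hx; exact le_rfl
    · refine (this.queues.enqueue (k := queueOf l p) (e := σ.newElem p u)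
        (reg := upd (upd σ.reg (.T p) (σ.reg (.T p) + 1)) .localCounter (σ.reg .localCounter + 1))
        ?_ h₃ ?_ ?_ ?_).congr ?_ ?_ ?_ ?_ ?_
      · simp [LState.newElem]
      · simp
      · intro q
        by_cases hq : q = p
        · subst hq; simp
        · simp [hq]
      · simp [LState.newElem]
      all_goals cases l <;> rfl
    · simpa [LState.sendOthers, LState.request, LState.setReg, LState.receive] using this.logDlv
    · simpa [LState.sendOthers, LState.request, LState.setReg, LState.receive] using
        this.log_receive (h.sendInv hr') hn
  | @tsUpdate σ B s t q h ih =>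
    obtain ⟨⟨hs, rfl⟩, hr'⟩ := last (m := .tsUpdate t q) hr
    have := ih hr' (lastg (m := .tsUpdate t q) hg) (List.nodup_append'.1 hn).1
    have hgq := hg q hs.symm
    change GoodStream q (rcvFrom q (σ.rcv ++ [(q, .tsUpdate t q)])) at hgq
    rw [rcvFrom_snoc] at hgq
    -- The stream of the sender increases, so overwriting T[q] raises it.
    have hlt := hgq.inc.lastTs_lt
    rw [← stream_of_ne (B := B) hs.symm, ← this.ts] at hlt
    have hstream : ∀ s, stream p ((σ.receive q (.tsUpdate t q)).setReg (.T q) t) B s =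
        if s = q then stream p σ B s ++ [.tsUpdate t q] else stream p σ B s := by
      intro s
      by_cases hsp : s = p
      · subst hsp; simp [stream_self, hs]
      · rw [stream_of_ne hsp, stream_of_ne hsp]
        by_cases hsq : s = q
        · subst hsq; rw [if_pos rfl]; exact rcvFrom_snoc
        · rw [if_neg hsq]; exact rcvFrom_snoc_of_ne (Ne.symm hsq)
    refine ⟨fun s => ?_, fun s => ?_, ?_, ?_, ?_, ?_⟩
    · rw [hstream]
      by_cases hsq : s = q
      · subst hsq; simp [LState.setReg, Msg.ts]
      · simpa [LState.setReg, LState.receive, hsq] using this.ts s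
    · rw [hstream]
      refine (this.enq s).trans ?_
      split_ifs <;> simp [arrivals_append]
    · have hp : ((σ.receive q (.tsUpdate t q)).setReg (.T q) t).reg (.T p) = σ.reg (.T p) :=
        upd_of_ne (by simpa using hs)
      rw [hp]; exact this.own
    · refine (this.queues.raise (reg := upd σ.reg (.T q) t) (by simp) fun s => ?_).congr rfl rfl rfl rfl rfl
      by_cases hsq : s = q
      · subst hsq; rw [upd_same]; exact hlt.le
      · simp [hsq]
    · exact logIn this.logDlv
    · exact this.log_receive (h.sendInv hr') hn
  | @arrive σ B s l e h hle ih =>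
    have hinv := (h.arrive s l e hle).sendInv hr
    have hrcv : (σ.arrive s l e).rcv = σ.rcv ++ [(s, .ordMsg l e)] := by
      simp [LState.arrive, LState.setReg, LState.receive]
    rw [RcvOK, hrcv] at hr
    rw [hrcv] at hg hn
    obtain ⟨hs, hr'⟩ := last hr
    replace hs : p ≠ s := hs
    refine (ih hr' (lastg hg) (List.nodup_append'.1 hn).1).arrive (h.sendInv hr') hs.symm
      (hg s hs.symm) hn hrcv ?_ ?_ ?_ ?_ ?_ ?_ ?_ hinv.ts (h.sendInv hr').ts.le (hle.trans_eq hinv.ts) ?_ rfl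
    · simp [LState.arrive, LState.setReg, LState.receive]
    · cases l <;> rfl
    · cases l <;> rfl
    · simp [LState.arrive, LState.setReg, LState.receive]
    · simp [LState.arrive, LState.setReg, LState.receive]
    · simp [LState.arrive, LState.setReg]
    · intro q hq _; simp [LState.arrive, LState.setReg, LState.receive, hq]
    · intro q; simp [LState.arrive, LState.setReg, LState.receive]
  | @arriveRaise σ B s l e h hlt ih =>
    have hinv := (h.arriveRaise s l e hlt).sendInv hr
    have hrcv : (((σ.arrive s l e).setReg (.T p) e.ts).sendOthers p (.tsUpdate e.ts p)).rcv =
        σ.rcv ++ [(s, .ordMsg l e)] := by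
      simp [LState.arrive, LState.setReg, LState.receive, LState.sendOthers]
    rw [RcvOK, hrcv] at hr
    rw [hrcv] at hg hn
    obtain ⟨hs, hr'⟩ := last hr
    replace hs : p ≠ s := hs
    refine (ih hr' (lastg hg) (List.nodup_append'.1 hn).1).arrive (h.sendInv hr') hs.symm
      (hg s hs.symm) hn hrcv ?_ ?_ ?_ ?_ ?_ ?_ ?_ hinv.ts ?_ ?_ ?_ ?_
    · simp [LState.arrive, LState.setReg, LState.receive, LState.sendOthers]
    · cases l <;> rfl
    · cases l <;> rfl
    · simp [LState.arrive, LState.setReg, LState.receive, LState.sendOthers]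
    · simp [LState.arrive, LState.setReg, LState.receive, LState.sendOthers]
    · simp [LState.arrive, LState.setReg, LState.sendOthers, hs.symm]
    · intro q hq hqp; simp [LState.arrive, LState.setReg, LState.receive, LState.sendOthers, hq, hqp]
    · rw [lastTs_snoc]
      have : σ.reg (.T p) < e.ts := by simpa [LState.arrive, LState.setReg, LState.receive, hs] using hlt
      exact this.le
    · rw [lastTs_snoc]; exact le_rfl
    · intro q; simp [LState.arrive, LState.setReg, LState.receive, LState.sendOthers]
    · simp [arrivals_append]
  | @dequeuePQ σ B l e e' s h h₁ h₂ h₃ h₄ ih =>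
    have := ih hr hg hn
    refine ⟨fun s => (upd_of_ne (by simp)).trans (this.ts s), this.enq,
      fun x hx => (this.own x hx).trans_eq (upd_of_ne (by simp)).symm, this.queues.dequeuePQ h₁ h₂ h₃ h₄, ?_, ?_⟩
    · intro x hx
      rcases List.mem_append.1 hx with hx | hx
      · exact List.mem_append_left _ (this.logDlv x hx)
      · exact List.mem_append_right _ (by simpa using hx)
    · refine List.pairwise_append.2 ⟨this.log, by simp, ?_⟩
      rintro a _ b hb x u l _ _ rfl
      simp at hb
  | @dequeueFifo σ B q e s h h₁ h₂ ih =>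
    have := ih hr hg hn
    refine ⟨fun s => (upd_of_ne (by simp)).trans (this.ts s), this.enq,
      fun x hx => (this.own x hx).trans_eq (upd_of_ne (by simp)).symm, this.queues.dequeueFifo h₁ h₂, ?_, ?_⟩
    · intro x hx
      rcases List.mem_append.1 hx with hx | hx
      · exact List.mem_append_left _ (this.logDlv x hx)
      · exact List.mem_append_right _ (by simpa using hx)
    · refine List.pairwise_append.2 ⟨this.log, by simp, ?_⟩
      rintro a _ b hb x u l _ _ rfl
      simp at hb

end Streams

/-! ## Occurrences in a subsequence -/

section Embedding

theorem forall₂_filterMap {ι β : Type} (g : ι → Option β) (xs : List ι) :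
    List.Forall₂ (fun j b => g j = some b) (xs.filter fun j => (g j).isSome) (xs.filterMap g) := by
  induction xs with
  | nil => exact .nil
  | cons x xs ih =>
    rcases hg : g x with _ | b
    · rw [List.filter_cons_of_neg (by simp [hg]), List.filterMap_cons_none hg]; exact ih
    · rw [List.filter_cons_of_pos (by simp [hg]), List.filterMap_cons_some hg]; exact .cons hg ih

/-- The entries of the filtered list correspond, in increasing order, to the positions at which `f`
is defined. -/
theorem exists_filterMap_embedding {α β : Type} (f : α → Option β) (l : List α) :
    ∃ φ : Fin (l.filterMap f).length → Fin l.length, StrictMono φ ∧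
      (∀ i, f (l.get (φ i)) = some ((l.filterMap f).get i)) ∧
      ∀ j, (f (l.get j)).isSome → ∃ i, φ i = j := by
  have hF := forall₂_filterMap (fun j => f (l.get j)) (List.finRange l.length)
  have hl : (List.finRange l.length).filterMap (fun j => f (l.get j)) = l.filterMap f := by
    conv_rhs => rw [← List.map_get_finRange l, List.filterMap_map]
    rfl
  rw [hl] at hF
  set idx := (List.finRange l.length).filter fun j => (f (l.get j)).isSome with hidx
  have hlen : idx.length = (l.filterMap f).length := hF.length_eq
  refine ⟨fun i => idx.get (i.cast hlen.symm), ?_, fun i => ?_, fun j hj => ?_⟩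
  · have hs : idx.Pairwise (· < ·) := (List.pairwise_lt_finRange _).filter _
    intro i j hij
    exact List.pairwise_iff_get.1 hs _ _ hij
  · exact hF.get _ i.2
  · have : j ∈ idx := by simpa [hidx] using hj
    obtain ⟨i, hi⟩ := List.get_of_mem this
    exact ⟨i.cast hlen, by simpa using hi⟩

variable {Thr Op Op' : Type} {D : MultiComputation Thr Op} {C : MultiComputation Thr Op'}

theorem exists_occ_embedding {f : Op → Option Op'} (h : ∀ t, (D t).filterMap f = C t) :
    ∃ φ : Occ C → Occ D, Function.Injective φ ∧ (∀ x, (φ x).1 = x.1) ∧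
      (∀ x, f (φ x).op = some x.op) ∧ (∀ x y, ProgOrder C x y → ProgOrder D (φ x) (φ y)) ∧
      ∀ y, (f y.op).isSome → ∃ x, φ x = y := by
  obtain rfl : (fun t => (D t).filterMap f) = C := funext h
  choose φ h₁ h₂ h₃ using fun t => exists_filterMap_embedding f (D t)
  refine ⟨fun x => ⟨x.1, φ x.1 x.2⟩, ?_, fun _ => rfl, fun x => h₂ _ _, ?_, ?_⟩
  · rintro ⟨t, i⟩ ⟨t', j⟩ hij
    simp only [Sigma.mk.injEq] at hij
    obtain ⟨rfl, hij⟩ := hij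
    rw [(h₁ t).injective (eq_of_heq hij)]
  · rintro ⟨t, i⟩ ⟨t', j⟩ ⟨ht, hij⟩
    change t = t' at ht
    subst ht
    exact ⟨rfl, h₁ t hij⟩
  · rintro ⟨t, j⟩ hj
    obtain ⟨i, hi⟩ := h₃ t j hj
    exact ⟨⟨t, i⟩, congrArg (Sigma.mk t) hi⟩

end Embedding

/-! ### Comparison of sequences through their orders -/

section BeforeLemmas

variable {α β : Type} {l l' : List α} {a b c : α}

theorem Before.map {f : α → β} (h : Before l a b) : Before (l.map f) (f a) (f b) :=
  List.Sublist.map f h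

theorem Before.of_map {f : α → β} {x y : β} (h : Before (l.map f) x y) :
    ∃ a b, Before l a b ∧ f a = x ∧ f b = y := by
  rw [← List.filterMap_eq_map] at h
  obtain ⟨a, b, hab, ha, hb⟩ := h.of_filterMap
  exact ⟨a, b, hab, by simpa using ha, by simpa using hb⟩

/-- The order of a duplicate-free list is total on its members, so a total order that contains it
has no freedom left. -/
theorem eq_of_before (hl : l.Nodup) (hl' : l'.Nodup) (hm : ∀ a, a ∈ l ↔ a ∈ l')
    (hb : ∀ a b, Before l' a b → Before l a b) : l = l' := by
  refine List.Perm.eq_of_pairwise (le := Before l) (fun a b _ _ h₁ h₂ => absurd h₂ (h₁.asymm hl))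
    (List.pairwise_iff_forall_sublist.2 fun h => h)
    (List.pairwise_iff_forall_sublist.2 fun h => hb _ _ h) ((List.perm_ext_iff_of_nodup hl hl').2 hm)

end BeforeLemmas

/-! ## Total orders of a computation -/

section TotalOrder

variable {Proc Thr Op : Type} {owner : Thr → Proc} {D : MultiComputation Thr Op}
  {seq : List (Occ D)} {p : Proc}

theorem mem_map_op (h : IsTotalOrderOf seq (opsOf owner D p)) {o : Op} :
    o ∈ seq.map Occ.op ↔ ∃ x : Occ D, owner x.1 = p ∧ x.op = o := by
  rw [List.mem_map]
  exact exists_congr fun x => and_congr_left' (h.2 x)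

/-- Program order is already total on one thread, so no extension of it can reverse two operations
of that thread. -/
theorem progOrder_of_before (h : IsTotalOrderOf seq (opsOf owner D p))
    (hext : Extends (opsOf owner D p) (Before seq) (ProgOrder D)) {x y : Occ D}
    (hxy : Before seq x y) (ht : x.1 = y.1) : ProgOrder D x y := by
  obtain ⟨t, i⟩ := x
  obtain ⟨t', j⟩ := y
  change t = t' at ht
  subst ht
  refine ⟨rfl, ?_⟩
  rcases lt_trichotomy i.val j.val with hij | hij | hij
  · exact hij
  · rw [Fin.ext hij] at hxy
    exact absurd rfl (hxy.ne h.1)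
  · exact absurd (hext _ ((h.2 _).1 hxy.mem_right) _ ((h.2 _).1 hxy.mem_left) ⟨rfl, hij⟩)
      (hxy.asymm h.1)

/-- If only one thread of the process performs operations visible to `f`, the interleaving with
other threads is invisible to `f`. This replaces the concurrent execution by a sequential one. -/
theorem filterMap_op_eq {β : Type} (h : IsTotalOrderOf seq (opsOf owner D p))
    (hext : Extends (opsOf owner D p) (Before seq) (ProgOrder D)) {t : Thr} (ht : owner t = p)
    {f : Op → Option β} (hf : ∀ x : Occ D, owner x.1 = p → x.1 ≠ t → f x.op = none) :
    (seq.map Occ.op).filterMap f = (D t).filterMap f := by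
  classical
  have key : seq.filter (fun x => decide (x.1 = t)) =
      (List.finRange (D t).length).map fun i => (⟨t, i⟩ : Occ D) := by
    have hn : (seq.filter (fun x => decide (x.1 = t))).Nodup := h.1.filter _
    have hinj : Function.Injective fun i : Fin (D t).length => (⟨t, i⟩ : Occ D) :=
      fun i j hij => by simpa using hij
    refine List.Perm.eq_of_pairwise (le := fun x y => x.2.val < y.2.val)
      (fun a b _ _ h₁ h₂ => absurd h₂ (lt_asymm h₁)) ?_ ?_
      ((List.perm_ext_iff_of_nodup hn ((List.nodup_finRange _).map hinj)).2 ?_)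
    · refine List.pairwise_iff_forall_sublist.2 fun {x y} hxy => ?_
      have hx : x.1 = t := by simpa using (List.mem_filter.1 (Before.mem_left hxy)).2
      have hy : y.1 = t := by simpa using (List.mem_filter.1 (Before.mem_right hxy)).2
      exact (progOrder_of_before h hext (hxy.trans List.filter_sublist) (hx.trans hy.symm)).2
    · exact List.pairwise_map.2 (List.pairwise_lt_finRange _)
    · rintro ⟨t', i⟩
      simp only [List.mem_filter, decide_eq_true_eq, List.mem_map, List.mem_finRange, true_and]
      constructor
      · rintro ⟨_, rfl⟩; exact ⟨i, rfl⟩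
      · rintro ⟨j, hj⟩
        have hj' := (congrArg Sigma.fst hj).symm
        exact ⟨(h.2 _).2 ((congrArg owner hj').trans ht), hj'⟩
  have h₁ : (seq.map Occ.op).filterMap f =
      ((seq.filter fun x => decide (x.1 = t)).map Occ.op).filterMap f := by
    rw [List.filterMap_map, List.filterMap_map, List.filterMap_filter]
    refine List.filterMap_congr fun x hx => ?_
    by_cases hxt : x.1 = t
    · simp [hxt]
    · simpa [hxt] using hf x ((h.2 x).1 hx) hxt
  rw [h₁, key, List.map_map]
  congr 1
  exact List.map_get_finRange (D t)

end TotalOrder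

/-! ## Computations of the transformed multiprogram on the network -/

section Network

variable {Proc Thr V Val U L : Type} [LinearOrder Proc]

/-- A computation of the transformed multiprogram, and orders that witness the network model. -/
structure NetworkRun (P : Multiprogram Proc Thr V Val U L)
    (D : MultiComputation Thr (TargetOp Proc V Val U L)) (C : MultiComputation Thr (SpecOp V Val U L))
    (waiting : Thr → Bool) (seq : Proc → List (Occ D)) : Prop where
  single : ∀ t₁ t₂, P.owner t₁ = P.owner t₂ → P.CallsDeliver t₁ → P.CallsDeliver t₂ → t₁ = t₂
  run : IsTimestampComputation P D C waiting
  total : ∀ p, IsTotalOrderOf (seq p) (opsOf P.owner D p)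
  valid : ∀ p, TargetValid (P.init p) ((seq p).map Occ.op)
  ext : ∀ p, Extends (opsOf P.owner D p) (Before (seq p)) (HappensBefore P.owner D)
  recv_iff_send : ∀ s d m, (∃ o : Occ D, o.op = .recv s d m) ↔ (∃ o : Occ D, o.op = .send s d m)

/-! ### From network orders to local runs -/

namespace NetworkRun

variable {P : Multiprogram Proc Thr V Val U L} {D : MultiComputation Thr (TargetOp Proc V Val U L)}
  {C : MultiComputation Thr (SpecOp V Val U L)} {waiting : Thr → Bool} {seq : Proc → List (Occ D)}

theorem threadOp (N : NetworkRun P D C waiting seq) (x : Occ D) : ThreadOp (P.owner x.1) x.op :=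
  (N.run x.1).threadOp _ (List.get_mem _ _)

theorem callsDeliver (N : NetworkRun P D C waiting seq) {x : Occ D}
    (h : ¬ PlainOp (P.owner x.1) x.op) : P.CallsDeliver x.1 := by
  by_contra hc
  exact h (((N.run x.1).plain hc).2 _ (List.get_mem _ _))

theorem ext_prog (N : NetworkRun P D C waiting seq) (p : Proc) : Extends (opsOf P.owner D p)
    (Before (seq p)) (ProgOrder D) :=
  fun a ha b hb h => N.ext p a ha b hb (.single (.inl h))

theorem source_of_send (N : NetworkRun P D C waiting seq) {x : Occ D} {s d : Proc}
    {m : Msg Proc U L} (h : x.op = .send s d m) :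
    P.owner x.1 = s ∧ MsgFrom s d m := by
  have := N.threadOp x
  rw [h] at this
  obtain ⟨h₁, h₂⟩ := this
  rw [← h₁] at h₂
  exact ⟨h₁.symm, h₂⟩

theorem dest_of_recv (N : NetworkRun P D C waiting seq) {x : Occ D} {s d : Proc} {m : Msg Proc U L}
    (h : x.op = .recv s d m) :
    P.owner x.1 = d := by
  have := N.threadOp x
  rw [h] at this
  exact this.symm

/-- The local run of a process. -/
theorem exists_local (N : NetworkRun P D C waiting seq) (p : Proc) : ∃ (σ : LState Proc U L)
    (B : List (Msg Proc U L)), Reach p σ B ∧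
    σ.rcv = ((seq p).map Occ.op).filterMap TargetOp.recvFrom? ∧
    (∀ d, d ≠ p → σ.snd d = ((seq p).map Occ.op).filterMap (TargetOp.sendTo? d)) ∧
    σ.dlv = ((seq p).map Occ.op).filterMap TargetOp.deq? ∧
    σ.log = ((seq p).map Occ.op).filterMap TargetOp.log? ∧
    ∀ t, P.owner t = p → waiting t = true →
      (∀ l, σ.PQBlocked l) ∧ ∀ q, σ.FifoBlocked q := by
  by_cases ht : ∃ t, P.owner t = p ∧ P.CallsDeliver t
  · obtain ⟨t, rfl, htd⟩ := ht
    -- An operation that is not plain shows that its thread calls `deliver`, hence that it is `t`.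
    -- The other threads perform only plain operations, to which `f` is blind.
    have proj : ∀ {β : Type} {f : TargetOp Proc V Val U L → Option β},
        (∀ o, PlainOp (P.owner t) o → f o = none) →
        ((seq (P.owner t)).map Occ.op).filterMap f = (D t).filterMap f := by
      intro β f hf
      refine filterMap_op_eq (N.total _) (N.ext_prog _) rfl fun x hx hxt => hf _ ?_
      by_contra hpl
      rw [← hx] at hpl
      exact hxt (N.single _ _ hx (N.callsDeliver hpl) htd)
    obtain ⟨_, h₂, h₃, h₄, _, _⟩ := N.valid (P.owner t)
    rw [proj (by rintro (_ | _ | _ | _ | _ | _) h <;> first | rfl | exact h.elim)] at h₂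
    obtain ⟨σ, hσ⟩ := exists_runs_lstep (w := D t) LState.init h₂.readsFrom
      (fun l => by
        rw [← proj (by rintro (_ | _ | _ | _ | _ | _) h <;> first | rfl | exact h.elim)]; exact h₃ l)
      (fun q => by
        rw [← proj (by rintro (_ | _ | _ | _ | _ | _) h <;> first | rfl | exact h.elim)]; exact h₄ q)
    obtain ⟨⟨B, hB⟩, hw⟩ := (N.run t).reach hσ
    obtain ⟨e₁, e₂, e₃, e₄⟩ := runs_lstep_history hσ
    refine ⟨σ, B, hB, ?_, fun d hd => ?_, ?_, ?_, fun t' ht' hwt => ?_⟩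
    · rw [e₁, proj (by rintro (_ | _ | _ | _ | _ | _) h <;> first | rfl | exact h.elim)]; rfl
    · rw [e₂, proj]
      · rfl
      · rintro (_ | _ | _ | _ | ⟨s, d', m⟩ | _) h
        all_goals try rfl
        cases m
        · exact if_neg fun hdd => hd (hdd.symm.trans h.2)
        all_goals exact h.elim
    · rw [e₃, proj (by rintro (_ | _ | _ | _ | _ | _) h <;> first | rfl | exact h.elim)]; rfl
    · rw [e₄, proj (by rintro (_ | _ | _ | _ | _ | _) h <;> first | rfl | exact h.elim)]; rfl
    · obtain rfl : t' = t := by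
        refine N.single _ _ ht' ?_ htd
        by_contra hc
        rw [((N.run t').plain hc).1] at hwt
        cases hwt
      exact hw hwt
  -- Without a delivering thread all relevant histories are empty, and the initial state serves.
  · have hpl : ∀ o ∈ (seq p).map Occ.op, PlainOp p o := by
      intro o ho
      obtain ⟨x, hx, rfl⟩ := (mem_map_op (N.total p)).1 ho
      by_contra hc
      rw [← hx] at hc
      exact ht ⟨x.1, hx, N.callsDeliver hc⟩
    have proj : ∀ {β : Type} {f : TargetOp Proc V Val U L → Option β},
        (∀ o, PlainOp p o → f o = none) → [] = ((seq p).map Occ.op).filterMap f :=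
      fun hf => (List.filterMap_eq_nil_iff.2 fun o ho => hf o (hpl o ho)).symm
    refine ⟨LState.init, [], .init, proj ?_, fun d hd => proj ?_, proj ?_, proj ?_, fun t htp hw => ?_⟩
    · rintro (_ | _ | _ | _ | _ | _) h <;> first | rfl | exact h.elim
    · rintro (_ | _ | _ | _ | ⟨s, d', m⟩ | _) h
      all_goals try rfl
      cases m
      · exact if_neg fun hdd => hd (hdd.symm.trans h.2)
      all_goals exact h.elim
    · rintro (_ | _ | _ | _ | _ | _) h <;> first | rfl | exact h.elim
    · rintro (_ | _ | _ | _ | _ | _) h <;> first | rfl | exact h.elim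
    · by_cases hc : P.CallsDeliver t
      · exact absurd ⟨t, htp, hc⟩ ht
      · rw [((N.run t).plain hc).1] at hw
        cases hw

theorem mem_recvFrom (N : NetworkRun P D C waiting seq) {p s : Proc} {m : Msg Proc U L} :
    (s, m) ∈ ((seq p).map Occ.op).filterMap TargetOp.recvFrom? ↔
      ∃ x : Occ D, x.op = .recv s p m := by
  rw [List.mem_filterMap]
  constructor
  · rintro ⟨o, ho, hom⟩
    obtain ⟨x, hx, rfl⟩ := (mem_map_op (N.total p)).1 ho
    rcases hxo : x.op with _ | _ | _ | _ | _ | ⟨s', d, m'⟩ <;> rw [hxo] at hom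
    case recv =>
      cases hom
      refine ⟨x, ?_⟩
      rw [hxo, ← hx, N.dest_of_recv hxo]
    case priorityQ l o => cases o <;> cases hom
    case fifoQ l o => cases o <;> cases hom
    all_goals cases hom
  · rintro ⟨x, hx⟩
    exact ⟨_, (mem_map_op (N.total p)).2 ⟨x, N.dest_of_recv hx, rfl⟩, by rw [hx]; rfl⟩

theorem mem_sendTo (N : NetworkRun P D C waiting seq) {p d : Proc} {m : Msg Proc U L} :
    m ∈ ((seq p).map Occ.op).filterMap (TargetOp.sendTo? d) ↔
      ∃ x : Occ D, x.op = .send p d m := by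
  rw [List.mem_filterMap]
  constructor
  · rintro ⟨o, ho, hom⟩
    obtain ⟨x, hx, rfl⟩ := (mem_map_op (N.total p)).1 ho
    rcases hxo : x.op with _ | _ | _ | _ | ⟨s', d', m'⟩ | _ <;> rw [hxo] at hom <;>
      simp only [TargetOp.sendTo?, reduceCtorEq, Option.ite_none_right_eq_some, Option.some.injEq] at hom
    obtain ⟨rfl, rfl⟩ := hom
    exact ⟨x, by rw [hxo, ← hx, (N.source_of_send hxo).1]⟩
  · rintro ⟨x, hx⟩
    exact ⟨_, (mem_map_op (N.total p)).2 ⟨x, (N.source_of_send hx).1, rfl⟩,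
      by rw [hx]; exact if_pos rfl⟩

/-- All receives of a process have that process as destination, so forgetting the destination is
injective on them. -/
theorem nodup_recvFrom (N : NetworkRun P D C waiting seq) (p : Proc) :
    (((seq p).map Occ.op).filterMap TargetOp.recvFrom?).Nodup := by
  have h := (N.valid p).2.2.2.2.2
  have hm : ((seq p).map Occ.op).filterMap TargetOp.recvFrom? =
      (((seq p).map Occ.op).filterMap TargetOp.recv?).map fun x => (x.1, x.2.2) := by
    rw [List.map_filterMap]
    refine List.filterMap_congr fun o _ => ?_
    cases o <;> rfl
  rw [hm]
  refine h.map_on ?_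
  have hd : ∀ x ∈ ((seq p).map Occ.op).filterMap TargetOp.recv?, x.2.1 = p := by
    intro x hx
    obtain ⟨o, ho, hox⟩ := List.mem_filterMap.1 hx
    obtain ⟨y, hy, rfl⟩ := (mem_map_op (N.total p)).1 ho
    rcases hyo : y.op with _ | _ | _ | _ | _ | ⟨s', d, m'⟩ <;> rw [hyo] at hox <;> cases hox
    exact (N.dest_of_recv hyo).symm.trans hy
  rintro ⟨s, d, m⟩ hx ⟨s', d', m'⟩ hy hxy
  have h₁ := hd _ hx
  have h₂ := hd _ hy
  simp only [Prod.mk.injEq] at hxy h₁ h₂ ⊢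
  exact ⟨hxy.1, h₁.trans h₂.symm, hxy.2⟩

/-- Messages sent in program order are received in the same order. -/
theorem before_recv (N : NetworkRun P D C waiting seq) {s p : Proc} {m m' : Msg Proc U L}
    {a b : Occ D} (ha : a.op = .send s p m)
    (hb : b.op = .send s p m') (hab : ProgOrder D a b) :
    Before (((seq p).map Occ.op).filterMap TargetOp.recvFrom?) (s, m) (s, m') := by
  obtain ⟨x, hx⟩ := (N.recv_iff_send _ _ _).2 ⟨a, ha⟩
  obtain ⟨y, hy⟩ := (N.recv_iff_send _ _ _).2 ⟨b, hb⟩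
  have hxy := N.ext p x (N.dest_of_recv hx) y (N.dest_of_recv hy)
    (.single (.inr (.inr (.inl ⟨s, p, m, m', hx, hy, a, b, ha, hb, hab⟩))))
  exact (hxy.map (f := Occ.op)).filterMap (by rw [hx]; rfl) (by rw [hy]; rfl)

theorem rcvOK (N : NetworkRun P D C waiting seq) {p : Proc} {σ : LState Proc U L}
    (hr : σ.rcv = ((seq p).map Occ.op).filterMap TargetOp.recvFrom?) : RcvOK p σ := by
  rintro ⟨s, m⟩ hm
  rw [hr, N.mem_recvFrom] at hm
  obtain ⟨y, hy⟩ := (N.recv_iff_send _ _ _).1 hm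
  exact (N.source_of_send hy).2

end NetworkRun

/-- The final local states of the processes and the sequences of messages they broadcast. -/
structure FinalStates (P : Multiprogram Proc Thr V Val U L)
    (D : MultiComputation Thr (TargetOp Proc V Val U L)) (waiting : Thr → Bool)
    (seq : Proc → List (Occ D)) (σ : Proc → LState Proc U L) (B : Proc → List (Msg Proc U L)) :
    Prop where
  rcv : ∀ p, (σ p).rcv = ((seq p).map Occ.op).filterMap TargetOp.recvFrom?
  dlv : ∀ p, (σ p).dlv = ((seq p).map Occ.op).filterMap TargetOp.deq?
  log : ∀ p, (σ p).log = ((seq p).map Occ.op).filterMap TargetOp.log?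
  blocked : ∀ t, waiting t = true →
    (∀ l, (σ (P.owner t)).PQBlocked l) ∧ ∀ q, (σ (P.owner t)).FifoBlocked q
  sendInv : ∀ p, SendInv p (σ p) (B p)
  deliverInv : ∀ p, DeliverInv p (σ p) (B p)
  stream : ∀ p s, stream p (σ p) (B p) s = B s

/-- Sent and received streams are duplicate-free lists with the same members, as messages arrive
exactly when they are sent, and with the same order, as channels are fifo; so they are equal. Thus
the senders' invariants become the hypotheses of `Reach.deliverInv`. -/
theorem NetworkRun.exists_finalStates {P : Multiprogram Proc Thr V Val U L}
    {D : MultiComputation Thr (TargetOp Proc V Val U L)} {C : MultiComputation Thr (SpecOp V Val U L)}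
    {waiting : Thr → Bool} {seq : Proc → List (Occ D)} (N : NetworkRun P D C waiting seq) :
    ∃ σ B, FinalStates P D waiting seq σ B := by
  choose σ B hR hrcv hsnd hdlv hlog hw using N.exists_local
  have hS : ∀ p, SendInv p (σ p) (B p) := fun p => (hR p).sendInv (N.rcvOK (hrcv p))
  have hst : ∀ p s, s ≠ p → rcvFrom s (σ p).rcv = B s := by
    intro p s hsp
    have hB : B s = ((seq s).map Occ.op).filterMap (TargetOp.sendTo? p) :=
      ((hS s).snd p hsp.symm).symm.trans (hsnd s p hsp.symm)
    have hbef : ∀ m m', Before (B s) m m' → Before (rcvFrom s (σ p).rcv) m m' := by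
      intro m m' hm
      rw [hB] at hm
      obtain ⟨o, o', hoo, ho, ho'⟩ := hm.of_filterMap
      obtain ⟨x, y, hxy, rfl, rfl⟩ := hoo.of_map
      have hsend : ∀ {x : Occ D} {m : Msg Proc U L}, x ∈ seq s →
          TargetOp.sendTo? p x.op = some m → x.op = .send s p m := by
        intro x m hx hxm
        rcases hxo : x.op with _ | _ | _ | _ | ⟨s', d', m'⟩ | _ <;> rw [hxo] at hxm <;>
          simp only [TargetOp.sendTo?, reduceCtorEq, Option.ite_none_right_eq_some,
            Option.some.injEq] at hxm
        obtain ⟨rfl, rfl⟩ := hxm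
        rw [← (N.source_of_send hxo).1, show P.owner x.1 = s from ((N.total s).2 x).1 hx]
      have hx := hsend hxy.mem_left ho
      have hy := hsend hxy.mem_right ho'
      have hcd : ∀ {x : Occ D} {m : Msg Proc U L}, x.op = .send s p m → P.CallsDeliver x.1 := by
        intro x m hx
        refine N.callsDeliver fun hpl => ?_
        rw [hx] at hpl
        cases m
        · exact hsp (hpl.1.trans hpl.2.symm)
        all_goals exact hpl.elim
      -- Fifo channels respect only program order. A send to another process is not plain, so both
      -- sends belong to the one delivering thread and are ordered by its program.
      have ht : x.1 = y.1 := N.single _ _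
        ((N.source_of_send hx).1.trans (N.source_of_send hy).1.symm) (hcd hx) (hcd hy)
      have hb := N.before_recv hx hy (progOrder_of_before (N.total s) (N.ext_prog s) hxy ht)
      rw [← hrcv] at hb
      exact hb.filterMap (by simp) (by simp)
    refine eq_of_before ?_ ?_ (fun m => ?_) hbef
    · refine List.Nodup.filterMap ?_ (by rw [hrcv]; exact N.nodup_recvFrom p)
      rintro ⟨s₁, m₁⟩ ⟨s₂, m₂⟩ m h₁ h₂
      simp only [Option.mem_def, Option.ite_none_right_eq_some, Option.some.injEq] at h₁ h₂
      rw [Prod.mk.injEq]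
      exact ⟨h₁.1.trans h₂.1.symm, h₁.2.trans h₂.2.symm⟩
    -- The sent stream has no duplicates because its timestamps are strictly increasing.
    · have := (List.pairwise_cons.1 (hS s).good.inc).2
      rw [List.pairwise_map] at this
      exact this.imp fun h e => by subst e; exact lt_irrefl _ h
    · rw [mem_rcvFrom, hrcv, N.mem_recvFrom, N.recv_iff_send, hB, N.mem_sendTo]
  have hD : ∀ p, DeliverInv p (σ p) (B p) := fun p => (hR p).deliverInv (N.rcvOK (hrcv p))
    (fun s hs => by rw [hst p s hs]; exact (hS s).good) (by rw [hrcv]; exact N.nodup_recvFrom p)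
  refine ⟨σ, B, hrcv, hdlv, hlog, fun t => hw _ t rfl, hS, hD, fun p s => ?_⟩
  by_cases hs : s = p
  · subst hs; exact stream_self
  · rw [stream_of_ne hs, hst p s hs]

end Network

/-! ## Partial-order broadcast -/

section Broadcast

theorem Before.trans {α : Type} {l : List α} {a b c : α} (hl : l.Nodup) (h : Before l a b)
    (h' : Before l b c) : Before l a c := by
  induction l with
  | nil => simp [Before] at h
  | cons d l ih =>
    rw [List.nodup_cons] at hl
    simp only [Before] at h h' ⊢
    rw [List.cons_sublist_cons'] at h h'
    rcases h with h | ⟨rfl, h⟩ <;> rcases h' with h' | ⟨rfl, h'⟩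
    · exact List.Sublist.trans (ih hl.2 h h') (List.sublist_cons_self _ _)
    · exact absurd (Before.mem_right h) hl.1
    · exact List.cons_sublist_cons.2 (List.singleton_sublist.2 (Before.mem_right h'))
    · exact absurd (List.singleton_sublist.1 h) hl.1

variable {Proc Thr V Val U L : Type}

theorem TargetOp.eq_of_spec_bcast {o : TargetOp Proc V Val U L} {u : U} {l : Option L}
    (h : o.spec? = some (.bcast u l)) : ∃ s d, o = .send s d (.localBroadcastRequest u l) := by
  rcases o with _ | _ | ⟨_, _ | _ | _ | _⟩ | ⟨_, _ | _ | _ | _⟩ | ⟨s, d, _ | _ | _⟩ | _ <;> cases h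
  exact ⟨s, d, rfl⟩

theorem TargetOp.spec_bind_deliver (o : TargetOp Proc V Val U L) :
    o.spec?.bind SpecOp.deliver? = o.deq?.map labeledUpdate := by
  rcases o with _ | _ | ⟨_, _ | _ | _ | _⟩ | ⟨_, _ | _ | _ | _⟩ | ⟨s, d, _ | _ | _⟩ | _ <;> rfl

theorem TargetOp.spec_bind_var (o : TargetOp Proc V Val U L) :
    o.spec?.bind SpecOp.var? = o.var? := by
  rcases o with _ | _ | ⟨_, _ | _ | _ | _⟩ | ⟨_, _ | _ | _ | _⟩ | ⟨s, d, _ | _ | _⟩ | _ <;> rfl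

theorem SpecOp.deliver_eq_some {o : SpecOp V Val U L} {a : U × Option L} :
    o.deliver? = some a ↔ o = .deliver a.1 a.2 := by
  cases o <;> simp [SpecOp.deliver?, Prod.ext_iff]

theorem TargetOp.log_of_deq {o : TargetOp Proc V Val U L} {x : Entry Proc U L}
    (h : o.deq? = some x) : o.log? = some (.inr x) := by
  rcases o with _ | _ | ⟨_, _ | _ | _ | _⟩ | ⟨_, _ | _ | _ | _⟩ | _ | _ <;> cases h <;> rfl

theorem Before.fromSrc {E : List (Entry Proc U L)} {x y : Entry Proc U L} (h : Before E x y)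
    (hs : x.2.src = y.2.src) : Before (fromSrc y.2.src E) x y := by
  classical
  have := List.Sublist.filter (fun x => decide (x.2.src = y.2.src)) h
  simpa [hs, TimestampBroadcast.fromSrc, Before] using this

variable {D : MultiComputation Thr (TargetOp Proc V Val U L)}
  {C : MultiComputation Thr (SpecOp V Val U L)}

/-- The occurrences in a computation of the transformed multiprogram that represent the operations
of its interpretation. -/
structure Represents (D : MultiComputation Thr (TargetOp Proc V Val U L))
    (C : MultiComputation Thr (SpecOp V Val U L)) (φ : Occ C → Occ D) : Prop where
  inj : Function.Injective φ
  thread : ∀ x, (φ x).1 = x.1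
  op : ∀ x, (φ x).op.spec? = some x.op
  prog : ∀ x y, ProgOrder C x y → ProgOrder D (φ x) (φ y)
  surj : ∀ y, y.op.spec?.isSome → ∃ x, φ x = y

/-- The order of the operations of the interpretation given by an order of the target operations. -/
noncomputable def specSeq (φ : Occ C → Occ D) (l : List (Occ D)) : List (Occ C) :=
  l.filterMap (Function.partialInv φ)

theorem Represents.partialInv {φ : Occ C → Occ D} (R : Represents D C φ) {x : Occ C} {y : Occ D} :
    Function.partialInv φ y = some x ↔ φ x = y :=
  R.inj.isPartialInv x y

theorem Represents.map_op {φ : Occ C → Occ D} (R : Represents D C φ) (l : List (Occ D)) :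
    (specSeq φ l).map Occ.op = (l.map Occ.op).filterMap TargetOp.spec? := by
  rw [specSeq, List.map_filterMap, List.filterMap_map]
  refine List.filterMap_congr fun y _ => ?_
  change _ = y.op.spec?
  rcases hy : y.op.spec? with _ | o
  · rw [Option.map_eq_none_iff]
    by_contra hne
    obtain ⟨x, hx⟩ := Option.ne_none_iff_exists'.1 hne
    rw [← R.partialInv.1 hx, R.op] at hy
    cases hy
  · obtain ⟨x, rfl⟩ := R.surj y (by simp [hy])
    rw [R.partialInv.2 rfl, ← hy, R.op]; rfl

theorem Represents.before {φ : Occ C → Occ D} (R : Represents D C φ) {l : List (Occ D)}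
    {x y : Occ C} (h : Before l (φ x) (φ y)) :
    Before (specSeq φ l) x y := h.filterMap (R.partialInv.2 rfl) (R.partialInv.2 rfl)

theorem Represents.varOps {φ : Occ C → Occ D} (R : Represents D C φ) (l : List (Occ D)) :
    ((specSeq φ l).map Occ.op).filterMap SpecOp.var? =
      (l.map Occ.op).filterMap TargetOp.var? := by
  rw [R.map_op, List.filterMap_filterMap]
  exact List.filterMap_congr fun o _ => o.spec_bind_var

variable [LinearOrder Proc]

/-- The delivered counters of one source are 1, 2, ... in this order. -/
theorem QInv.counter_lt {σ : LState Proc U L} (h : QInv σ) {x y : Entry Proc U L}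
    (hxy : Before σ.dlv x y) (hs : x.2.src = y.2.src) : x.2.counter < y.2.counter := by
  have h₂ := (hxy.fromSrc hs).map (f := fun x => x.2.counter)
  rw [h.counters] at h₂
  exact List.pairwise_iff_forall_sublist.1 List.pairwise_lt_range' h₂

theorem QInv.nodup_dlv {σ : LState Proc U L} (h : QInv σ) : σ.dlv.Nodup :=
  List.pairwise_iff_forall_sublist.2 fun hxy e => by
    subst e; exact lt_irrefl _ (h.counter_lt hxy rfl)

variable {P : Multiprogram Proc Thr V Val U L} {waiting : Thr → Bool} {seq : Proc → List (Occ D)}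
  {σ : Proc → LState Proc U L} {B : Proc → List (Msg Proc U L)}

/-! ### Consequences of equal message streams -/

namespace FinalStates

/-- The right-hand side does not depend on p: in the end all processes have enqueued the same
elements. -/
theorem fromSrc_enq (F : FinalStates P D waiting seq σ B) (p s : Proc) :
    fromSrc s (σ p).enq = arrivals s (B s) := by
  rw [(F.deliverInv p).enq, F.stream]

theorem mem_enq_iff (F : FinalStates P D waiting seq σ B) {p : Proc} {x : Entry Proc U L} :
    x ∈ (σ p).enq ↔ x ∈ arrivals x.2.src (B x.2.src) := by
  rw [← F.fromSrc_enq p, mem_fromSrc]; simp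

theorem mem_enq_of_mem_arrivals (F : FinalStates P D waiting seq σ B) {p s : Proc}
    {x : Entry Proc U L} (hx : x ∈ arrivals s (B s)) : x ∈ (σ p).enq := by
  rw [← F.fromSrc_enq p, mem_fromSrc] at hx; exact hx.1

theorem dlv_of_blocked (F : FinalStates P D waiting seq σ B) {t : Thr} (ht : waiting t = true) :
    ∀ x ∈ (σ (P.owner t)).enq, x ∈ (σ (P.owner t)).dlv := by
  obtain ⟨h₁, h₂⟩ := F.blocked t ht
  refine (F.deliverInv _).queues.delivered_of_blocked (fun x hx q => ?_) (fun q e he => ?_)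
    (fun x hx => ?_) (fun x hx c h₀ hc => ?_) h₁ h₂
  -- The process q has enqueued the same element and raised its own T[q] at least to its timestamp;
  -- both processes hold the last timestamp of the stream of q.
  · have := (F.deliverInv q).own x (F.mem_enq_iff.2 (F.mem_enq_iff.1 hx))
    rwa [(F.deliverInv q).ts, F.stream, ← F.stream (P.owner t), ← (F.deliverInv _).ts] at this
  · have := F.mem_enq_iff.1 he
    obtain ⟨l, _, hl⟩ := mem_arrivals.1 this
    cases l with
    | none => exact (Sum.inr.inj hl).symm
    | some l => cases hl
  · exact ((F.sendInv _).good.counter_mem (F.mem_enq_iff.1 hx)).1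
  · have hx' := F.mem_enq_iff.1 hx
    obtain ⟨y, hy, hyc⟩ := (F.sendInv _).good.exists_counter h₀
      (hc.trans ((F.sendInv _).good.counter_mem hx').2)
    exact ⟨y, F.mem_enq_of_mem_arrivals hy, (F.sendInv _).good.src y hy, hyc⟩

/-- Elements of one source correspond to the requests it has received, and each message is received
at most once. -/
theorem nodup_labeledUpdate (N : NetworkRun P D C waiting seq) (F : FinalStates P D waiting seq σ B)
    (s : Proc) : ((arrivals s (B s)).map labeledUpdate).Nodup := by
  rw [(F.sendInv s).requests]
  refine List.Nodup.filterMap ?_ (List.Nodup.filterMap ?_ (by rw [F.rcv]; exact N.nodup_recvFrom s))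
  · rintro (⟨u, l⟩ | _ | _) (⟨u', l'⟩ | _ | _) a h h' <;> cases h <;> cases h'
    rfl
  · rintro ⟨s₁, m₁⟩ ⟨s₂, m₂⟩ m h₁ h₂
    simp only [Option.mem_def, Option.ite_none_right_eq_some, Option.some.injEq] at h₁ h₂
    rw [Prod.mk.injEq]
    exact ⟨h₁.1.trans h₂.1.symm, h₁.2.trans h₂.2.symm⟩

theorem mem_requests (N : NetworkRun P D C waiting seq) (F : FinalStates P D waiting seq σ B)
    {s : Proc} {u : U} {l : Option L} : (u, l) ∈ (arrivals s (B s)).map labeledUpdate ↔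
      ∃ y : Occ D, y.op = .send s s (.localBroadcastRequest u l) := by
  rw [(F.sendInv s).requests, List.mem_filterMap, ← N.recv_iff_send, ← N.mem_recvFrom, ← F.rcv,
    ← mem_rcvFrom]
  constructor
  · rintro ⟨⟨u', l'⟩ | _ | _, hm, h⟩ <;> cases h
    exact hm
  · intro h; exact ⟨_, h, rfl⟩

end FinalStates

/-! ### Reading the local runs as broadcast operations -/

namespace Represents

variable {φ : Occ C → Occ D}

theorem total (R : Represents D C φ) (N : NetworkRun P D C waiting seq) (p : Proc) :
    IsTotalOrderOf (specSeq φ (seq p)) (opsOf P.owner C p) := by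
  constructor
  · refine List.Nodup.filterMap (fun a b x ha hb => ?_) (N.total p).1
    exact (R.partialInv.1 ha).symm.trans (R.partialInv.1 hb)
  · intro x
    rw [specSeq, List.mem_filterMap]
    constructor
    · rintro ⟨y, hy, hyx⟩
      have h := ((N.total p).2 y).1 hy
      rw [← R.partialInv.1 hyx] at h
      exact (congrArg P.owner (R.thread x)).symm.trans h
    · intro hx
      exact ⟨φ x, ((N.total p).2 _).2 ((congrArg P.owner (R.thread x)).trans hx), R.partialInv.2 rfl⟩

theorem deliveries (R : Represents D C φ) (F : FinalStates P D waiting seq σ B) (p : Proc) :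
    ((specSeq φ (seq p)).map Occ.op).filterMap SpecOp.deliver? = (σ p).dlv.map labeledUpdate := by
  rw [R.map_op, List.filterMap_filterMap, F.dlv, List.map_filterMap]
  exact List.filterMap_congr fun o _ => o.spec_bind_deliver

theorem send_of_bcast (R : Represents D C φ) (N : NetworkRun P D C waiting seq) {x : Occ C} {u : U}
    {l : Option L} (hx : x.op = .bcast u l) : (φ x).op =
      .send (P.owner x.1) (P.owner x.1) (.localBroadcastRequest u l) := by
  obtain ⟨s, d, h⟩ := TargetOp.eq_of_spec_bcast ((R.op x).trans (congrArg some hx))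
  obtain ⟨h₁, h₂⟩ := N.source_of_send h
  rw [R.thread] at h₁
  obtain rfl : d = s := h₂
  rw [h, h₁]

theorem bcast_iff (R : Represents D C φ) (N : NetworkRun P D C waiting seq)
    (F : FinalStates P D waiting seq σ B) {s : Proc} {u : U} {l : Option L} :
    (u, l) ∈ (arrivals s (B s)).map labeledUpdate ↔
      ∃ x : Occ C, P.owner x.1 = s ∧ x.op = .bcast u l := by
  rw [F.mem_requests N]
  constructor
  · rintro ⟨y, hy⟩
    obtain ⟨x, rfl⟩ := R.surj y (by rw [hy]; rfl)
    have h := R.op x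
    rw [hy] at h
    refine ⟨x, ?_, (Option.some.inj h).symm⟩
    rw [← R.thread]; exact (N.source_of_send hy).1
  · rintro ⟨x, rfl, hx⟩
    exact ⟨φ x, R.send_of_bcast N hx⟩

/-- Uniqueness of broadcasts forces the two elements to have the same source; within one source,
labeled updates do not repeat. -/
theorem labeledUpdate_inj (R : Represents D C φ) (N : NetworkRun P D C waiting seq)
    (F : FinalStates P D waiting seq σ B) (hU : UniqueUpdates C) {p : Proc} {x y : Entry Proc U L}
    (hx : x ∈ (σ p).enq) (hy : y ∈ (σ p).enq) (h : labeledUpdate x = labeledUpdate y) : x = y := by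
  rw [F.mem_enq_iff] at hx hy
  obtain ⟨a, ha, hau⟩ := (R.bcast_iff N F (u := x.2.update) (l := queueLabel x.1)).1
    (List.mem_map.2 ⟨x, hx, rfl⟩)
  obtain ⟨b, hb, hbu⟩ := (R.bcast_iff N F (u := x.2.update) (l := queueLabel x.1)).1
    (List.mem_map.2 ⟨y, hy, h.symm⟩)
  have hs : x.2.src = y.2.src := by rw [← ha, ← hb, hU _ _ _ _ hau hbu]
  rw [hs] at hx
  exact List.inj_on_of_nodup_map (F.nodup_labeledUpdate N _) hx hy h

theorem deliver_iff (R : Represents D C φ) (N : NetworkRun P D C waiting seq)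
    (F : FinalStates P D waiting seq σ B) {p : Proc} {u : U} {l : Option L} :
    (∃ o ∈ opsOf P.owner C p, o.op = .deliver u l) ↔ (u, l) ∈ (σ p).dlv.map labeledUpdate := by
  rw [← R.deliveries F, List.mem_filterMap]
  constructor
  · rintro ⟨o, ho, hou⟩
    exact ⟨_, (mem_map_op (R.total N p)).2 ⟨o, ho, rfl⟩, SpecOp.deliver_eq_some.2 hou⟩
  · rintro ⟨o, ho, hou⟩
    obtain ⟨x, hx, rfl⟩ := (mem_map_op (R.total N p)).1 ho
    exact ⟨x, hx, SpecOp.deliver_eq_some.1 hou⟩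

/-- Delivered elements form a duplicate-free sublist of the enqueued ones up to order. There are at
least as many of them as broadcasts, and at most as many enqueued elements as broadcasts; so both
lists have the same members. -/
theorem dlv_of_count [Finite Thr] (R : Represents D C φ) (N : NetworkRun P D C waiting seq)
    (F : FinalStates P D waiting seq σ B) (hU : UniqueUpdates C) {p : Proc}
    (h : (bcasts C).ncard ≤ (delivers C ∩ opsOf P.owner C p).ncard) :
    ∀ x ∈ (σ p).enq, x ∈ (σ p).dlv := by
  classical
  have hq := (F.deliverInv p).queues
  have h₁ : (delivers C ∩ opsOf P.owner C p).ncard ≤ (σ p).dlv.length := by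
    have hsub : delivers C ∩ opsOf P.owner C p ⊆
        (((specSeq φ (seq p)).filter fun x => x.op.deliver?.isSome).toFinset : Set (Occ C)) := by
      rintro x ⟨⟨u, l, hx⟩, hxp⟩
      simp [((R.total N p).2 x).2 hxp, hx, SpecOp.deliver?]
    refine (Set.ncard_le_ncard hsub (Finset.finite_toSet _)).trans ?_
    rw [Set.ncard_coe_finset]
    refine (List.toFinset_card_le _).trans_eq ?_
    rw [← List.length_map (as := (σ p).dlv) labeledUpdate, ← R.deliveries F, List.filterMap_map,
      List.length_filterMap_eq_countP, List.countP_eq_length_filter]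
    rfl
  have h₂ : (σ p).enq.length ≤ (bcasts C).ncard := by
    have hn : ((σ p).enq.map labeledUpdate).Nodup :=
      hq.streamed.nodup.map_on fun x hx y hy => R.labeledUpdate_inj N F hU hx hy
    -- `none` is a dummy value for operations that are not broadcasts; images are only taken over
    -- broadcasts.
    let f : Occ C → Option (U × Option L) := fun x => match x.op with
      | .bcast u l => some (u, l)
      | _ => none
    have hsub : ((((σ p).enq.map labeledUpdate).map some).toFinset : Set (Option (U × Option L))) ⊆
        f '' bcasts C := by
      intro a ha
      simp only [List.map_map, List.coe_toFinset, List.mem_map, Set.mem_ofPred_eq, Function.comp] at ha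
      obtain ⟨x, hx, rfl⟩ := ha
      obtain ⟨b, _, hb⟩ := (R.bcast_iff N F (u := x.2.update) (l := queueLabel x.1)).1
        (List.mem_map.2 ⟨x, F.mem_enq_iff.1 hx, rfl⟩)
      exact ⟨b, ⟨_, _, hb⟩, by simp only [f, hb]; rfl⟩
    have hc := (Set.ncard_le_ncard hsub (Set.toFinite _)).trans (Set.ncard_image_le (Set.toFinite _))
    rw [Set.ncard_coe_finset, List.toFinset_card_of_nodup (hn.map (Option.some_injective _))] at hc
    simpa using hc
  have hsub : (σ p).dlv ⊆ (σ p).enq := fun x hx => hq.mem_enq_of_mem_dlv hx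
  have hperm := (List.subperm_of_subset hq.nodup_dlv hsub).perm_of_length_le (h₂.trans (h.trans h₁))
  exact fun x hx => hperm.mem_iff.2 hx

theorem pob (R : Represents D C φ) (N : NetworkRun P D C waiting seq)
    (F : FinalStates P D waiting seq σ B) (hU : UniqueUpdates C)
    (hall : ∀ p, ∀ x ∈ (σ p).enq, x ∈ (σ p).dlv) : POB P.owner P.init C := by
  have hdlv : ∀ p, ∀ x ∈ (σ p).dlv, x ∈ (σ p).enq :=
    fun p x hx => (F.deliverInv p).queues.mem_enq_of_mem_dlv hx
  -- Once everything enqueued is delivered, equal enqueued sets give equal delivered sets.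
  have henq : ∀ {p q x}, x ∈ (σ p).dlv → x ∈ (σ q).dlv := fun {p q x} hx =>
    hall q x (F.mem_enq_iff.2 (F.mem_enq_iff.1 (hdlv p x hx)))
  have hnd : ∀ p, ((σ p).dlv.map labeledUpdate).Nodup := fun p =>
    (F.deliverInv p).queues.nodup_dlv.map_on fun x hx y hy =>
      R.labeledUpdate_inj N F hU (hdlv p x hx) (hdlv p y hy)
  have hbef : ∀ {p u₁ l₁ u₂ l₂}, Before ((specSeq φ (seq p)).map Occ.op) (.deliver u₁ l₁) (.deliver u₂ l₂) ↔
      Before ((σ p).dlv.map labeledUpdate) (u₁, l₁) (u₂, l₂) := by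
    intro p u₁ l₁ u₂ l₂
    rw [← R.deliveries F]
    constructor
    · exact fun h => h.filterMap rfl rfl
    · intro h
      obtain ⟨a, b, hab, ha, hb⟩ := h.of_filterMap
      rw [SpecOp.deliver_eq_some] at ha hb
      subst ha hb; exact hab
  refine ⟨fun p => specSeq φ (seq p), fun p => ⟨R.total N p, ?_, ?_, ?_⟩, ?_, ?_, ?_⟩
  · rw [R.varOps]; exact (N.valid p).1
  · rw [R.deliveries F]; exact hnd p
  · intro u l h
    rw [R.map_op] at h
    obtain ⟨o, o', hoo, ho, ho'⟩ := h.of_filterMap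
    obtain ⟨x, y, hxy, rfl, rfl⟩ := hoo.of_map
    have hyp : P.owner y.1 = p := ((N.total p).2 y).1 hxy.mem_right
    obtain ⟨b, rfl⟩ := R.surj y (by rw [ho']; rfl)
    have hb : b.op = .bcast u l := Option.some.inj ((R.op b).symm.trans ho')
    rw [R.thread] at hyp
    have hsend := R.send_of_bcast N hb
    rw [hyp] at hsend
    -- The request is received at p after it is sent. A delivery before the broadcast would thus
    -- precede this receive in the log, which `LogOrder` forbids.
    obtain ⟨z, hz⟩ := (N.recv_iff_send _ _ _).2 ⟨φ b, hsend⟩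
    have hyz := N.ext p (φ b) (((N.total p).2 _).1 hxy.mem_right) z (N.dest_of_recv hz)
      (.single (.inr (.inl ⟨p, p, _, hsend, hz⟩)))
    have hxz := (hxy.trans (N.total p).1 hyz).map (f := Occ.op)
    have hx : x.op.deq?.map labeledUpdate = some (u, l) := by
      rw [← TargetOp.spec_bind_deliver, ho]; rfl
    obtain ⟨e, he, heu⟩ := Option.map_eq_some_iff.1 hx
    have hlog := hxz.filterMap (TargetOp.log_of_deq he) (b' := .inl (p, .localBroadcastRequest u l))
      (by rw [hz]; rfl)
    rw [← F.log] at hlog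
    have hed : e ∈ (σ p).dlv := (F.deliverInv p).logDlv e hlog.mem_left
    refine List.pairwise_iff_forall_sublist.1 (F.deliverInv p).log hlog e u l rfl ?_ rfl heu
    -- `LogOrder` speaks of elements with source p; uniqueness of the broadcast identifies the
    -- source of the delivered one.
    obtain ⟨a, ha, hau⟩ := (R.bcast_iff N F).1
      (List.mem_map.2 ⟨e, F.mem_enq_iff.1 (hdlv p e hed), heu⟩)
    rw [← ha, hU _ _ _ _ hau hb, hyp]
  · rintro p x hx y hy (hxy | ⟨u₁, l₁, u₂, l₂, hxu, hyu, b₁, b₂, hb₁, hb₂, hb⟩)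
    · refine R.before (N.ext_prog p _ ?_ _ ?_ (R.prog _ _ hxy))
      · exact (congrArg P.owner (R.thread x)).trans hx
      · exact (congrArg P.owner (R.thread y)).trans hy
    · have hs₁ := R.send_of_bcast N hb₁
      have hs₂ := R.send_of_bcast N hb₂
      rw [← hb.1] at hs₂
      have hrcv := N.before_recv hs₁ hs₂ (R.prog _ _ hb)
      rw [← F.rcv] at hrcv
      set s := P.owner b₁.1
      have hmsg : Before (rcvFrom s (σ s).rcv) (.localBroadcastRequest u₁ l₁)
          (.localBroadcastRequest u₂ l₂) := hrcv.filterMap (by simp) (by simp)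
      -- Requests travel over the channel from the process to itself in program order, so the
      -- elements made from them have increasing counters; deliveries of one source follow the
      -- counters.
      have hreq := hmsg.filterMap (f := Msg.request?) rfl rfl
      rw [← (F.sendInv s).requests] at hreq
      obtain ⟨e₁, e₂, he, h₁, h₂⟩ := hreq.of_map
      rw [← F.fromSrc_enq p s] at he
      have hlt := (List.pairwise_iff_forall_sublist.1 ((F.deliverInv p).queues.streamed s) he).2
      obtain ⟨hm₁, hs₁⟩ := mem_fromSrc.1 he.mem_left
      obtain ⟨hm₂, hs₂⟩ := mem_fromSrc.1 he.mem_right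
      have hd := ((before_or_before (hall p _ hm₁) (hall p _ hm₂)
        (by rintro rfl; exact lt_irrefl _ hlt)).resolve_right fun hr => lt_asymm hlt
          ((F.deliverInv p).queues.counter_lt hr (hs₂.trans hs₁.symm))).map (f := labeledUpdate)
      rw [h₁, h₂] at hd
      refine (before_or_before (((R.total N p).2 x).2 hx) (((R.total N p).2 y).2 hy) ?_).resolve_right
        fun hr => hd.asymm (hnd p) ?_
      · rintro rfl
        rw [hxu] at hyu
        injection hyu with hu hl
        exact hd.ne (hnd p) (by rw [hu, hl])
      · have := hr.map (f := Occ.op)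
        rw [hxu, hyu] at this
        exact hbef.1 this
  · have key : ∀ p q l u₁ u₂, DeliveredBefore ((specSeq φ (seq p)).map Occ.op) l u₁ u₂ →
        DeliveredBefore ((specSeq φ (seq q)).map Occ.op) l u₁ u₂ := by
      intro p q l u₁ u₂ h
      obtain ⟨e₁, e₂, he, h₁, h₂⟩ := (hbef.1 h).of_map
      refine hbef.2 ?_
      rw [← h₁, ← h₂]
      have hl : ∀ {e : Entry Proc U L} {u}, labeledUpdate e = (u, some l) → e.1 = .inl l := by
        rintro ⟨l' | q, e⟩ u h
        · simp only [labeledUpdate, queueLabel, Prod.mk.injEq, Option.some.injEq] at h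
          rw [h.2]
        · simp [labeledUpdate, queueLabel] at h
      -- The order of deliveries with one label is the order of keys, which are the same at every
      -- process.
      have hlt := List.pairwise_iff_forall_sublist.1 (F.deliverInv p).queues.sorted he l (hl h₁) (hl h₂)
      refine Before.map ?_
      refine (before_or_before (henq he.mem_left) (henq he.mem_right) ?_).resolve_right fun hr => ?_
      · rintro rfl; exact lt_irrefl _ hlt
      · exact lt_asymm hlt
          (List.pairwise_iff_forall_sublist.1 (F.deliverInv q).queues.sorted hr l (hl h₂) (hl h₁))
    exact fun p q l u₁ _ u₂ _ => ⟨key p q l u₁ u₂, key q p l u₁ u₂⟩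
  · intro p u l
    rw [R.deliver_iff N F]
    constructor
    · rintro ⟨o, ho⟩
      obtain ⟨e, he, heu⟩ := List.mem_map.1 ((R.bcast_iff N F).2 ⟨o, rfl, ho⟩)
      exact List.mem_map.2 ⟨e, hall p e (F.mem_enq_of_mem_arrivals he), heu⟩
    · intro h
      obtain ⟨e, he, heu⟩ := List.mem_map.1 h
      obtain ⟨o, _, ho⟩ := (R.bcast_iff N F).1 (List.mem_map.2 ⟨e, F.mem_enq_iff.1 (hdlv p e he), heu⟩)
      exact ⟨o, ho⟩

end Represents

end Broadcast

end TimestampBroadcast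

theorem mainTheorem3 {Proc Thr V Val U L : Type} [Finite Proc] [LinearOrder Proc] [Finite Thr]
    [Finite L] (P : Multiprogram Proc Thr V Val U L)
    (hP : ∀ t₁ t₂, P.owner t₁ = P.owner t₂ → P.CallsDeliver t₁ → P.CallsDeliver t₂ → t₁ = t₂)
    (D : MultiComputation Thr (TargetOp Proc V Val U L)) (C : MultiComputation Thr (SpecOp V Val U L))
    (waiting : Thr → Bool) (hD : IsTimestampComputation P D C waiting)
    (hNW : NW P.owner P.init D)
    (hU : UniqueUpdates C) (hdel : KeepsDelivering P C waiting) :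
    P.IsComputation C ∧ POB P.owner P.init C := by
  obtain ⟨seq, h₁, h₂, h₃⟩ := hNW
  have N : NetworkRun P D C waiting seq :=
    ⟨hP, hD, fun p => (h₁ p).1, fun p => (h₁ p).2, h₂, h₃⟩
  obtain ⟨σ, B, F⟩ := N.exists_finalStates
  obtain ⟨φ, k₁, k₂, k₃, k₄, k₅⟩ := exists_occ_embedding fun t => (hD t).filterMap_spec
  have R : Represents D C φ := ⟨k₁, k₂, k₃, k₄, k₅⟩
  refine ⟨fun t => (hD t).generates, R.pob N F hU fun p => ?_⟩
  -- The two ways to keep delivering lead to complete delivery by blocking and by counting.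
  rcases hdel p with ⟨t, rfl, ht⟩ | hc
  · exact F.dlv_of_blocked ht
  · exact R.dlv_of_count N F hU hc
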